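/- **Setting.** Let $\Phi\in C^1([0,\infty))\cap C^2((0,\infty))$ be strictly convex with $\Phi(0)=\Phi'(0)=0$, and assume that there are constants $C>0$ and $0<n,n'<3$ with $\Phi(r)\ge C r^{1+1/n}$ for all large $r$ and $\Phi(r)\le C r^{1+1/n'}$ for all small $r\ge 0$ (the two constants $C$ may differ). Put $P(r)=\int_0^r\sigma\Phi''(\sigma)\,d\sigma$. For a density $\rho\ge 0$ on $\mathbb R^3$ let $$V_\rho(x)=-\int\frac{\rho(y)}{|x-y|}\,dy,\qquad E_{\rm pot}(\rho)=-\frac12\iint\frac{\rho(x)\rho(y)}{|x-y|}\,dy\,dx,$$ $$\mathcal H_r(\rho)=\int\Phi(\rho)\,dx+E_{\rm pot}(\rho),\qquad \mathcal H(\rho,u)=\frac12\int|u|^2\rho\,dx+\mathcal H_r(\rho).$$ Fix $M>0$, let $$\mathcal F_M=\Bigl\{\rho\in L^1(\mathbb R^3)\ \Big|\ \rho\ge 0,\ \int\Phi(\rho)\,dx<\infty,\ \int\rho\,dx=M\Bigr\},$$ and let $\mathcal M_M\subset\mathcal F_M$ be the set of all minimizers of $\mathcal H_r$ over $\mathcal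 F_M$. For $\rho_0\in\mathcal M_M$ with $V_0=V_{\rho_0}$ let $E_0\le 0$ be its Lagrange multiplier, i.e. the number for which $\rho_0=(\Phi')^{-1}(E_0-V_0)$ a.e. where $V_0<E_0$ and $\rho_0=0$ a.e. where $V_0\ge E_0$. Put $$d(\rho,\rho_0)=\int\bigl[\Phi(\rho)-\Phi(\rho_0)+(V_0-E_0)(\rho-\rho_0)\bigr]dx,$$ $$D(\rho,u;\rho_0)=d(\rho,\rho_0)+\frac1{8\pi}\|\nabla V_\rho-\nabla V_{\rho_0}\|_2^2+\frac12\int|u|^2\rho\,dx,$$ and $T^a\rho_0=\rho_0(\cdot+a)$ for $a\in\mathbb R^3$. A *solution* is a weak (distributional) solution $t\mapsto(\rho(t),u(t))$, $\rho\ge0$, on a time interval $I\subset[0,\infty)$ with $0\in I$, with initial data $(\rho(0),u(0))$, of the Euler–Poisson system $$\partial_t\rho+\nabla\cdot(\rho u)=0,\qquad \partial_t(\rho u)+\nabla\cdot(\rho u\otimes u)=-\nabla P(\rho)-\rho\nabla V,\qquad V(t)=V_{\rho(t)}.$$ It *preserves mass and energy* if $\int\rho(t)\,dx$ and $\mathcal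 H(\rho(t),u(t))$ do not depend on $t\in I$. **Claim.** 1. For every $\epsilon>0$ there is a $\delta>0$ such that for every solution with $\rho(0)\in\mathcal F_M$ which preserves mass and energy, the initial estimate $$\inf_{\rho_0\in\mathcal M_M}D(\rho(0),u(0);\rho_0)<\delta$$ implies that for every $t\in I$ $$\inf_{\rho_0\in\mathcal M_M}D(\rho(t),u(t);\rho_0)<\epsilon.$$ 2. Let $\rho_0\in\mathcal M_M$ be isolated up to shifts, that is, $$\inf\bigl\{\|\nabla V_{\rho_0}-\nabla V_{\tilde\rho_0}\|_2\ \big|\ \tilde\rho_0\in\mathcal M_M\setminus\{T^a\rho_0\mid a\in\mathbb R^3\}\bigr\}>0$$ (with $\inf\emptyset=+\infty$). Then for every $\epsilon>0$ there is a $\delta>0$ such that for every solution with $\rho(0)\in\mathcal F_M$ which preserves mass and energy and for which $t\mapsto\inf_{a\in\mathbb R^3}D(\rho(t),u(t);T^a\rho_0)$ is continuous on $I$, the initial estimate $D(\rho(0),u(0);\rho_0)<\delta$ implies that for every $t\in I$ there is a shift vector $a\in\mathbb R^3$ with $D(\rho(t),u(t);T^a\rho_0)<\epsilon$. -/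

import Mathlib

open MeasureTheory Set
open scoped ENNReal ContDiff Gradient

noncomputable section

namespace EulerPoisson

/-- Physical space `ℝ³` with the Euclidean norm. -/
abbrev E3 : Type := EuclideanSpace ℝ (Fin 3)

/-! ### The function `Φ` and the equation of state -/

/-- The standing assumptions on `Φ`, including `Φ ∈ C²(]0,∞[)`. Only the values of `Φ` on `[0,∞[`
matter; `derivWithin Φ (Ici 0)` is the derivative on `[0,∞[`, one-sided at `0`. -/
structure Admissible (Φ : ℝ → ℝ) : Prop where
  contDiffOn_one : ContDiffOn ℝ 1 Φ (Ici 0)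
  contDiffOn_two : ContDiffOn ℝ 2 Φ (Ioi 0)
  map_zero : Φ 0 = 0
  deriv_zero : derivWithin Φ (Ici 0) 0 = 0
  strictConvexOn : StrictConvexOn ℝ (Ici 0) Φ
  growth_large : ∃ n C R : ℝ, 0 < n ∧ n < 3 ∧ 0 < C ∧ 0 < R ∧
    ∀ r, R ≤ r → C * r ^ (1 + 1 / n) ≤ Φ r
  growth_small : ∃ n' C R : ℝ, 0 < n' ∧ n' < 3 ∧ 0 < C ∧ 0 < R ∧
    ∀ r, 0 ≤ r → r ≤ R → Φ r ≤ C * r ^ (1 + 1 / n')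

/-- The equation of state `P(r) = ∫₀ʳ σ Φ''(σ) dσ`, so that `P'(r) = r Φ''(r)` for `r > 0`. -/
def pressure (Φ : ℝ → ℝ) (r : ℝ) : ℝ :=
  ∫ σ in (0 : ℝ)..r, σ * deriv (deriv Φ) σ

/-! ### Potential and gravitational field -/

/-- The induced potential `V_ρ(x) = - ∫ ρ(y) / |x - y| dy`. -/
def potential (ρ : E3 → ℝ) (x : E3) : ℝ :=
  - ∫ y, ρ y / ‖x - y‖

/-- `G` is the weak gradient of `V` on `ℝ³`. -/
def IsWeakGradient (V : E3 → ℝ) (G : E3 → E3) : Prop :=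
  LocallyIntegrable V volume ∧ LocallyIntegrable G volume ∧
    ∀ φ : E3 → ℝ, ContDiff ℝ ∞ φ → HasCompactSupport φ →
      ∫ x, V x • ∇ φ x = - ∫ x, φ x • G x

open Classical in
/-- A representative of the weak gradient of `V` (which is unique up to null sets), and `0` if `V`
is not weakly differentiable. -/
def weakGradient (V : E3 → ℝ) : E3 → E3 :=
  if h : ∃ G, IsWeakGradient V G then h.choose else 0

/-- `‖∇V_ρ - ∇V_σ‖₂`. -/
def fieldDist (ρ σ : E3 → ℝ) : ℝ≥0∞ :=
  eLpNorm (weakGradient (potential ρ) - weakGradient (potential σ)) 2 volume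

/-! ### Mass and energy

These are only applied to densities which are non-negative almost everywhere. -/

/-- The mass `∫ ρ dx`. -/
def mass (ρ : E3 → ℝ) : ℝ≥0∞ :=
  ∫⁻ x, ENNReal.ofReal (ρ x)

/-- The internal energy `∫ Φ(ρ) dx`. -/
def internalEnergy (Φ : ℝ → ℝ) (ρ : E3 → ℝ) : ℝ≥0∞ :=
  ∫⁻ x, ENNReal.ofReal (Φ (ρ x))

/-- The negative of the potential energy, `½ ∬ ρ(x) ρ(y) / |x - y| dy dx`. -/
def selfEnergy (ρ : E3 → ℝ) : ℝ≥0∞ :=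
  2⁻¹ * ∫⁻ x, ∫⁻ y, ENNReal.ofReal (ρ x * ρ y / ‖x - y‖)

/-- The kinetic energy `½ ∫ |u|² ρ dx`. -/
def kineticEnergy (ρ : E3 → ℝ) (u : E3 → E3) : ℝ≥0∞ :=
  2⁻¹ * ∫⁻ x, ENNReal.ofReal (‖u x‖ ^ 2 * ρ x)

/-- The total energy `H(ρ,u) = ½ ∫ |u|² ρ + ∫ Φ(ρ) - ½ ∬ ρ(x) ρ(y) / |x - y|`. It is a real number
if and only if all three terms are finite. -/
def energy (Φ : ℝ → ℝ) (ρ : E3 → ℝ) (u : E3 → E3) : EReal :=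
  ((kineticEnergy ρ u + internalEnergy Φ ρ : ℝ≥0∞) : EReal) - (selfEnergy ρ : EReal)

/-- The reduced energy `H_r(ρ) = ∫ Φ(ρ) + E_pot(ρ)`. -/
def reducedEnergy (Φ : ℝ → ℝ) (ρ : E3 → ℝ) : EReal :=
  (internalEnergy Φ ρ : EReal) - (selfEnergy ρ : EReal)

/-- The constraint set `F_M`. Its elements are functions, to be thought of as representatives of
their classes in `L¹`. -/
def constraintSet (Φ : ℝ → ℝ) (M : ℝ) : Set (E3 → ℝ) :=
  {ρ | Integrable ρ volume ∧ 0 ≤ᵐ[volume] ρ ∧ internalEnergy Φ ρ < ⊤ ∧ ∫ x, ρ x = M}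

/-- The set `M_M` of all minimizers of `H_r` over `F_M`. -/
def minimizers (Φ : ℝ → ℝ) (M : ℝ) : Set (E3 → ℝ) :=
  {ρ₀ | ρ₀ ∈ constraintSet Φ M ∧ ∀ ρ ∈ constraintSet Φ M, reducedEnergy Φ ρ₀ ≤ reducedEnergy Φ ρ}

/-- The shift `T^a ρ = ρ(· + a)`. -/
def shift (a : E3) (ρ : E3 → ℝ) : E3 → ℝ :=
  fun x => ρ (x + a)

/-! ### The distance to a minimizer -/

/-- `E` is the Lagrange multiplier of `ρ₀`: `E ≤ 0`, and `ρ₀ = (Φ')⁻¹(E - V₀)` where `V₀ < E`, and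
`ρ₀ = 0` where `V₀ ≥ E`. For a minimizer there is exactly one such number. -/
def IsMultiplier (Φ : ℝ → ℝ) (ρ₀ : E3 → ℝ) (E : ℝ) : Prop :=
  E ≤ 0 ∧ ∀ᵐ x,
    (potential ρ₀ x < E → 0 ≤ ρ₀ x ∧ derivWithin Φ (Ici 0) (ρ₀ x) = E - potential ρ₀ x) ∧
    (E ≤ potential ρ₀ x → ρ₀ x = 0)

/-- The Lagrange multiplier `E₀` of a minimizer `ρ₀`. -/
def multiplier (Φ : ℝ → ℝ) (ρ₀ : E3 → ℝ) : ℝ :=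
  Classical.epsilon (IsMultiplier Φ ρ₀)

/-- `d(ρ,ρ₀) = ∫ [Φ(ρ) - Φ(ρ₀) + (V₀ - E₀)(ρ - ρ₀)] dx`. -/
def dFun (Φ : ℝ → ℝ) (ρ ρ₀ : E3 → ℝ) : ℝ :=
  ∫ x, (Φ (ρ x) - Φ (ρ₀ x) + (potential ρ₀ x - multiplier Φ ρ₀) * (ρ x - ρ₀ x))

/-- `d(ρ,ρ₀) + (1/8π) ‖∇V_ρ - ∇V_{ρ₀}‖₂² + ½ ∫ |u|² ρ dx`. -/
def distTo (Φ : ℝ → ℝ) (ρ : E3 → ℝ) (u : E3 → E3) (ρ₀ : E3 → ℝ) : EReal :=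
  (dFun Φ ρ ρ₀ : EReal)
    + ((ENNReal.ofReal (1 / (8 * Real.pi)) * fieldDist ρ ρ₀ ^ 2 : ℝ≥0∞) : EReal)
    + (kineticEnergy ρ u : EReal)

/-- `ρ₀` is isolated up to shifts: the infimum `δ₀` of `‖∇V_{ρ₀} - ∇V_σ‖₂` over all minimizers `σ`
which are not (almost everywhere equal to) a shift of `ρ₀` is positive (`+∞` if there are none). -/
def IsolatedUpToShifts (Φ : ℝ → ℝ) (M : ℝ) (ρ₀ : E3 → ℝ) : Prop :=
  0 < ⨅ σ ∈ {σ ∈ minimizers Φ M | ¬ ∃ a : E3, σ =ᵐ[volume] shift a ρ₀}, fieldDist ρ₀ σ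

/-! ### Solutions of the Euler-Poisson system -/

/-- Space-time points `(t,x)` with `t` in the time interval `I`, its right end point removed. -/
def spaceTime (I : Set ℝ) : Set (ℝ × E3) :=
  {p | p.1 ∈ I ∧ ∃ s ∈ I, p.1 < s}

/-- Admissible supports of test functions: test functions vanish near the right end point of `I`
but need not vanish at `t = 0`. -/
def testRegion (I : Set ℝ) : Set (ℝ × E3) :=
  {p | ∃ s ∈ I, p.1 < s}

/-- The divergence in `x` of a time-dependent vector field. -/
def spaceDiv (ψ : ℝ × E3 → E3) (p : ℝ × E3) : ℝ :=
  ∑ i : Fin 3, fderiv ℝ ψ p (0, EuclideanSpace.single i 1) i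

/-- `(ρ,u)` is a weak (distributional) solution on the time interval `I ∋ 0` of the Euler-Poisson
system with equation of state `p = P(ρ)` and initial data `(ρ(0),u(0))`,
`∂ₜρ + ∇·(ρu) = 0`, `∂ₜ(ρu) + ∇·(ρ u ⊗ u) = -∇P(ρ) - ρ ∇V`, `V(t) = V_{ρ(t)}`;
`G` is the field `∇V`. By the first equation, the second one is
`ρ ∂ₜu + ρ (u·∇)u = -∇P(ρ) - ρ ∇V` for smooth solutions. -/
structure IsSolutionWithField (P : ℝ → ℝ) (I : Set ℝ) (ρ : ℝ → E3 → ℝ) (u G : ℝ → E3 → E3) :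
    Prop where
  ordConnected : I.OrdConnected
  zero_mem : 0 ∈ I
  nonneg_time : I ⊆ Ici 0
  measurable_density : ∀ t ∈ I, AEStronglyMeasurable (ρ t) volume
  measurable_velocity : ∀ t ∈ I, AEStronglyMeasurable (u t) volume
  density_nonneg : ∀ t ∈ I, 0 ≤ᵐ[volume] ρ t
  field : ∀ t ∈ I, IsWeakGradient (potential (ρ t)) (G t)
  initial_density : LocallyIntegrable (ρ 0) volume
  initial_momentum : LocallyIntegrable (fun x => ρ 0 x • u 0 x) volume
  density : LocallyIntegrableOn (fun p : ℝ × E3 => ρ p.1 p.2) (spaceTime I) volume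
  momentum : LocallyIntegrableOn (fun p : ℝ × E3 => ρ p.1 p.2 • u p.1 p.2) (spaceTime I) volume
  momentum_flux : ∀ i j : Fin 3, LocallyIntegrableOn
    (fun p : ℝ × E3 => ρ p.1 p.2 * u p.1 p.2 i * u p.1 p.2 j) (spaceTime I) volume
  pressure : LocallyIntegrableOn (fun p : ℝ × E3 => P (ρ p.1 p.2)) (spaceTime I) volume
  force : LocallyIntegrableOn (fun p : ℝ × E3 => ρ p.1 p.2 • G p.1 p.2) (spaceTime I) volume
  continuity_eq : ∀ φ : ℝ × E3 → ℝ, ContDiff ℝ ∞ φ → HasCompactSupport φ →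
    tsupport φ ⊆ testRegion I →
      ∫ p in spaceTime I, ρ p.1 p.2 * fderiv ℝ φ p (1, u p.1 p.2)
        + ∫ x, ρ 0 x * φ (0, x) = 0
  euler_eq : ∀ ψ : ℝ × E3 → E3, ContDiff ℝ ∞ ψ → HasCompactSupport ψ →
    tsupport ψ ⊆ testRegion I →
      ∫ p in spaceTime I,
          (ρ p.1 p.2 * inner ℝ (u p.1 p.2) (fderiv ℝ ψ p (1, u p.1 p.2))
            + P (ρ p.1 p.2) * spaceDiv ψ p
            - ρ p.1 p.2 * inner ℝ (G p.1 p.2) (ψ p))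
        + ∫ x, ρ 0 x * inner ℝ (u 0 x) (ψ (0, x)) = 0

/-- `(ρ,u)` is a solution of the Euler-Poisson system on the time interval `I`. -/
def IsSolution (P : ℝ → ℝ) (I : Set ℝ) (ρ : ℝ → E3 → ℝ) (u : ℝ → E3 → E3) : Prop :=
  ∃ G : ℝ → E3 → E3, IsSolutionWithField P I ρ u G

/-- `(ρ,u)` preserves mass and energy on `I`. -/
def PreservesMassEnergy (Φ : ℝ → ℝ) (I : Set ℝ) (ρ : ℝ → E3 → ℝ) (u : ℝ → E3 → E3) : Prop :=
  ∀ t ∈ I, mass (ρ t) = mass (ρ 0) ∧ energy Φ (ρ t) (u t) = energy Φ (ρ 0) (u 0)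

end EulerPoisson

end

open Filter Topology

noncomputable section

/-! ### Radial integrals and the kernel of the gravitational field -/

namespace EulerPoisson

/-! Write J(f,g) = ∬ f(x)g(y)/|x-y|. Everything rests on one identity and one compactness theorem.

The identity (`distTo_eq`): for densities f, g of equal mass, the multiplier drops out of d(f,g).
Expanding J(f,f) around g and using ‖∇V_f - ∇V_g‖² = 4π J(f-g,f-g) (`integral_norm_sq_gravField`)
gives D(f,u;g) = H_r(f) - H_r(g) + J(f-g,f-g) + kinetic energy. If g is a minimizer, this is the
energy excess e = H(f,u) - inf H_r plus J(f-g,f-g). For a solution preserving mass and energy, e is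
constant, nonnegative and at most the initial distance (`exists_excess`). Only J(ρ(t)-g,ρ(t)-g) can
vary, while H_r(ρ(t)) stays within e of its infimum.

The compactness theorem (`exists_near_minimizer`): a density of mass M with nearly minimal H_r is
close in the J-norm to some minimizer. Together with the identity this is the first claim.

To prove it, take a minimizing sequence. As n < 3, Φ dominates r^(4/3) at infinity, which makes H_r
coercive and bounds ∫ f^(4/3) (`exists_coercive`). The infimum is negative because n' < 3
(`infEnergy_neg`), so the mass cannot spread out, and after shifts a fixed amount stays near the
origin (`exists_concentration`). Scaling shows that dividing the mass M into tM and (1-t)M costs at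
least a fixed multiple of t(1-t) (`redEnergy_ge_of_mass`, `splitting_estimate`), so nothing escapes
to infinity (`tight_of_minimizing`). A weak limit then exists, ∫Φ is lower semicontinuous by
convexity (`phiInt_le_of_weak_limit`), and J is continuous by tightness and the L^(4/3) bound
(`coulomb_sub_self_small`). Hence the limit is a minimizer, approached in the J-norm.

For the second claim, isolation yields a gap: at each time the distance to the orbit of shifts of ρ₀
is either below η or at least c > η, according to whether the nearby minimizer is a shift of ρ₀
(`le_coulomb_of_isolated`). A continuous function starting below the gap cannot cross it. -/

lemma finrank_E3 : Module.finrank ℝ E3 = 3 := by simp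

/-- The area of the unit sphere. -/
lemma three_mul_volume_ball : (3 : ℝ) * volume.real (Metric.ball (0 : E3) 1) = 4 * Real.pi := by
  rw [measureReal_def, EuclideanSpace.volume_ball_fin_three]
  rw [ENNReal.toReal_mul, ENNReal.toReal_ofReal (by positivity)]
  simp
  ring

lemma integral_radial (f : ℝ → ℝ) :
    ∫ x : E3, f ‖x‖ = 4 * Real.pi * ∫ r in Ioi (0 : ℝ), r ^ 2 * f r := by
  rw [integral_fun_norm_addHaar, finrank_E3, ← three_mul_volume_ball]
  simp [mul_assoc]

lemma integrable_radial_iff {f : ℝ → ℝ} :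
    Integrable (fun x : E3 => f ‖x‖) ↔ IntegrableOn (fun r : ℝ => r ^ 2 * f r) (Ioi 0) := by
  rw [integrable_fun_norm_addHaar, finrank_E3]
  rfl

/-- The kernel `|z|⁻²` cut off outside of the ball of radius `r`. -/
def nearSq (r : ℝ) (z : E3) : ℝ := (Iio r).indicator (fun s => (s ^ 2)⁻¹) ‖z‖

/-- The kernel `|z|⁻⁴` cut off inside of the ball of radius `r`. -/
def farFourth (r : ℝ) (z : E3) : ℝ := (Ici r).indicator (fun s => (s ^ 4)⁻¹) ‖z‖

lemma nearSq_nonneg (r : ℝ) (z : E3) : 0 ≤ nearSq r z :=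
  indicator_nonneg (fun _ _ => by positivity) _

lemma farFourth_nonneg (r : ℝ) (z : E3) : 0 ≤ farFourth r z :=
  indicator_nonneg (fun _ _ => by positivity) _

lemma nearSq_aux {r : ℝ} : EqOn (fun s : ℝ => s ^ 2 * (Iio r).indicator (fun s => (s ^ 2)⁻¹) s)
    ((Ioo 0 r).indicator (fun _ => 1)) (Ioi 0) := by
  intro s hs
  have hs' : s ≠ 0 := ne_of_gt hs
  by_cases h : s < r
  · simp [h, mem_Ioi.1 hs, hs']
  · simp [h]

lemma integrable_nearSq (r : ℝ) : Integrable (nearSq r) := by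
  unfold nearSq
  rw [integrable_radial_iff, integrableOn_congr_fun nearSq_aux measurableSet_Ioi]
  refine Integrable.integrableOn ?_
  rw [integrable_indicator_iff measurableSet_Ioo]
  exact integrableOn_const (by simp)

lemma integral_nearSq {r : ℝ} (hr : 0 ≤ r) : ∫ z, nearSq r z = 4 * Real.pi * r := by
  unfold nearSq
  rw [integral_radial, setIntegral_congr_fun measurableSet_Ioi nearSq_aux,
    setIntegral_indicator measurableSet_Ioo]
  have : Ioi 0 ∩ Ioo 0 r = Ioo 0 r := by ext; simp
  rw [this]
  simp [hr]

lemma farFourth_aux {r : ℝ} :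
    EqOn (fun s : ℝ => s ^ 2 * (Ici r).indicator (fun s => (s ^ 4)⁻¹) s)
    ((Ici r).indicator (fun s => s ^ (-2 : ℝ))) (Ioi 0) := by
  intro s hs
  have hs' : 0 < s := hs
  by_cases h : r ≤ s
  · simp only [indicator, mem_Ici, h, if_true]
    rw [Real.rpow_neg hs'.le, show (2 : ℝ) = (2 : ℕ) by norm_num, Real.rpow_natCast]
    field_simp
  · simp [h]

lemma integrable_farFourth {r : ℝ} (hr : 0 < r) : Integrable (farFourth r) := by
  unfold farFourth
  rw [integrable_radial_iff, integrableOn_congr_fun farFourth_aux measurableSet_Ioi]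
  refine Integrable.integrableOn ?_
  rw [integrable_indicator_iff measurableSet_Ici, integrableOn_Ici_iff_integrableOn_Ioi]
  exact integrableOn_Ioi_rpow_of_lt (by norm_num) hr

lemma integral_farFourth {r : ℝ} (hr : 0 < r) : ∫ z, farFourth r z = 4 * Real.pi * r⁻¹ := by
  unfold farFourth
  rw [integral_radial, setIntegral_congr_fun measurableSet_Ioi farFourth_aux,
    setIntegral_indicator measurableSet_Ici]
  have : Ioi 0 ∩ Ici r = Ici r := by ext; simp; intro h; linarith
  rw [this, integral_Ici_eq_integral_Ioi, integral_Ioi_rpow_of_lt (by norm_num) hr]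
  norm_num [Real.rpow_neg_one]

/-- The pointwise bound behind `∫ |x|⁻² |x - w|⁻² dx ≤ C / |w|`. -/
lemma inv_sq_mul_inv_sq_le {w : E3} (hw : w ≠ 0) (x : E3) :
    (‖x‖ ^ 2)⁻¹ * (‖x - w‖ ^ 2)⁻¹ ≤
      (4 / ‖w‖ ^ 2 * nearSq (‖w‖ / 2) x + farFourth (‖w‖ / 2) x) +
      (4 / ‖w‖ ^ 2 * nearSq (‖w‖ / 2) (x - w) + farFourth (‖w‖ / 2) (x - w)) := by
  have hw' : 0 < ‖w‖ := norm_pos_iff.2 hw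
  have htri : ‖w‖ ≤ ‖x‖ + ‖x - w‖ := by
    calc ‖w‖ = ‖x - (x - w)‖ := by simp
      _ ≤ _ := norm_sub_le _ _
  have key : ∀ a b : ℝ, 0 ≤ a → ‖w‖ / 2 ≤ b → (a ^ 2)⁻¹ * (b ^ 2)⁻¹ ≤ 4 / ‖w‖ ^ 2 * (a ^ 2)⁻¹ := by
    intro a b ha hb
    rw [mul_comm]
    refine mul_le_mul_of_nonneg_right ?_ (by positivity)
    rw [show 4 / ‖w‖ ^ 2 = ((‖w‖ / 2) ^ 2)⁻¹ by field_simp; norm_num]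
    gcongr
  have n1 := nearSq_nonneg (‖w‖ / 2) x
  have n2 := nearSq_nonneg (‖w‖ / 2) (x - w)
  have f1 := farFourth_nonneg (‖w‖ / 2) x
  have f2 := farFourth_nonneg (‖w‖ / 2) (x - w)
  have c0 : 0 ≤ 4 / ‖w‖ ^ 2 := by positivity
  have m1 := mul_nonneg c0 n1
  have m2 := mul_nonneg c0 n2
  -- Within |w|/2 of one pole, the distance to the other is at least |w|/2, so that factor is at
  -- most 4/|w|². Away from both poles, ab ≤ a² + b² leaves fourth powers.
  by_cases h1 : ‖x‖ < ‖w‖ / 2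
  · have := key ‖x‖ ‖x - w‖ (norm_nonneg _) (by linarith)
    have e : nearSq (‖w‖ / 2) x = (‖x‖ ^ 2)⁻¹ := by simp [nearSq, h1]
    rw [← e] at this ⊢
    linarith
  · by_cases h2 : ‖x - w‖ < ‖w‖ / 2
    · have := key ‖x - w‖ ‖x‖ (norm_nonneg _) (by linarith)
      have e : nearSq (‖w‖ / 2) (x - w) = (‖x - w‖ ^ 2)⁻¹ := by simp [nearSq, h2]
      rw [← e] at this ⊢
      rw [mul_comm]
      linarith
    · have e1 : farFourth (‖w‖ / 2) x = (‖x‖ ^ 2)⁻¹ ^ 2 := by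
        simp [farFourth, not_lt.1 h1, ← pow_mul]
      have e2 : farFourth (‖w‖ / 2) (x - w) = (‖x - w‖ ^ 2)⁻¹ ^ 2 := by
        simp [farFourth, not_lt.1 h2, ← pow_mul]
      rw [e1, e2]
      nlinarith [sq_nonneg ((‖x‖ ^ 2)⁻¹ - (‖x - w‖ ^ 2)⁻¹), sq_nonneg (‖x‖ ^ 2)⁻¹,
        sq_nonneg (‖x - w‖ ^ 2)⁻¹]

lemma integrable_inv_sq_mul_inv_sq {w : E3} (hw : w ≠ 0) :
    Integrable (fun x : E3 => (‖x‖ ^ 2)⁻¹ * (‖x - w‖ ^ 2)⁻¹) := by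
  have hw' : 0 < ‖w‖ / 2 := half_pos (norm_pos_iff.2 hw)
  have h := ((integrable_nearSq (‖w‖ / 2)).const_mul (4 / ‖w‖ ^ 2)).add (integrable_farFourth hw')
  refine (h.add (h.comp_sub_right w)).mono' (by fun_prop) (ae_of_all _ fun x => ?_)
  rw [Real.norm_of_nonneg (by positivity)]
  exact inv_sq_mul_inv_sq_le hw x

lemma integral_inv_sq_mul_inv_sq_le {w : E3} (hw : w ≠ 0) :
    ∫ x : E3, (‖x‖ ^ 2)⁻¹ * (‖x - w‖ ^ 2)⁻¹ ≤ 32 * Real.pi / ‖w‖ := by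
  have hw' : 0 < ‖w‖ / 2 := half_pos (norm_pos_iff.2 hw)
  have i1 := (integrable_nearSq (‖w‖ / 2)).const_mul (4 / ‖w‖ ^ 2)
  have i2 := integrable_farFourth hw'
  have h := i1.add i2
  set F : E3 → ℝ := (fun x => 4 / ‖w‖ ^ 2 * nearSq (‖w‖ / 2) x) + farFourth (‖w‖ / 2) with hF
  have e : ∫ x, F x = 16 * Real.pi / ‖w‖ := by
    rw [hF, integral_add' i1 i2, integral_const_mul, integral_nearSq hw'.le,
      integral_farFourth hw']
    have := norm_pos_iff.2 hw
    field_simp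
    ring
  calc ∫ x : E3, (‖x‖ ^ 2)⁻¹ * (‖x - w‖ ^ 2)⁻¹ ≤ ∫ x, (F x + F (x - w)) :=
        integral_mono (integrable_inv_sq_mul_inv_sq hw) (h.add (h.comp_sub_right w))
          (inv_sq_mul_inv_sq_le hw)
    _ = 32 * Real.pi / ‖w‖ := by
      rw [integral_add h (h.comp_sub_right w), integral_sub_right_eq_self F w, e]
      ring

/-- The kernel `z / |z|³` of the gravitational field. -/
def fieldKernel (z : E3) : E3 := (‖z‖ ^ 3)⁻¹ • z

lemma norm_fieldKernel (z : E3) : ‖fieldKernel z‖ = (‖z‖ ^ 2)⁻¹ := by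
  rcases eq_or_ne z 0 with rfl | hz
  · simp [fieldKernel]
  · have := norm_pos_iff.2 hz
    rw [fieldKernel, norm_smul, norm_inv, norm_pow, norm_norm]
    field_simp

lemma measurable_fieldKernel : Measurable fieldKernel := by
  unfold fieldKernel; fun_prop

lemma integrable_inner_fieldKernel {w : E3} (hw : w ≠ 0) :
    Integrable (fun x : E3 => inner ℝ (fieldKernel x) (fieldKernel (x - w))) := by
  have m := measurable_fieldKernel
  refine (integrable_inv_sq_mul_inv_sq hw).mono' (by fun_prop) (ae_of_all _ fun x => ?_)
  rw [← norm_fieldKernel, ← norm_fieldKernel]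
  exact norm_inner_le_norm _ _

/-! ### Polar coordinates for non-radial integrands, and the composition of two field kernels. -/

lemma integrable_volumeIoiPow_iff {f : ℝ → ℝ} :
    Integrable (fun r : Ioi (0 : ℝ) => f r) (Measure.volumeIoiPow 2) ↔
      IntegrableOn (fun r : ℝ => r ^ 2 * f r) (Ioi 0) := by
  rw [integrableOn_iff_comap_subtypeVal measurableSet_Ioi, Measure.volumeIoiPow,
    integrable_withDensity_iff_integrable_smul' (by fun_prop) (by simp)]
  refine integrable_congr (ae_of_all _ ?_)
  rintro ⟨x, hx : 0 < x⟩
  simp (disch := positivity) [ENNReal.toReal_ofReal]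

lemma integral_volumeIoiPow (f : ℝ → ℝ) :
    ∫ r : Ioi (0 : ℝ), f r ∂(Measure.volumeIoiPow 2) = ∫ r in Ioi (0 : ℝ), r ^ 2 * f r := by
  simp only [Measure.volumeIoiPow, ENNReal.ofReal]
  rw [integral_withDensity_eq_integral_smul (by fun_prop),
    integral_subtype_comap measurableSet_Ioi fun a : ℝ ↦ Real.toNNReal (a ^ 2) • f a,
    setIntegral_congr_fun measurableSet_Ioi fun x hx ↦ ?_]
  rw [NNReal.smul_def, Real.coe_toNNReal _ (by positivity), smul_eq_mul]

lemma integrable_polar {F : E3 → ℝ} (hF : Integrable F) :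
    Integrable (fun p : Metric.sphere (0 : E3) 1 × Ioi (0 : ℝ) => F ((p.2 : ℝ) • (p.1 : E3)))
      ((volume : Measure E3).toSphere.prod (Measure.volumeIoiPow 2)) ∧
    ∫ p : Metric.sphere (0 : E3) 1 × Ioi (0 : ℝ), F ((p.2 : ℝ) • (p.1 : E3))
      ∂((volume : Measure E3).toSphere.prod (Measure.volumeIoiPow 2)) = ∫ x, F x := by
  have mp := (volume : Measure E3).measurePreserving_homeomorphUnitSphereProd
  rw [finrank_E3] at mp
  have e : (fun p : Metric.sphere (0 : E3) 1 × Ioi (0 : ℝ) => F ((p.2 : ℝ) • (p.1 : E3))) ∘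
      homeomorphUnitSphereProd E3 = F ∘ Subtype.val := by
    ext x
    have : ‖(x : E3)‖ ≠ 0 := norm_ne_zero_iff.2 x.2
    simp [smul_smul, this]
  constructor
  · rw [← mp.integrable_comp_emb (Homeomorph.measurableEmbedding _), e,
      ← integrableOn_iff_comap_subtypeVal (measurableSet_singleton _).compl]
    exact hF.integrableOn
  · rw [← mp.integral_comp (Homeomorph.measurableEmbedding _)
      (fun p : Metric.sphere (0 : E3) 1 × Ioi (0 : ℝ) => F ((p.2 : ℝ) • (p.1 : E3)))]
    calc _ = ∫ x : ({(0 : E3)}ᶜ : Set E3), F x ∂((volume : Measure E3).comap (↑)) :=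
          integral_congr_ae (ae_of_all _ fun x => congrFun e x)
      _ = _ := by
        rw [integral_subtype_comap (measurableSet_singleton _).compl F, restrict_compl_singleton]

lemma ae_integrableOn_polar {F : E3 → ℝ} (hF : Integrable F) :
    ∀ᵐ θ : Metric.sphere (0 : E3) 1 ∂(volume : Measure E3).toSphere,
      IntegrableOn (fun r : ℝ => r ^ 2 * F (r • (θ : E3))) (Ioi 0) := by
  filter_upwards [(integrable_polar hF).1.prod_right_ae] with θ hθ
  exact (integrable_volumeIoiPow_iff (f := fun r => F (r • (θ : E3)))).1 hθ

lemma integral_polar {F : E3 → ℝ} (hF : Integrable F) :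
    ∫ x, F x = ∫ θ : Metric.sphere (0 : E3) 1, (∫ r in Ioi (0 : ℝ), r ^ 2 * F (r • (θ : E3)))
      ∂(volume : Measure E3).toSphere := by
  rw [← (integrable_polar hF).2, integral_prod _ (integrable_polar hF).1]
  refine integral_congr_ae (ae_of_all _ fun θ => ?_)
  exact integral_volumeIoiPow (fun r => F (r • (θ : E3)))

/-- A line is a null set in ℝ³, so almost every ray misses a given w ≠ 0. This permits the
fundamental theorem of calculus along almost every ray from the origin. -/
lemma ae_toSphere_notMem_ray (w : E3) :
    ∀ᵐ θ : Metric.sphere (0 : E3) 1 ∂(volume : Measure E3).toSphere, ∀ r : ℝ, w = r • (θ : E3) → w = 0 := by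
  by_cases hw : w = 0
  · simp [hw]
  have hs : MeasurableSet ((Subtype.val : Metric.sphere (0 : E3) 1 → E3) ⁻¹' (ℝ ∙ w : Submodule ℝ E3)) :=
    ((ℝ ∙ w).closed_of_finiteDimensional.measurableSet).preimage measurable_subtype_coe
  have h0 : (volume : Measure E3) (ℝ ∙ w : Submodule ℝ E3) = 0 := by
    refine Measure.addHaar_submodule _ _ fun h => ?_
    have := finrank_span_singleton (K := ℝ) hw
    rw [h, finrank_top, finrank_E3] at this
    omega
  have : (volume : Measure E3).toSphere
      ((Subtype.val : Metric.sphere (0 : E3) 1 → E3) ⁻¹' (ℝ ∙ w : Submodule ℝ E3)) = 0 := by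
    rw [Measure.toSphere_apply' _ hs, measure_mono_null _ h0, mul_zero]
    rintro _ ⟨r, -, _, ⟨θ, hθ, rfl⟩, rfl⟩
    exact Submodule.smul_mem _ _ hθ
  filter_upwards [compl_mem_ae_iff.2 this] with θ hθ r hr
  exfalso
  apply hθ
  have hr0 : r ≠ 0 := by rintro rfl; simp at hr; exact hw hr
  refine Submodule.mem_span_singleton.2 ⟨r⁻¹, ?_⟩
  rw [hr, smul_smul, inv_mul_cancel₀ hr0, one_smul]

lemma hasDerivAt_inv_norm_ray {θ w : E3} {r : ℝ} (h : r • θ - w ≠ 0) :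
    HasDerivAt (fun s : ℝ => -‖s • θ - w‖⁻¹) (inner ℝ θ (fieldKernel (r • θ - w))) r := by
  have h1 : HasDerivAt (fun s : ℝ => s • θ - w) θ r := by
    simpa using ((hasDerivAt_id r).smul_const θ).sub_const w
  have h2 := (h1.norm_sq).sqrt (by positivity)
  have h3 := (h2.inv (by positivity)).neg
  have h0 : ‖r • θ - w‖ ≠ 0 := norm_ne_zero_iff.2 h
  have e : ∀ s : ℝ, √(‖s • θ - w‖ ^ 2) = ‖s • θ - w‖ := fun s => Real.sqrt_sq (norm_nonneg _)
  simp only [e] at h3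
  refine HasDerivAt.congr_deriv h3 ?_
  rw [fieldKernel, inner_smul_right, real_inner_comm]
  field_simp

lemma radial_inner_fieldKernel {θ w : E3} (hθ : ‖θ‖ = 1) {r : ℝ} (hr : 0 < r) :
    r ^ 2 * inner ℝ (fieldKernel (r • θ)) (fieldKernel (r • θ - w)) =
      inner ℝ θ (fieldKernel (r • θ - w)) := by
  rw [fieldKernel, norm_smul, hθ, inner_smul_left, inner_smul_left, Real.norm_of_nonneg hr.le]
  simp
  field_simp

/-- The polar weight r² cancels the kernel centred at the origin. What remains on the ray through θ
is the derivative of -1/|rθ - w|, so each ray contributes 1/|w|, and the sphere has area 4π. -/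
lemma integral_inner_fieldKernel {w : E3} (hw : w ≠ 0) :
    ∫ x : E3, inner ℝ (fieldKernel x) (fieldKernel (x - w)) = 4 * Real.pi / ‖w‖ := by
  have hi := integrable_inner_fieldKernel hw
  rw [integral_polar hi]
  have : ∀ᵐ θ : Metric.sphere (0 : E3) 1 ∂(volume : Measure E3).toSphere, ∫ r in Ioi (0 : ℝ),
      r ^ 2 * inner ℝ (fieldKernel (r • (θ : E3))) (fieldKernel (r • (θ : E3) - w)) = ‖w‖⁻¹ := by
    filter_upwards [ae_integrableOn_polar hi, ae_toSphere_notMem_ray w] with θ h1 h2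
    have hθ : ‖(θ : E3)‖ = 1 := by simp
    have hne : ∀ r : ℝ, r • (θ : E3) - w ≠ 0 := fun r h => hw (h2 r (sub_eq_zero.1 h).symm)
    have hcongr : EqOn (fun r : ℝ => r ^ 2 * inner ℝ (fieldKernel (r • (θ : E3)))
        (fieldKernel (r • (θ : E3) - w)))
        (fun r : ℝ => inner ℝ (θ : E3) (fieldKernel (r • (θ : E3) - w))) (Ioi 0) :=
      fun r hr => radial_inner_fieldKernel hθ hr
    rw [setIntegral_congr_fun measurableSet_Ioi hcongr]
    rw [integrableOn_congr_fun hcongr measurableSet_Ioi] at h1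
    have hd : ∀ r : ℝ, HasDerivAt (fun s : ℝ => -‖s • (θ : E3) - w‖⁻¹)
      (inner ℝ (θ : E3) (fieldKernel (r • (θ : E3) - w))) r :=
      fun r => hasDerivAt_inv_norm_ray (hne r)
    rw [integral_Ioi_of_hasDerivAt_of_tendsto (m := 0) (hd 0).continuousAt.continuousWithinAt
      (fun r _ => hd r) h1]
    · simp
    · suffices h : Tendsto (fun s : ℝ => ‖s • (θ : E3) - w‖⁻¹) atTop (𝓝 0) by simpa using h.neg
      refine tendsto_inv_atTop_zero.comp ?_
      refine tendsto_atTop_mono' _ (f₁ := fun s : ℝ => s - ‖w‖) ?_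
        (tendsto_atTop_add_const_right _ _ tendsto_id)
      filter_upwards [eventually_ge_atTop 0] with s hs
      have := norm_sub_norm_le (s • (θ : E3)) w
      rwa [norm_smul, hθ, Real.norm_of_nonneg hs, mul_one] at this
  rw [integral_congr_ae this, integral_const, Measure.toSphere_real_apply_univ, finrank_E3]
  push_cast
  rw [three_mul_volume_ball, smul_eq_mul, div_eq_mul_inv]

end EulerPoisson

/-! ### Local integrability of convolutions with the kernels -/

namespace EulerPoisson

lemma inv_norm_le (z : E3) : ‖z‖⁻¹ ≤ nearSq 1 z + 1 := by
  rcases eq_or_ne z 0 with rfl | hz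
  · have := nearSq_nonneg 1 (0 : E3)
    simp; linarith
  have h0 := norm_pos_iff.2 hz
  by_cases h : ‖z‖ < 1
  · have e : nearSq 1 z = (‖z‖ ^ 2)⁻¹ := by simp [nearSq, h]
    have : ‖z‖⁻¹ ≤ (‖z‖ ^ 2)⁻¹ := by
      gcongr; nlinarith
    rw [e]; linarith
  · have : ‖z‖⁻¹ ≤ 1 := inv_le_one_of_one_le₀ (not_lt.1 h)
    have := nearSq_nonneg 1 z
    linarith

lemma inv_norm_sq_le (z : E3) : (‖z‖ ^ 2)⁻¹ ≤ nearSq 1 z + 1 := by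
  by_cases h : ‖z‖ < 1
  · have e : nearSq 1 z = (‖z‖ ^ 2)⁻¹ := by simp [nearSq, h]
    rw [e]; linarith
  · have : (‖z‖ ^ 2)⁻¹ ≤ 1 := inv_le_one_of_one_le₀ (one_le_pow₀ (not_lt.1 h))
    have := nearSq_nonneg 1 z
    linarith

variable {F : Type*} [NormedAddCommGroup F] [NormedSpace ℝ F]

/-- Domination by an integrable function plus a constant is all that is asked of the kernel; this
treats 1/|z| and z/|z|³ at once. -/
lemma integrable_smul_kernel {k : E3 → F} (hk : AEStronglyMeasurable k)
    (hk' : ∀ z, ‖k z‖ ≤ nearSq 1 z + 1) {φ : E3 → ℝ} (hφ : Integrable φ) {C : ℝ}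
    (hC : ∀ x, |φ x| ≤ C) (y : E3) : Integrable (fun x => φ x • k (x - y)) := by
  have hC0 : 0 ≤ C := (abs_nonneg _).trans (hC 0)
  refine (((integrable_nearSq 1).comp_sub_right y).const_mul C |>.add hφ.norm).mono'
    (hφ.1.smul (hk.comp_quasiMeasurePreserving
      (measurePreserving_sub_right volume y).quasiMeasurePreserving)) (ae_of_all _ fun x => ?_)
  rw [norm_smul, Real.norm_eq_abs]
  calc |φ x| * ‖k (x - y)‖ ≤ |φ x| * (nearSq 1 (x - y) + 1) := by gcongr; exact hk' _
    _ ≤ C * nearSq 1 (x - y) + |φ x| := by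
      nlinarith [mul_le_mul_of_nonneg_right (hC x) (nearSq_nonneg 1 (x - y))]

lemma integrable_prod_kernel {k : E3 → F} (hk : StronglyMeasurable k)
    (hk' : ∀ z, ‖k z‖ ≤ nearSq 1 z + 1) {φ : E3 → ℝ} (hφ : Integrable φ) {C : ℝ}
    (hC : ∀ x, |φ x| ≤ C) {f : E3 → ℝ} (hf : Integrable f) :
    Integrable (fun p : E3 × E3 => (φ p.1 * f p.2) • k (p.1 - p.2)) (volume.prod volume) := by
  have hC0 : 0 ≤ C := (abs_nonneg _).trans (hC 0)
  have h1 := (hf.norm.convolution_integrand (ContinuousLinearMap.mul ℝ ℝ)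
    (integrable_nearSq 1) (μ := volume)).const_mul C
  have h2 := hφ.norm.mul_prod hf.norm
  refine (h1.add h2).mono' ((hφ.1.comp_fst.mul hf.1.comp_snd).smul
    (hk.comp_measurable (measurable_fst.sub measurable_snd)).aestronglyMeasurable)
    (ae_of_all _ fun p => ?_)
  simp only [norm_smul, norm_mul, Pi.add_apply, ContinuousLinearMap.mul_apply', Real.norm_eq_abs]
  calc |φ p.1| * |f p.2| * ‖k (p.1 - p.2)‖
      ≤ |φ p.1| * |f p.2| * (nearSq 1 (p.1 - p.2) + 1) := by gcongr; exact hk' _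
    _ ≤ C * (|f p.2| * nearSq 1 (p.1 - p.2)) + |φ p.1| * |f p.2| := by
      nlinarith [mul_le_mul_of_nonneg_right (hC p.1)
        (mul_nonneg (abs_nonneg (f p.2)) (nearSq_nonneg 1 (p.1 - p.2)))]

lemma locallyIntegrable_integral_kernel {k : E3 → F} (hk : StronglyMeasurable k)
    (hk' : ∀ z, ‖k z‖ ≤ nearSq 1 z + 1) {f : E3 → ℝ} (hf : Integrable f) :
    LocallyIntegrable (fun x => ∫ y, f y • k (x - y)) := by
  rw [locallyIntegrable_iff]
  intro S hS
  have hφ : Integrable (S.indicator (fun _ => (1 : ℝ))) :=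
    (integrable_indicator_iff hS.measurableSet).2 (integrableOn_const hS.measure_ne_top)
  have h := (integrable_prod_kernel hk hk' hφ (C := 1) (fun x => by
    by_cases h : x ∈ S <;> simp [h]) hf).integral_prod_left
  rw [← integrable_indicator_iff hS.measurableSet]
  refine h.congr (ae_of_all _ fun x => ?_)
  by_cases hx : x ∈ S <;> simp [hx]

lemma ae_integrable_kernel {k : E3 → F} (hk : StronglyMeasurable k)
    (hk' : ∀ z, ‖k z‖ ≤ nearSq 1 z + 1) {f : E3 → ℝ} (hf : Integrable f) :
    ∀ᵐ x, Integrable (fun y => f y • k (x - y)) := by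
  have : ∀ᵐ x : E3, ∀ n : ℕ, x ∈ Metric.ball (0 : E3) n → Integrable (fun y => f y • k (x - y)) := by
    rw [ae_all_iff]
    intro n
    have hφ : Integrable ((Metric.ball (0 : E3) n).indicator (fun _ => (1 : ℝ))) :=
      (integrable_indicator_iff Metric.isOpen_ball.measurableSet).2
        (integrableOn_const measure_ball_lt_top.ne)
    filter_upwards [(integrable_prod_kernel hk hk' hφ (C := 1) (fun x => by
      by_cases h : x ∈ Metric.ball (0 : E3) n <;> simp [indicator, h]) hf).prod_right_ae] with x hx hxn
    simpa [hxn, indicator] using hx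
  filter_upwards [this] with x hx
  obtain ⟨n, hn⟩ := exists_nat_gt ‖x‖
  exact hx n (by simpa using hn)

lemma stronglyMeasurable_fieldKernel : StronglyMeasurable fieldKernel :=
  measurable_fieldKernel.stronglyMeasurable

lemma stronglyMeasurable_inv_norm : StronglyMeasurable (fun z : E3 => ‖z‖⁻¹) :=
  Measurable.stronglyMeasurable (by fun_prop)

lemma norm_inv_norm_le (z : E3) : ‖‖z‖⁻¹‖ ≤ nearSq 1 z + 1 := by
  simpa using inv_norm_le z

lemma norm_fieldKernel_le (z : E3) : ‖fieldKernel z‖ ≤ nearSq 1 z + 1 := by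
  rw [norm_fieldKernel]; exact inv_norm_sq_le z

/-- The smooth kernel `(|z|² + s²)^(-1/2)`. -/
def smoothKernel (s : ℝ) (z : E3) : ℝ := (√(‖z‖ ^ 2 + s ^ 2))⁻¹

lemma smoothKernel_le {s : ℝ} (z : E3) : smoothKernel s z ≤ (√(‖z‖ ^ 2))⁻¹ ∨ z = 0 := by
  by_cases h : z = 0
  · exact Or.inr h
  left
  have := norm_pos_iff.2 h
  unfold smoothKernel
  gcongr
  nlinarith [sq_nonneg s]

lemma hasFDerivAt_smoothKernel {s : ℝ} (hs : 0 < s) (y x : E3) :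
    HasFDerivAt (fun x => smoothKernel s (x - y))
      (-((smoothKernel s (x - y)) ^ 3) • innerSL ℝ (x - y)) x := by
  have h1 : HasFDerivAt (fun x : E3 => ‖x - y‖ ^ 2 + s ^ 2) (2 • innerSL ℝ (x - y)) x := by
    have := (((hasFDerivAt_id (𝕜 := ℝ) x).sub_const y).norm_sq).add_const (s ^ 2)
    refine this.congr_fderiv ?_
    ext v; simp
  have hp : ‖x - y‖ ^ 2 + s ^ 2 ≠ 0 := by positivity
  have h2 := (h1.sqrt hp)
  have h3 := (hasDerivAt_inv (x := √(‖x - y‖ ^ 2 + s ^ 2)) (by positivity)).comp_hasFDerivAt x h2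
  refine HasFDerivAt.congr_fderiv h3 ?_
  have hq : √(‖x - y‖ ^ 2 + s ^ 2) ≠ 0 := by positivity
  ext v
  simp [smoothKernel]
  field_simp

end EulerPoisson

/-! ### The weak gradient of the potential -/

namespace EulerPoisson

lemma continuous_smoothKernel {s : ℝ} (hs : 0 < s) : Continuous (smoothKernel s) := by
  unfold smoothKernel
  refine Continuous.inv₀ (by fun_prop) fun x => ?_
  positivity

lemma smoothKernel_nonneg (s : ℝ) (z : E3) : 0 ≤ smoothKernel s z := by
  unfold smoothKernel; positivity

lemma smoothKernel_le_inv_norm {s : ℝ} {z : E3} (hz : z ≠ 0) : smoothKernel s z ≤ ‖z‖⁻¹ := by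
  have := (smoothKernel_le (s := s) z).resolve_right hz
  rwa [Real.sqrt_sq (norm_nonneg _)] at this

lemma integral_smoothKernel_mul_fderiv {s : ℝ} (hs : 0 < s) {φ : E3 → ℝ} (hφ : ContDiff ℝ ∞ φ)
    (hc : HasCompactSupport φ) (y e : E3) :
    ∫ x, smoothKernel s (x - y) * fderiv ℝ φ x e =
      ∫ x, φ x * (smoothKernel s (x - y) ^ 3 * inner ℝ (x - y) e) := by
  have hd := fun x => hasFDerivAt_smoothKernel hs y x
  have hφ' : Continuous (fun x => fderiv ℝ φ x e) :=
    (hφ.continuous_fderiv (by simp)).clm_apply continuous_const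
  have hk : Continuous (fun x => smoothKernel s (x - y)) :=
    (continuous_smoothKernel hs).comp (by fun_prop)
  have hfd : ∀ x, fderiv ℝ (fun x => smoothKernel s (x - y)) x e =
      -(smoothKernel s (x - y) ^ 3 * inner ℝ (x - y) e) := by
    intro x; rw [(hd x).fderiv]; simp [inner_sub_left]
  have hcd : HasCompactSupport (fun x => fderiv ℝ φ x e) := hc.fderiv_apply ℝ e
  rw [integral_mul_fderiv_eq_neg_fderiv_mul_of_integrable]
  · rw [← integral_neg]
    refine integral_congr_ae (ae_of_all _ fun x => ?_)
    simp only [hfd]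
    ring
  · simp only [hfd]
    refine Continuous.integrable_of_hasCompactSupport ?_ hc.mul_left
    exact ((hk.pow 3).mul (by fun_prop)).neg.mul hφ.continuous
  · exact Continuous.integrable_of_hasCompactSupport (hk.mul hφ') hcd.mul_left
  · exact Continuous.integrable_of_hasCompactSupport (hk.mul hφ.continuous) hc.mul_left
  · exact fun x _ => (hd x).differentiableAt
  · exact fun x _ => (hφ.differentiable (by simp)) x

lemma tendsto_smoothKernel {z : E3} (hz : z ≠ 0) :
    Tendsto (fun n : ℕ => smoothKernel (1 / ((n : ℝ) + 1)) z) atTop (𝓝 ‖z‖⁻¹) := by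
  have h0 : ‖z‖ ≠ 0 := norm_ne_zero_iff.2 hz
  have h := tendsto_one_div_add_atTop_nhds_zero_nat (𝕜 := ℝ)
  have h2 : Tendsto (fun n : ℕ => √(‖z‖ ^ 2 + (1 / ((n : ℝ) + 1)) ^ 2)) atTop (𝓝 ‖z‖) := by
    have := ((h.pow 2).const_add (‖z‖ ^ 2)).sqrt
    simpa [Real.sqrt_sq (norm_nonneg z)] using this
  exact h2.inv₀ h0

lemma ae_ne_point (y : E3) : ∀ᵐ x : E3, x - y ≠ 0 := by
  have : ∀ᵐ x : E3, x ≠ y := compl_mem_ae_iff.2 (measure_singleton y)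
  filter_upwards [this] with x hx
  exact sub_ne_zero.2 hx

lemma bounded_of_continuous_hasCompactSupport {φ : E3 → ℝ} (hφ : Continuous φ)
    (hc : HasCompactSupport φ) : ∃ C, ∀ x, |φ x| ≤ C := by
  obtain ⟨C, hC⟩ := hc.exists_bound_of_continuous hφ
  exact ⟨C, by simpa using hC⟩

/-- The singularity is avoided by integrating by parts with the smooth kernel (|z|² + s²)^(-1/2) and
letting s → 0. The two limits are dominated by the integrable singularities 1/|z| and 1/|z|². -/
lemma integral_inv_norm_mul_fderiv {φ : E3 → ℝ} (hφ : ContDiff ℝ ∞ φ)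
    (hc : HasCompactSupport φ) (y e : E3) :
    ∫ x, fderiv ℝ φ x e * ‖x - y‖⁻¹ = ∫ x, φ x * inner ℝ (fieldKernel (x - y)) e := by
  have hφ' : Continuous (fun x => fderiv ℝ φ x e) :=
    (hφ.continuous_fderiv (by simp)).clm_apply continuous_const
  have hcd : HasCompactSupport (fun x => fderiv ℝ φ x e) := hc.fderiv_apply ℝ e
  obtain ⟨C1, hC1⟩ := bounded_of_continuous_hasCompactSupport hφ' hcd
  obtain ⟨C2, hC2⟩ := bounded_of_continuous_hasCompactSupport hφ.continuous hc
  have i1 := integrable_smul_kernel stronglyMeasurable_inv_norm.aestronglyMeasurable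
    norm_inv_norm_le (hφ'.integrable_of_hasCompactSupport hcd) hC1 y
  have i2 := integrable_smul_kernel stronglyMeasurable_fieldKernel.aestronglyMeasurable
    norm_fieldKernel_le (hφ.continuous.integrable_of_hasCompactSupport hc) hC2 y
  have hk : ∀ n : ℕ, Continuous (fun x => smoothKernel (1 / ((n : ℝ) + 1)) (x - y)) := fun n =>
    (continuous_smoothKernel (by positivity)).comp (by fun_prop)
  have t1 : Tendsto (fun n : ℕ => ∫ x, smoothKernel (1 / ((n : ℝ) + 1)) (x - y) * fderiv ℝ φ x e)
      atTop (𝓝 (∫ x, fderiv ℝ φ x e * ‖x - y‖⁻¹)) := by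
    refine tendsto_integral_of_dominated_convergence _
      (fun n => ((hk n).mul hφ').aestronglyMeasurable) i1.norm (fun n => ?_) ?_
    · filter_upwards [ae_ne_point y] with x hx
      rw [norm_mul, norm_smul, mul_comm, norm_inv, norm_norm,
        Real.norm_of_nonneg (smoothKernel_nonneg _ _)]
      gcongr
      exact smoothKernel_le_inv_norm hx
    · filter_upwards [ae_ne_point y] with x hx
      rw [mul_comm]
      exact (tendsto_smoothKernel hx).mul_const _
  have t2 : Tendsto (fun n : ℕ => ∫ x, φ x * (smoothKernel (1 / ((n : ℝ) + 1)) (x - y) ^ 3 *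
      inner ℝ (x - y) e)) atTop (𝓝 (∫ x, φ x * inner ℝ (fieldKernel (x - y)) e)) := by
    refine tendsto_integral_of_dominated_convergence _
      (fun n => (hφ.continuous.mul (((hk n).pow 3).mul (by fun_prop))).aestronglyMeasurable)
      (i2.norm.mul_const ‖e‖) (fun n => ?_) ?_
    · filter_upwards [ae_ne_point y] with x hx
      rw [norm_mul, norm_mul, norm_smul, norm_pow, fieldKernel, norm_smul, norm_inv, norm_pow,
        norm_norm, Real.norm_of_nonneg (smoothKernel_nonneg _ _), ← inv_pow, mul_assoc, mul_assoc]
      gcongr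
      · exact smoothKernel_nonneg _ _
      · exact smoothKernel_le_inv_norm hx
      · exact norm_inner_le_norm _ _
    · filter_upwards [ae_ne_point y] with x hx
      rw [fieldKernel, inner_smul_left, ← inv_pow]
      exact (((tendsto_smoothKernel hx).pow 3).mul_const _).const_mul _
  refine tendsto_nhds_unique t1 (t2.congr fun n => ?_)
  exact (integral_smoothKernel_mul_fderiv (by positivity) hφ hc y e).symm

/-- The gravitational field `∫ f(y) (x - y) / |x - y|³ dy`. -/
def gravField (f : E3 → ℝ) (x : E3) : E3 := ∫ y, f y • fieldKernel (x - y)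

lemma potential_eq (f : E3 → ℝ) (x : E3) : potential f x = -∫ y, f y • ‖x - y‖⁻¹ := by
  simp [potential, div_eq_mul_inv]

/-- By Fubini the claim reduces to the integration by parts for a single point mass, tested in each
direction e. -/
lemma isWeakGradient_gravField {f : E3 → ℝ} (hf : Integrable f) :
    IsWeakGradient (potential f) (gravField f) := by
  have hp : potential f = fun x => -∫ y, f y • ‖x - y‖⁻¹ := funext (potential_eq f)
  have hV : LocallyIntegrable (fun x : E3 => ∫ y, f y • ‖x - y‖⁻¹) :=
    locallyIntegrable_integral_kernel stronglyMeasurable_inv_norm norm_inv_norm_le hf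
  have hG : LocallyIntegrable (gravField f) :=
    locallyIntegrable_integral_kernel stronglyMeasurable_fieldKernel norm_fieldKernel_le hf
  have hV' : LocallyIntegrable (potential f) := by rw [hp]; exact hV.neg
  refine ⟨hV', hG, fun φ hφ hc => ?_⟩
  have hgc : Continuous (∇ φ) := by
    have := hφ.continuous_fderiv (by simp)
    unfold gradient
    fun_prop
  have hcs : HasCompactSupport (∇ φ) := by
    have := hc.fderiv (𝕜 := ℝ)
    exact this.comp_left (g := (InnerProductSpace.toDual ℝ E3).symm) (by simp)
  have iV : Integrable (fun x => potential f x • ∇ φ x) :=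
    hV'.integrable_smul_right_of_hasCompactSupport hgc hcs
  have iG : Integrable (fun x => φ x • gravField f x) :=
    hG.integrable_smul_left_of_hasCompactSupport hφ.continuous hc
  refine ext_inner_left ℝ fun e => ?_
  rw [inner_neg_right, ← integral_inner iV, ← integral_inner iG]
  have hφ' : Continuous (fun x => fderiv ℝ φ x e) :=
    (hφ.continuous_fderiv (by simp)).clm_apply continuous_const
  have hcd : HasCompactSupport (fun x => fderiv ℝ φ x e) := hc.fderiv_apply ℝ e
  obtain ⟨C1, hC1⟩ := bounded_of_continuous_hasCompactSupport hφ' hcd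
  obtain ⟨C2, hC2⟩ := bounded_of_continuous_hasCompactSupport hφ.continuous hc
  have i1 := integrable_prod_kernel stronglyMeasurable_inv_norm
    norm_inv_norm_le (hφ'.integrable_of_hasCompactSupport hcd) hC1 hf
  have i2 := (integrable_prod_kernel stronglyMeasurable_fieldKernel
    norm_fieldKernel_le (hφ.continuous.integrable_of_hasCompactSupport hc) hC2 hf).inner_const
      (𝕜 := ℝ) e
  have s1 : ∫ x, inner ℝ e (potential f x • ∇ φ x) =
      -∫ x, ∫ y, (fderiv ℝ φ x e * f y) • ‖x - y‖⁻¹ := by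
    rw [← integral_neg]
    refine integral_congr_ae (ae_of_all _ fun x => ?_)
    have : inner ℝ e (∇ φ x) = fderiv ℝ φ x e := by
      rw [real_inner_comm, inner_gradient_left]
    simp only [inner_smul_right, this, potential_eq, smul_eq_mul, mul_assoc]
    rw [integral_const_mul]
    ring
  have s2 : ∫ x, inner ℝ e (φ x • gravField f x) =
      ∫ x, ∫ y, inner ℝ ((φ x * f y) • fieldKernel (x - y)) e := by
    refine integral_congr_ae ?_
    filter_upwards [ae_integrable_kernel stronglyMeasurable_fieldKernel norm_fieldKernel_le hf]
      with x hx
    rw [inner_smul_right, gravField, ← integral_inner hx, ← integral_const_mul]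
    refine integral_congr_ae (ae_of_all _ fun y => ?_)
    simp only [inner_smul_left, inner_smul_right]
    rw [real_inner_comm]
    simp; ring
  rw [s1, s2]
  refine congrArg Neg.neg (((integral_integral_swap i1).trans ?_).trans
    (integral_integral_swap i2).symm)
  refine integral_congr_ae (ae_of_all _ fun y => ?_)
  have := integral_inv_norm_mul_fderiv hφ hc y e
  simp only [smul_eq_mul, inner_smul_left]
  calc ∫ x, fderiv ℝ φ x e * f y * ‖x - y‖⁻¹ = ∫ x, f y * (fderiv ℝ φ x e * ‖x - y‖⁻¹) := by
        congr 1; ext x; ring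
    _ = ∫ x, f y * (φ x * inner ℝ (fieldKernel (x - y)) e) := by
        rw [integral_const_mul, this, integral_const_mul]
    _ = _ := by congr 1; ext x; simp; ring

/-- Uniqueness by the fundamental lemma of the calculus of variations. It frees `fieldDist` from the
arbitrary choice of a representative. -/
lemma weakGradient_ae_eq {V : E3 → ℝ} {G : E3 → E3} (h : IsWeakGradient V G) :
    weakGradient V =ᵐ[volume] G := by
  have hex : ∃ G, IsWeakGradient V G := ⟨G, h⟩
  have h' : IsWeakGradient V (weakGradient V) := by
    rw [weakGradient, dif_pos hex]; exact hex.choose_spec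
  refine ae_eq_of_integral_contDiff_smul_eq h'.2.1 h.2.1 fun φ hφ hc => ?_
  have := (h'.2.2 φ hφ hc).symm.trans (h.2.2 φ hφ hc)
  exact neg_injective this

lemma gravField_sub {f g : E3 → ℝ} (hf : Integrable f) (hg : Integrable g) :
    gravField (f - g) =ᵐ[volume] gravField f - gravField g := by
  filter_upwards [ae_integrable_kernel stronglyMeasurable_fieldKernel norm_fieldKernel_le hf,
    ae_integrable_kernel stronglyMeasurable_fieldKernel norm_fieldKernel_le hg] with x h1 h2
  simp only [gravField, Pi.sub_apply, sub_smul]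
  exact integral_sub h1 h2

end EulerPoisson

/-! ### The Coulomb form and the field energy -/

namespace EulerPoisson

/-- The integrand of the Coulomb form. -/
def coulombIntegrand (f g : E3 → ℝ) (p : E3 × E3) : ℝ := f p.1 * g p.2 * ‖p.1 - p.2‖⁻¹

/-- The Coulomb form `∬ f(x) g(y) / |x - y| dx dy`. -/
def coulomb (f g : E3 → ℝ) : ℝ := ∫ p, coulombIntegrand f g p ∂((volume : Measure E3).prod volume)

/-- Absolute convergence of the Coulomb form. -/
def HasCoulomb (f g : E3 → ℝ) : Prop :=
  Integrable (coulombIntegrand f g) ((volume : Measure E3).prod volume)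

lemma ae_prod_ne : ∀ᵐ p : E3 × E3 ∂((volume : Measure E3).prod volume), p.2 - p.1 ≠ 0 := by
  rw [Measure.ae_prod_iff_ae_ae]
  · exact ae_of_all _ fun x => ae_ne_point x
  · exact (measurableSet_singleton (0 : E3)).compl.preimage (measurable_snd.sub measurable_fst)

/-- The integrand of `∫ |G_f|²` as a function of three points. -/
def fieldTriple (f : E3 → ℝ) (q : E3 × (E3 × E3)) : ℝ :=
  f q.2.1 * f q.2.2 * inner ℝ (fieldKernel (q.1 - q.2.1)) (fieldKernel (q.1 - q.2.2))

lemma aestronglyMeasurable_fieldTriple {f : E3 → ℝ} (hf : AEStronglyMeasurable f volume) :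
    AEStronglyMeasurable (fieldTriple f)
      ((volume : Measure E3).prod ((volume : Measure E3).prod volume)) := by
  have m := measurable_fieldKernel
  have h1 : AEStronglyMeasurable (fun p : E3 × E3 => f p.1 * f p.2)
      ((volume : Measure E3).prod volume) := hf.comp_fst.mul hf.comp_snd
  refine AEStronglyMeasurable.mul (f := fun q : E3 × (E3 × E3) => f q.2.1 * f q.2.2)
    h1.comp_snd ?_
  exact Measurable.aestronglyMeasurable (by fun_prop)

lemma integrable_inner_fieldKernel_sub {y z : E3} (h : z - y ≠ 0) :
    Integrable (fun x : E3 => inner ℝ (fieldKernel (x - y)) (fieldKernel (x - z))) := by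
  have := (integrable_inner_fieldKernel h).comp_sub_right y
  simpa [sub_sub_sub_cancel_right] using this

lemma integral_inner_fieldKernel_sub {y z : E3} (h : z - y ≠ 0) :
    ∫ x : E3, inner ℝ (fieldKernel (x - y)) (fieldKernel (x - z)) = 4 * Real.pi * ‖y - z‖⁻¹ := by
  have := integral_sub_right_eq_self
    (fun x : E3 => (inner ℝ (fieldKernel x) (fieldKernel (x - (z - y))) : ℝ)) y (μ := volume)
  rw [integral_inner_fieldKernel h] at this
  rw [norm_sub_rev, ← div_eq_mul_inv, ← this]
  simp [sub_sub_sub_cancel_right]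

lemma integral_norm_inner_fieldKernel_sub_le {y z : E3} (h : z - y ≠ 0) :
    ∫ x : E3, ‖(inner ℝ (fieldKernel (x - y)) (fieldKernel (x - z)) : ℝ)‖ ≤
      32 * Real.pi * ‖y - z‖⁻¹ := by
  have h1 := integral_sub_right_eq_self
    (fun x : E3 => (‖x‖ ^ 2)⁻¹ * (‖x - (z - y)‖ ^ 2)⁻¹) y (μ := volume)
  have h2 := (integrable_inv_sq_mul_inv_sq h).comp_sub_right y
  have h3 := integral_inv_sq_mul_inv_sq_le h
  rw [← h1] at h3
  rw [norm_sub_rev y z, ← div_eq_mul_inv]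
  refine (integral_mono (integrable_inner_fieldKernel_sub h).norm h2 fun x => ?_).trans h3
  simp only [sub_sub_sub_cancel_right]
  rw [← norm_fieldKernel, ← norm_fieldKernel]
  exact norm_inner_le_norm _ _

/-- Integrating over the field point first, the absolute integral is at most 32π/|y-z|, so absolute
convergence of the Coulomb form suffices. -/
lemma integrable_fieldTriple {f : E3 → ℝ} (hf : AEStronglyMeasurable f volume)
    (hJ : HasCoulomb f f) : Integrable (fieldTriple f)
      ((volume : Measure E3).prod ((volume : Measure E3).prod volume)) := by
  have hm := aestronglyMeasurable_fieldTriple hf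
  rw [integrable_prod_iff' hm]
  constructor
  · filter_upwards [ae_prod_ne] with p hp
    exact (integrable_inner_fieldKernel_sub hp).const_mul (f p.1 * f p.2)
  · refine (hJ.norm.const_mul (32 * Real.pi)).mono' hm.norm.prod_swap.integral_prod_right' ?_
    filter_upwards [ae_prod_ne] with p hp
    rw [Real.norm_of_nonneg (integral_nonneg fun _ => norm_nonneg _)]
    simp only [fieldTriple, norm_mul (f p.1 * f p.2), integral_const_mul]
    rw [coulombIntegrand, norm_mul (f p.1 * f p.2), norm_inv, norm_norm]
    calc ‖f p.1 * f p.2‖ * _ ≤ ‖f p.1 * f p.2‖ * (32 * Real.pi * ‖p.1 - p.2‖⁻¹) := by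
          gcongr; exact integral_norm_inner_fieldKernel_sub_le hp
      _ = _ := by ring

lemma inner_gravField {f : E3 → ℝ} (hf : Integrable f) (hJ : HasCoulomb f f) :
    ∀ᵐ x, ‖gravField f x‖ ^ 2 =
      ∫ p, fieldTriple f (x, p) ∂((volume : Measure E3).prod volume) := by
  filter_upwards [ae_integrable_kernel stronglyMeasurable_fieldKernel norm_fieldKernel_le hf,
    (integrable_fieldTriple hf.1 hJ).prod_right_ae] with x h1 h2
  rw [integral_prod _ h2, ← real_inner_self_eq_norm_sq]
  nth_rw 1 [gravField]
  rw [real_inner_comm, ← integral_inner h1]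
  refine integral_congr_ae (ae_of_all _ fun y => ?_)
  simp only [fieldTriple]
  rw [real_inner_comm, gravField, ← integral_inner h1]
  refine integral_congr_ae (ae_of_all _ fun z => ?_)
  simp only [inner_smul_left, inner_smul_right]
  simp; ring

lemma integrable_norm_sq_gravField {f : E3 → ℝ} (hf : Integrable f) (hJ : HasCoulomb f f) :
    Integrable (fun x => ‖gravField f x‖ ^ 2) :=
  (integrable_fieldTriple hf.1 hJ).integral_prod_left.congr
    ((inner_gravField hf hJ).mono fun _ h => h.symm)

/-- Expanding the square gives a triple integral; integrating the product of the two kernels over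
the field point first leaves 4π/|y-z|. -/
lemma integral_norm_sq_gravField {f : E3 → ℝ} (hf : Integrable f) (hJ : HasCoulomb f f) :
    ∫ x, ‖gravField f x‖ ^ 2 = 4 * Real.pi * coulomb f f := by
  have hT := integrable_fieldTriple hf.1 hJ
  rw [integral_congr_ae (inner_gravField hf hJ), integral_integral_swap (f := fun x p => fieldTriple f (x, p)) hT, coulomb,
    ← integral_const_mul]
  refine integral_congr_ae ?_
  filter_upwards [ae_prod_ne] with p hp
  simp only [fieldTriple, integral_const_mul]
  rw [integral_inner_fieldKernel_sub hp, coulombIntegrand]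
  ring

/-- For f of varying sign, positivity cannot be read off the kernel; it comes from the
representation as a field energy. -/
lemma coulomb_self_nonneg {f : E3 → ℝ} (hf : Integrable f) (hJ : HasCoulomb f f) :
    0 ≤ coulomb f f := by
  have h := integral_norm_sq_gravField hf hJ
  have h0 : 0 ≤ ∫ x, ‖gravField f x‖ ^ 2 := integral_nonneg fun _ => by positivity
  rw [h] at h0
  have := Real.pi_pos
  exact nonneg_of_mul_nonneg_right h0 (by positivity)

lemma fieldDist_sq {f g : E3 → ℝ} (hf : Integrable f) (hg : Integrable g)
    (hJ : HasCoulomb (f - g) (f - g)) :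
    fieldDist f g ^ 2 = ENNReal.ofReal (4 * Real.pi * coulomb (f - g) (f - g)) := by
  have hfg := hf.sub hg
  have e : weakGradient (potential f) - weakGradient (potential g) =ᵐ[volume] gravField (f - g) :=
    ((weakGradient_ae_eq (isWeakGradient_gravField hf)).sub
      (weakGradient_ae_eq (isWeakGradient_gravField hg))).trans (gravField_sub hf hg).symm
  rw [fieldDist, eLpNorm_congr_ae e, ← integral_norm_sq_gravField hfg hJ,
    ofReal_integral_eq_lintegral_ofReal (integrable_norm_sq_gravField hfg hJ)
      (ae_of_all _ fun _ => by positivity),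
    eLpNorm_eq_lintegral_rpow_enorm_toReal (by norm_num) (by norm_num)]
  simp only [ENNReal.toReal_ofNat, one_div]
  rw [← ENNReal.rpow_natCast, ← ENNReal.rpow_mul]
  norm_num

lemma fieldDist_triangle {f g h : E3 → ℝ} (hf : Integrable f) (hg : Integrable g)
    (hh : Integrable h) : fieldDist f h ≤ fieldDist f g + fieldDist g h := by
  have m : ∀ {f : E3 → ℝ}, Integrable f →
      AEStronglyMeasurable (weakGradient (potential f)) volume := fun hf =>
    (isWeakGradient_gravField hf).2.1.aestronglyMeasurable.congr
      (weakGradient_ae_eq (isWeakGradient_gravField hf)).symm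
  unfold fieldDist
  have := eLpNorm_add_le ((m hf).sub (m hg)) ((m hg).sub (m hh)) (p := 2) (by norm_num)
  rwa [sub_add_sub_cancel] at this

end EulerPoisson

/-! ### Estimates for the Coulomb form -/

namespace EulerPoisson

/-- Functions in `L¹ ∩ L^{4/3}`. -/
structure IsDensity (f : E3 → ℝ) : Prop where
  integrable : Integrable f
  integrable_rpow : Integrable (fun x => |f x| ^ (4 / 3 : ℝ))

/-- `∫ |f|^{4/3}`. -/
def powMass (f : E3 → ℝ) : ℝ := ∫ x, |f x| ^ (4 / 3 : ℝ)

/-- `∫ |f|`. -/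
def absMass (f : E3 → ℝ) : ℝ := ∫ x, |f x|

lemma powMass_nonneg (f : E3 → ℝ) : 0 ≤ powMass f :=
  integral_nonneg fun _ => Real.rpow_nonneg (abs_nonneg _) _

/-- The kernel `1 / |z|` cut off outside of the ball of radius `r`. -/
def nearInv (r : ℝ) (z : E3) : ℝ := (Iio r).indicator (fun s => s⁻¹) ‖z‖

lemma nearInv_nonneg (r : ℝ) (z : E3) : 0 ≤ nearInv r z := by
  unfold nearInv
  by_cases h : ‖z‖ < r <;> simp [h]

lemma nearInv_sq (r : ℝ) (z : E3) : nearInv r z ^ 2 = nearSq r z := by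
  unfold nearInv nearSq
  by_cases h : ‖z‖ < r <;> simp [h]

lemma measurable_nearInv (r : ℝ) : Measurable (nearInv r) :=
  (Measurable.indicator (by fun_prop) measurableSet_Iio).comp measurable_norm

lemma inv_norm_le_nearInv_add {r : ℝ} (hr : 0 < r) (z : E3) : ‖z‖⁻¹ ≤ nearInv r z + r⁻¹ := by
  have hr' : 0 < r⁻¹ := inv_pos.2 hr
  by_cases h : ‖z‖ < r
  · simp [nearInv, h, hr.le]
  · have : ‖z‖⁻¹ ≤ r⁻¹ := by gcongr; exact not_lt.1 h
    have := nearInv_nonneg r z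
    linarith

/-- With p = |a|^(1/3) and q = |b|^(1/3), split p³q³k = (p²q²)(pqk), apply the weighted inequality
between arithmetic and geometric mean, then 2p²q² ≤ p⁴ + q⁴. After integration with k the cut-off
1/|z|, the first term is a product of integrals and the second a convolution with 1/|z|² on a ball,
of total mass 4πr. -/
lemma abs_mul_abs_mul_le {l : ℝ} (hl : 0 < l) (a b k : ℝ) :
    |a| * |b| * k ≤ l / 2 * (|a| ^ (4 / 3 : ℝ) * |b| ^ (4 / 3 : ℝ)) +
      (4 * l)⁻¹ * ((|a| ^ (4 / 3 : ℝ) + |b| ^ (4 / 3 : ℝ)) * k ^ 2) := by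
  have key : ∀ c : ℝ, ∃ p : ℝ, |c| = p ^ 3 ∧ |c| ^ (4 / 3 : ℝ) = p ^ 4 := by
    intro c
    refine ⟨|c| ^ (1 / 3 : ℝ), ?_, ?_⟩ <;> rw [← Real.rpow_natCast, ← Real.rpow_mul (abs_nonneg c)]
    · norm_num
    · norm_num
  obtain ⟨p, hp1, hp2⟩ := key a
  obtain ⟨q, hq1, hq2⟩ := key b
  rw [hp2, hq2, hp1, hq1]
  have h1 : p ^ 3 * q ^ 3 * k ≤ l / 2 * (p ^ 4 * q ^ 4) + (2 * l)⁻¹ * (p ^ 2 * q ^ 2 * k ^ 2) := by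
    have : l / 2 * (p ^ 4 * q ^ 4) + (2 * l)⁻¹ * (p ^ 2 * q ^ 2 * k ^ 2) - p ^ 3 * q ^ 3 * k =
        (2 * l)⁻¹ * (l * (p ^ 2 * q ^ 2) - p * q * k) ^ 2 := by
      field_simp; ring
    have : 0 ≤ (2 * l)⁻¹ * (l * (p ^ 2 * q ^ 2) - p * q * k) ^ 2 := by positivity
    linarith
  have h2 : (2 * l)⁻¹ * (p ^ 2 * q ^ 2 * k ^ 2) ≤ (4 * l)⁻¹ * ((p ^ 4 + q ^ 4) * k ^ 2) := by
    have : (4 * l)⁻¹ * ((p ^ 4 + q ^ 4) * k ^ 2) - (2 * l)⁻¹ * (p ^ 2 * q ^ 2 * k ^ 2) =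
        (4 * l)⁻¹ * ((p ^ 2 - q ^ 2) ^ 2 * k ^ 2) := by
      field_simp; ring
    have : 0 ≤ (4 * l)⁻¹ * ((p ^ 2 - q ^ 2) ^ 2 * k ^ 2) := by positivity
    linarith
  linarith

/-- The integrand of the near part of the Coulomb form. -/
def nearIntegrand (r : ℝ) (f g : E3 → ℝ) (p : E3 × E3) : ℝ :=
  |f p.1| * |g p.2| * nearInv r (p.1 - p.2)

lemma nearIntegrand_nonneg (r : ℝ) (f g : E3 → ℝ) (p : E3 × E3) : 0 ≤ nearIntegrand r f g p :=
  mul_nonneg (by positivity) (nearInv_nonneg _ _)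

lemma aestronglyMeasurable_nearIntegrand {f g : E3 → ℝ} (r : ℝ)
    (hf : AEStronglyMeasurable f volume) (hg : AEStronglyMeasurable g volume) :
    AEStronglyMeasurable (nearIntegrand r f g) ((volume : Measure E3).prod volume) :=
  (hf.norm.comp_fst.mul hg.norm.comp_snd).mul
    ((measurable_nearInv r).comp (measurable_fst.sub measurable_snd)).aestronglyMeasurable

lemma near_aux {f g : E3 → ℝ} (hf : IsDensity f) (hg : IsDensity g) {r l : ℝ} (hr : 0 ≤ r) :
    Integrable (fun p : E3 × E3 => l / 2 * (|f p.1| ^ (4 / 3 : ℝ) * |g p.2| ^ (4 / 3 : ℝ)) +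
      (4 * l)⁻¹ * ((|f p.1| ^ (4 / 3 : ℝ) + |g p.2| ^ (4 / 3 : ℝ)) * nearSq r (p.1 - p.2)))
      ((volume : Measure E3).prod volume) ∧
    ∫ p : E3 × E3, (l / 2 * (|f p.1| ^ (4 / 3 : ℝ) * |g p.2| ^ (4 / 3 : ℝ)) +
      (4 * l)⁻¹ * ((|f p.1| ^ (4 / 3 : ℝ) + |g p.2| ^ (4 / 3 : ℝ)) * nearSq r (p.1 - p.2)))
      ∂((volume : Measure E3).prod volume) = l / 2 * (powMass f * powMass g) +
        (4 * l)⁻¹ * ((powMass f + powMass g) * (4 * Real.pi * r)) := by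
  have hF := hf.integrable_rpow
  have hG := hg.integrable_rpow
  have i1 := (hF.mul_prod hG).const_mul (l / 2)
  have hn := integrable_nearSq r
  have sym : ∀ z w : E3, nearSq r (z - w) = nearSq r (w - z) := fun z w => by
    simp only [nearSq, norm_sub_rev]
  have i2 : Integrable (fun p : E3 × E3 => |g p.2| ^ (4 / 3 : ℝ) * nearSq r (p.1 - p.2))
      ((volume : Measure E3).prod volume) :=
    hG.convolution_integrand (ContinuousLinearMap.mul ℝ ℝ) hn (μ := volume)
  have i3 : Integrable (fun p : E3 × E3 => |f p.1| ^ (4 / 3 : ℝ) * nearSq r (p.1 - p.2))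
      ((volume : Measure E3).prod volume) := by
    have := (hF.convolution_integrand (ContinuousLinearMap.mul ℝ ℝ) hn (μ := volume)).swap
    refine this.congr (ae_of_all _ fun p => ?_)
    simp [sym p.1 p.2]
  have v2 : ∫ p : E3 × E3, |g p.2| ^ (4 / 3 : ℝ) * nearSq r (p.1 - p.2)
      ∂((volume : Measure E3).prod volume) = powMass g * (4 * Real.pi * r) := by
    rw [integral_prod_symm _ i2, powMass, ← integral_mul_const]
    congr 1; ext y
    simp only
    rw [integral_const_mul, integral_sub_right_eq_self (nearSq r) y, integral_nearSq hr]
  have v3 : ∫ p : E3 × E3, |f p.1| ^ (4 / 3 : ℝ) * nearSq r (p.1 - p.2)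
      ∂((volume : Measure E3).prod volume) = powMass f * (4 * Real.pi * r) := by
    rw [integral_prod _ i3, powMass, ← integral_mul_const]
    congr 1; ext x
    simp only [sym x]
    rw [integral_const_mul, integral_sub_right_eq_self (nearSq r) x, integral_nearSq hr]
  have i4 := (i3.add i2).const_mul (4 * l)⁻¹
  have e : (fun p : E3 × E3 => (4 * l)⁻¹ * ((|f p.1| ^ (4 / 3 : ℝ) + |g p.2| ^ (4 / 3 : ℝ)) *
      nearSq r (p.1 - p.2))) = fun p => (4 * l)⁻¹ * (((fun p : E3 × E3 => |f p.1| ^ (4 / 3 : ℝ) *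
        nearSq r (p.1 - p.2)) + (fun p : E3 × E3 => |g p.2| ^ (4 / 3 : ℝ) *
        nearSq r (p.1 - p.2))) p) := by
    ext p; simp only [Pi.add_apply]; ring
  have i5 : Integrable (fun p : E3 × E3 => (4 * l)⁻¹ * ((|f p.1| ^ (4 / 3 : ℝ) +
      |g p.2| ^ (4 / 3 : ℝ)) * nearSq r (p.1 - p.2))) ((volume : Measure E3).prod volume) := by
    rw [e]; exact i4
  refine ⟨i1.add i5, ?_⟩
  rw [integral_add i1 i5, integral_const_mul, integral_prod_mul
    (fun x : E3 => |f x| ^ (4 / 3 : ℝ)) (fun x : E3 => |g x| ^ (4 / 3 : ℝ)), e, integral_const_mul,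
    integral_add' i3 i2, v2, v3, powMass, powMass]
  ring

lemma nearIntegrand_le {f g : E3 → ℝ} {r l : ℝ} (hl : 0 < l) (p : E3 × E3) :
    nearIntegrand r f g p ≤ l / 2 * (|f p.1| ^ (4 / 3 : ℝ) * |g p.2| ^ (4 / 3 : ℝ)) +
      (4 * l)⁻¹ * ((|f p.1| ^ (4 / 3 : ℝ) + |g p.2| ^ (4 / 3 : ℝ)) * nearSq r (p.1 - p.2)) := by
  rw [← nearInv_sq]
  exact abs_mul_abs_mul_le hl _ _ _

lemma integrable_nearIntegrand {f g : E3 → ℝ} (hf : IsDensity f) (hg : IsDensity g) {r : ℝ}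
    (hr : 0 ≤ r) : Integrable (nearIntegrand r f g) ((volume : Measure E3).prod volume) := by
  refine (near_aux hf hg hr (l := 1)).1.mono'
    (aestronglyMeasurable_nearIntegrand r hf.integrable.1 hg.integrable.1) (ae_of_all _ fun p => ?_)
  rw [Real.norm_of_nonneg (nearIntegrand_nonneg _ _ _ _)]
  exact nearIntegrand_le one_pos p

/-- The near part of the Coulomb form. -/
def nearCoulomb (r : ℝ) (f g : E3 → ℝ) : ℝ :=
  ∫ p, nearIntegrand r f g p ∂((volume : Measure E3).prod volume)

lemma nearCoulomb_le {f g : E3 → ℝ} (hf : IsDensity f) (hg : IsDensity g) {r l : ℝ}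
    (hr : 0 ≤ r) (hl : 0 < l) : nearCoulomb r f g ≤ l / 2 * (powMass f * powMass g) +
        Real.pi * r / l * (powMass f + powMass g) := by
  refine (integral_mono (integrable_nearIntegrand hf hg hr) (near_aux hf hg hr (l := l)).1
    (nearIntegrand_le hl)).trans (le_of_eq ?_)
  rw [(near_aux hf hg hr).2]
  field_simp

lemma norm_coulombIntegrand_le {f g : E3 → ℝ} {r : ℝ} (hr : 0 < r) (p : E3 × E3) :
    ‖coulombIntegrand f g p‖ ≤ nearIntegrand r f g p + |f p.1| * |g p.2| * r⁻¹ := by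
  rw [coulombIntegrand, norm_mul, norm_mul, norm_inv, norm_norm, nearIntegrand, ← mul_add]
  exact mul_le_mul_of_nonneg_left (inv_norm_le_nearInv_add hr _) (by positivity)

lemma aestronglyMeasurable_coulombIntegrand {f g : E3 → ℝ}
    (hf : AEStronglyMeasurable f volume) (hg : AEStronglyMeasurable g volume) :
    AEStronglyMeasurable (coulombIntegrand f g) ((volume : Measure E3).prod volume) :=
  (hf.comp_fst.mul hg.comp_snd).mul (Measurable.aestronglyMeasurable (by fun_prop))

lemma far_aux {f g : E3 → ℝ} (hf : IsDensity f) (hg : IsDensity g) (r : ℝ) :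
    Integrable (fun p : E3 × E3 => |f p.1| * |g p.2| * r⁻¹) ((volume : Measure E3).prod volume) :=
  (hf.integrable.abs.mul_prod hg.integrable.abs).mul_const _

lemma hasCoulomb {f g : E3 → ℝ} (hf : IsDensity f) (hg : IsDensity g) : HasCoulomb f g :=
  ((integrable_nearIntegrand hf hg zero_le_one).add (far_aux hf hg 1)).mono'
    (aestronglyMeasurable_coulombIntegrand hf.integrable.1 hg.integrable.1)
    (ae_of_all _ fun p => norm_coulombIntegrand_le one_pos p)

lemma abs_coulomb_le {f g : E3 → ℝ} (hf : IsDensity f) (hg : IsDensity g) {r : ℝ} (hr : 0 < r) :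
    |coulomb f g| ≤ nearCoulomb r f g + absMass f * absMass g * r⁻¹ := by
  have i := integrable_nearIntegrand hf hg hr.le
  rw [coulomb, ← Real.norm_eq_abs]
  refine (norm_integral_le_of_norm_le (i.add (far_aux hf hg r))
    (ae_of_all _ fun p => norm_coulombIntegrand_le hr p)).trans (le_of_eq ?_)
  rw [integral_add' i (far_aux hf hg r), integral_mul_const,
    integral_prod_mul (fun x : E3 => |f x|) (fun x : E3 => |g x|)]
  rfl

/-! ### Stability of L¹ ∩ L^(4/3) under domination, restriction and differences. -/

lemma IsDensity.of_le {f g : E3 → ℝ} (hf : IsDensity f) (hg : AEStronglyMeasurable g volume)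
    (h : ∀ x, |g x| ≤ |f x|) : IsDensity g :=
  ⟨hf.integrable.mono hg (ae_of_all _ h), hf.integrable_rpow.mono
    ((continuous_abs.rpow_const (fun _ => Or.inr (by norm_num))).comp_aestronglyMeasurable hg)
    (ae_of_all _ fun x => by
      rw [Real.norm_of_nonneg (by positivity), Real.norm_of_nonneg (by positivity)]
      exact Real.rpow_le_rpow (abs_nonneg _) (h x) (by norm_num))⟩

lemma powMass_le_of_le {f g : E3 → ℝ} (hf : IsDensity f) (hg : IsDensity g)
    (h : ∀ x, |g x| ≤ |f x|) : powMass g ≤ powMass f :=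
  integral_mono hg.integrable_rpow hf.integrable_rpow fun x =>
    Real.rpow_le_rpow (abs_nonneg _) (h x) (by norm_num)

lemma abs_indicator_le_abs (S : Set E3) (f : E3 → ℝ) (x : E3) : |S.indicator f x| ≤ |f x| := by
  by_cases h : x ∈ S <;> simp [h]

lemma IsDensity.indicator {f : E3 → ℝ} (hf : IsDensity f) {S : Set E3} (hS : MeasurableSet S) :
    IsDensity (S.indicator f) :=
  hf.of_le (hf.integrable.1.indicator hS) (abs_indicator_le_abs S f)

lemma powMass_indicator_le {f : E3 → ℝ} (hf : IsDensity f) {S : Set E3} (hS : MeasurableSet S) :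
    powMass (S.indicator f) ≤ powMass f :=
  powMass_le_of_le hf (hf.indicator hS) (abs_indicator_le_abs S f)

lemma abs_sub_rpow_le (a b : ℝ) :
    |a - b| ^ (4 / 3 : ℝ) ≤ 4 * (|a| ^ (4 / 3 : ℝ) + |b| ^ (4 / 3 : ℝ)) := by
  have h1 : |a - b| ≤ 2 * max |a| |b| := by
    have := abs_sub a b
    have := le_max_left |a| |b|
    have := le_max_right |a| |b|
    linarith
  have h0 : 0 ≤ max |a| |b| := (abs_nonneg a).trans (le_max_left _ _)
  have h2 : (2 : ℝ) ^ (4 / 3 : ℝ) ≤ 4 := by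
    calc (2 : ℝ) ^ (4 / 3 : ℝ) ≤ 2 ^ (2 : ℝ) :=
          Real.rpow_le_rpow_of_exponent_le (by norm_num) (by norm_num)
      _ = 4 := by norm_num
  calc |a - b| ^ (4 / 3 : ℝ) ≤ (2 * max |a| |b|) ^ (4 / 3 : ℝ) :=
        Real.rpow_le_rpow (abs_nonneg _) h1 (by norm_num)
    _ = 2 ^ (4 / 3 : ℝ) * (max |a| |b|) ^ (4 / 3 : ℝ) := Real.mul_rpow (by norm_num) h0
    _ ≤ 4 * (max |a| |b|) ^ (4 / 3 : ℝ) := by gcongr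
    _ ≤ _ := by
      have p1 : 0 ≤ |a| ^ (4 / 3 : ℝ) := by positivity
      have p2 : 0 ≤ |b| ^ (4 / 3 : ℝ) := by positivity
      rcases max_choice |a| |b| with h | h <;> rw [h] <;> linarith

lemma IsDensity.sub {f g : E3 → ℝ} (hf : IsDensity f) (hg : IsDensity g) : IsDensity (f - g) := by
  refine ⟨hf.integrable.sub hg.integrable,
    ((hf.integrable_rpow.add hg.integrable_rpow).const_mul 4).mono'
    ((continuous_abs.rpow_const (fun _ => Or.inr (by norm_num))).comp_aestronglyMeasurable
      (hf.integrable.sub hg.integrable).1) (ae_of_all _ fun x => ?_)⟩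
  rw [Real.norm_of_nonneg (by positivity)]
  exact abs_sub_rpow_le _ _

lemma powMass_sub_le {f g : E3 → ℝ} (hf : IsDensity f) (hg : IsDensity g) :
    powMass (f - g) ≤ 4 * (powMass f + powMass g) := by
  refine (integral_mono (hf.sub hg).integrable_rpow
    ((hf.integrable_rpow.add hg.integrable_rpow).const_mul 4)
    fun x => abs_sub_rpow_le _ _).trans (le_of_eq ?_)
  rw [integral_const_mul, integral_add' hf.integrable_rpow hg.integrable_rpow, powMass, powMass]

lemma absMass_sub_le {f g : E3 → ℝ} (hf : IsDensity f) (hg : IsDensity g) :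
    absMass (f - g) ≤ absMass f + absMass g := by
  rw [absMass, absMass, absMass, ← integral_add hf.integrable.abs hg.integrable.abs]
  exact integral_mono (hf.sub hg).integrable.abs (hf.integrable.abs.add hg.integrable.abs)
    fun x => abs_sub _ _

/-! ### Bilinearity of the Coulomb form. -/

lemma HasCoulomb.symm {f g : E3 → ℝ} (h : HasCoulomb f g) : HasCoulomb g f := by
  refine (Integrable.swap h).congr (ae_of_all _ fun p => ?_)
  simp [coulombIntegrand, norm_sub_rev p.2 p.1, mul_comm]

lemma coulomb_comm (f g : E3 → ℝ) : coulomb f g = coulomb g f := by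
  rw [coulomb, coulomb, ← integral_prod_swap]
  congr 1; ext p
  simp [coulombIntegrand, norm_sub_rev p.2 p.1, mul_comm]

lemma coulomb_add_left {f₁ f₂ g : E3 → ℝ} (h₁ : HasCoulomb f₁ g) (h₂ : HasCoulomb f₂ g) :
    coulomb (f₁ + f₂) g = coulomb f₁ g + coulomb f₂ g := by
  rw [coulomb, coulomb, coulomb, ← integral_add h₁ h₂]
  congr 1; ext p
  simp [coulombIntegrand]; ring

lemma coulomb_add_right {f g₁ g₂ : E3 → ℝ} (h₁ : HasCoulomb f g₁) (h₂ : HasCoulomb f g₂) :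
    coulomb f (g₁ + g₂) = coulomb f g₁ + coulomb f g₂ := by
  rw [coulomb_comm, coulomb_add_left h₁.symm h₂.symm, coulomb_comm g₁, coulomb_comm g₂]

lemma IsDensity.add {f g : E3 → ℝ} (hf : IsDensity f) (hg : IsDensity g) : IsDensity (f + g) := by
  have hn : IsDensity (-g) := hg.of_le hg.integrable.1.neg fun x => by simp
  simpa using hf.sub hn

lemma coulomb_add_self {f g : E3 → ℝ} (hf : IsDensity f) (hg : IsDensity g) :
    coulomb (f + g) (f + g) = coulomb f f + 2 * coulomb f g + coulomb g g := by
  rw [coulomb_add_left (hasCoulomb hf (hf.add hg)) (hasCoulomb hg (hf.add hg)),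
    coulomb_add_right (hasCoulomb hf hf) (hasCoulomb hf hg),
    coulomb_add_right (hasCoulomb hg hf) (hasCoulomb hg hg), coulomb_comm g f]
  ring

lemma coulomb_nonneg {f g : E3 → ℝ} (hf : 0 ≤ᵐ[volume] f) (hg : 0 ≤ᵐ[volume] g) :
    0 ≤ coulomb f g := by
  refine integral_nonneg_of_ae ?_
  filter_upwards [Measure.quasiMeasurePreserving_fst.ae hf,
    Measure.quasiMeasurePreserving_snd.ae hg] with p h1 h2
  exact mul_nonneg (mul_nonneg h1 h2) (by positivity)

lemma coulomb_congr {f g f' g' : E3 → ℝ} (hf : f =ᵐ[volume] f') (hg : g =ᵐ[volume] g') :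
    coulomb f g = coulomb f' g' := by
  refine integral_congr_ae ?_
  filter_upwards [Measure.quasiMeasurePreserving_fst.ae hf,
    Measure.quasiMeasurePreserving_snd.ae hg] with p h1 h2
  simp only [coulombIntegrand, h1, h2]

lemma abs_coulomb_le_of_separated {f g : E3 → ℝ} (hf : IsDensity f) (hg : IsDensity g)
    {R R' : ℝ} (hR : R < R') (h1 : ∀ x, R ≤ ‖x‖ → f x = 0) (h2 : ∀ x, ‖x‖ < R' → g x = 0) :
    |coulomb f g| ≤ absMass f * absMass g * (R' - R)⁻¹ := by
  rw [coulomb, ← Real.norm_eq_abs]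
  refine (norm_integral_le_of_norm_le (far_aux hf hg (R' - R))
    (ae_of_all _ fun p => ?_)).trans (le_of_eq ?_)
  · rw [coulombIntegrand, norm_mul, norm_mul, norm_inv, norm_norm, Real.norm_eq_abs,
      Real.norm_eq_abs]
    by_cases hp1 : R ≤ ‖p.1‖
    · simp [h1 _ hp1]
    by_cases hp2 : ‖p.2‖ < R'
    · simp [h2 _ hp2]
    gcongr
    have := norm_sub_norm_le p.2 p.1
    rw [norm_sub_rev]
    linarith
  · rw [integral_mul_const, integral_prod_mul (fun x : E3 => |f x|) (fun x : E3 => |g x|)]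
    rfl

end EulerPoisson

/-! ### The function `Φ` and the constraint class -/

namespace EulerPoisson

namespace Admissible

variable {Φ : ℝ → ℝ}

lemma continuousOn (h : Admissible Φ) : ContinuousOn Φ (Ici 0) := h.contDiffOn_one.continuousOn

lemma continuousOn_deriv (h : Admissible Φ) : ContinuousOn (derivWithin Φ (Ici 0)) (Ici 0) :=
  h.contDiffOn_one.continuousOn_derivWithin (uniqueDiffOn_Ici 0) le_rfl

lemma tangent_le (h : Admissible Φ) {a b : ℝ} (ha : 0 ≤ a) (hb : 0 ≤ b) :
    Φ a + derivWithin Φ (Ici 0) a * (b - a) ≤ Φ b := by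
  have hd : DifferentiableWithinAt ℝ Φ (Ici 0) a :=
    h.contDiffOn_one.differentiableOn (by simp) a ha
  have hc := h.strictConvexOn.convexOn
  rcases lt_trichotomy a b with hab | rfl | hab
  · have := hc.derivWithin_le_slope ha hb hab hd
    rw [slope_def_field, le_div_iff₀ (by linarith)] at this
    linarith
  · simp
  · have := hc.slope_le_derivWithin hb ha hab hd
    rw [slope_def_field, div_le_iff₀ (by linarith)] at this
    linarith

lemma nonneg (h : Admissible Φ) {a : ℝ} (ha : 0 ≤ a) : 0 ≤ Φ a := by
  have := h.tangent_le le_rfl ha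
  rwa [h.map_zero, h.deriv_zero, zero_mul, add_zero] at this

lemma continuous_max (h : Admissible Φ) : Continuous (fun r => Φ (max r 0)) :=
  h.continuousOn.comp_continuous (by fun_prop) fun r => le_max_right r 0

lemma continuous_deriv_max (h : Admissible Φ) :
    Continuous (fun r => derivWithin Φ (Ici 0) (max r 0)) :=
  h.continuousOn_deriv.comp_continuous (by fun_prop) fun r => le_max_right r 0

lemma aestronglyMeasurable_comp (h : Admissible Φ) {f : E3 → ℝ}
    (hf : AEStronglyMeasurable f volume) (h0 : 0 ≤ᵐ[volume] f) :
    AEStronglyMeasurable (fun x => Φ (f x)) volume := by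
  refine (h.continuous_max.comp_aestronglyMeasurable hf).congr ?_
  filter_upwards [h0] with x hx
  simp only [Pi.zero_apply] at hx
  simp [hx]

/-- Since n < 3, the growth exponent 1 + 1/n exceeds 4/3, so Φ beats r^(4/3) beyond some T by any
prescribed factor; below T, r^(4/3) ≤ T^(1/3) r. The freedom in ε is what coercivity needs. -/
lemma exists_rpow_le (h : Admissible Φ) {ε : ℝ} (hε : 0 < ε) :
    ∃ C : ℝ, 0 ≤ C ∧ ∀ r : ℝ, 0 ≤ r → r ^ (4 / 3 : ℝ) ≤ ε * Φ r + C * r := by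
  obtain ⟨n, c, R, hn, hn3, hc, hR, hgrow⟩ := h.growth_large
  have hexp : 0 < 1 + 1 / n - 4 / 3 := by
    have : 1 / 3 < 1 / n := by gcongr
    linarith
  obtain ⟨S, hS⟩ := ((tendsto_rpow_atTop hexp).eventually_ge_atTop (1 / (ε * c))).exists_forall_of_atTop
  set T := max (max R S) 1
  have hT1 : 1 ≤ T := le_max_right _ _
  refine ⟨T ^ (1 / 3 : ℝ), by positivity, fun r hr => ?_⟩
  have hΦ := h.nonneg hr
  by_cases hrT : T ≤ r
  · have hr0 : 0 < r := by linarith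
    have h1 := hS r (((le_max_right R S).trans (le_max_left _ 1)).trans hrT)
    have h2 := hgrow r (((le_max_left R S).trans (le_max_left _ 1)).trans hrT)
    have h3 : r ^ (1 + 1 / n) = r ^ (4 / 3 : ℝ) * r ^ (1 + 1 / n - 4 / 3) := by
      rw [← Real.rpow_add hr0]; congr 1; ring
    have h4 : r ^ (4 / 3 : ℝ) ≤ ε * Φ r := by
      calc r ^ (4 / 3 : ℝ) = ε * (c * (r ^ (4 / 3 : ℝ) * (1 / (ε * c)))) := by field_simp
        _ ≤ ε * (c * (r ^ (4 / 3 : ℝ) * r ^ (1 + 1 / n - 4 / 3))) := by gcongr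
        _ ≤ ε * Φ r := by rw [← h3]; gcongr
    have : 0 ≤ T ^ (1 / 3 : ℝ) * r := by positivity
    linarith
  · have hrT' : r ≤ T := (not_le.1 hrT).le
    have : r ^ (4 / 3 : ℝ) ≤ T ^ (1 / 3 : ℝ) * r := by
      rcases hr.eq_or_lt with rfl | hr0
      · rw [Real.zero_rpow (by norm_num), mul_zero]
      · calc r ^ (4 / 3 : ℝ) = r ^ (1 / 3 : ℝ) * r := by
              nth_rw 3 [← Real.rpow_one r]
              rw [← Real.rpow_add hr0]; norm_num
          _ ≤ _ := by gcongr
    have : 0 ≤ ε * Φ r := by positivity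
    linarith

end Admissible

/-- The nonnegative densities of mass `m` with finite internal energy. -/
structure InClass (Φ : ℝ → ℝ) (m : ℝ) (f : E3 → ℝ) : Prop where
  integrable : Integrable f
  nonneg : 0 ≤ᵐ[volume] f
  integrable_comp : Integrable (fun x => Φ (f x))
  integral_eq : ∫ x, f x = m

/-- The internal energy as a real number. -/
def phiInt (Φ : ℝ → ℝ) (f : E3 → ℝ) : ℝ := ∫ x, Φ (f x)

/-- The reduced energy as a real number. -/
def redEnergy (Φ : ℝ → ℝ) (f : E3 → ℝ) : ℝ := phiInt Φ f - 1 / 2 * coulomb f f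

/-- The infimum of the reduced energy at mass `m`. -/
def infEnergy (Φ : ℝ → ℝ) (m : ℝ) : ℝ := sInf (redEnergy Φ '' {f | InClass Φ m f})

namespace InClass

variable {Φ : ℝ → ℝ} {m : ℝ} {f : E3 → ℝ}

lemma mass_nonneg (hf : InClass Φ m f) : 0 ≤ m := by
  rw [← hf.integral_eq]; exact integral_nonneg_of_ae hf.nonneg

lemma abs_ae_eq (hf : InClass Φ m f) : (fun x => |f x|) =ᵐ[volume] f := by
  filter_upwards [hf.nonneg] with x hx
  exact abs_of_nonneg hx

lemma absMass_eq (hf : InClass Φ m f) : absMass f = m := by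
  rw [absMass, integral_congr_ae hf.abs_ae_eq, hf.integral_eq]

lemma phiInt_nonneg (hΦ : Admissible Φ) (hf : InClass Φ m f) : 0 ≤ phiInt Φ f := by
  refine integral_nonneg_of_ae ?_
  filter_upwards [hf.nonneg] with x hx
  exact hΦ.nonneg hx

lemma isDensity (hΦ : Admissible Φ) (hf : InClass Φ m f) : IsDensity f := by
  obtain ⟨C, hC, h⟩ := hΦ.exists_rpow_le one_pos
  refine ⟨hf.integrable, (hf.integrable_comp.add (hf.integrable.const_mul C)).mono'
    ((continuous_abs.rpow_const (fun _ => Or.inr (by norm_num))).comp_aestronglyMeasurable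
      hf.integrable.1) ?_⟩
  filter_upwards [hf.nonneg] with x hx
  rw [Real.norm_of_nonneg (by positivity), abs_of_nonneg hx]
  simpa using h (f x) hx

lemma powMass_le (hΦ : Admissible Φ) {ε C : ℝ}
    (h : ∀ r : ℝ, 0 ≤ r → r ^ (4 / 3 : ℝ) ≤ ε * Φ r + C * r) (hf : InClass Φ m f) :
    powMass f ≤ ε * phiInt Φ f + C * m := by
  rw [phiInt, ← hf.integral_eq, ← integral_const_mul, ← integral_const_mul,
    ← integral_add (hf.integrable_comp.const_mul ε) (hf.integrable.const_mul C)]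
  refine integral_mono_ae (hf.isDensity hΦ).integrable_rpow
    ((hf.integrable_comp.const_mul ε).add (hf.integrable.const_mul C)) ?_
  filter_upwards [hf.nonneg] with x hx
  simp only [abs_of_nonneg hx]
  exact h _ hx

end InClass

/-- The cut-off radius and the weight l are both 1/(A+1) with A = ∫|f|^(4/3). This makes the bound
linear in A, so that it can be absorbed into ∫Φ(f). -/
lemma abs_coulomb_self_le {f : E3 → ℝ} (hf : IsDensity f) :
    |coulomb f f| ≤ (1 / 2 + 2 * Real.pi + absMass f ^ 2) * powMass f + absMass f ^ 2 := by
  have hA := powMass_nonneg f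
  set A := powMass f with hAdef
  have hr : 0 < 1 / (A + 1) := by positivity
  have h1 := abs_coulomb_le hf hf hr
  have h2 := nearCoulomb_le hf hf hr.le hr
  rw [mul_div_assoc, div_self hr.ne', ← hAdef] at h2
  have h3 : 1 / (A + 1) / 2 * (A * A) ≤ 1 / 2 * A := by
    rw [div_div, one_div_mul_eq_div, div_le_iff₀ (by positivity)]
    nlinarith
  have h4 : absMass f * absMass f * (1 / (A + 1))⁻¹ = absMass f ^ 2 * A + absMass f ^ 2 := by
    rw [one_div, inv_inv]; ring
  rw [h4] at h1
  linarith

/-- Taking ε = 1/B, with B the coefficient of ∫ f^(4/3) in the Coulomb bound, the potential energy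
consumes at most half of ∫Φ(f) up to a constant. -/
lemma exists_coercive {Φ : ℝ → ℝ} (hΦ : Admissible Φ) (M : ℝ) :
    ∃ C : ℝ, 0 ≤ C ∧ ∀ m f, m ≤ M → InClass Φ m f →
      1 / 2 * phiInt Φ f - C ≤ redEnergy Φ f ∧ powMass f ≤ phiInt Φ f + C := by
  set B := 1 / 2 + 2 * Real.pi + M ^ 2 with hB
  have hB0 : 0 < B := by positivity
  obtain ⟨C, hC, h⟩ := hΦ.exists_rpow_le (ε := B⁻¹) (by positivity)
  obtain ⟨C', hC', h'⟩ := hΦ.exists_rpow_le (ε := 1) one_pos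
  refine ⟨1 / 2 * (B * (C * |M|) + M ^ 2) + C' * |M|, by positivity, fun m f hm hf => ?_⟩
  have hm0 := hf.mass_nonneg
  have hmM : m ^ 2 ≤ M ^ 2 := by gcongr
  have hmM' : m ≤ |M| := hm.trans (le_abs_self M)
  have h1 := abs_coulomb_self_le (hf.isDensity hΦ)
  have h2 := hf.powMass_le hΦ h
  have h3 := hf.powMass_le hΦ h'
  have hA := powMass_nonneg f
  rw [hf.absMass_eq] at h1
  constructor
  · have h4 : (1 / 2 + 2 * Real.pi + m ^ 2) * powMass f ≤ B * powMass f := by rw [hB]; gcongr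
    have h5 : B * powMass f ≤ phiInt Φ f + B * (C * |M|) := by
      calc B * powMass f ≤ B * (B⁻¹ * phiInt Φ f + C * m) := by gcongr
        _ ≤ B * (B⁻¹ * phiInt Φ f + C * |M|) := by gcongr
        _ = _ := by rw [mul_add, ← mul_assoc, mul_inv_cancel₀ hB0.ne', one_mul]
    have h6 := le_abs_self (coulomb f f)
    have h7 : 0 ≤ C' * |M| := by positivity
    rw [redEnergy]
    linarith
  · have : C' * m ≤ C' * |M| := by gcongr
    have : 0 ≤ 1 / 2 * (B * (C * |M|) + M ^ 2) := by positivity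
    linarith

lemma bddBelow_redEnergy {Φ : ℝ → ℝ} (hΦ : Admissible Φ) (m : ℝ) :
    BddBelow (redEnergy Φ '' {f | InClass Φ m f}) := by
  obtain ⟨C, -, h⟩ := exists_coercive hΦ m
  refine ⟨-C, ?_⟩
  rintro _ ⟨f, hf, rfl⟩
  have := (h m f le_rfl hf).1
  have := InClass.phiInt_nonneg hΦ hf
  linarith

lemma infEnergy_le {Φ : ℝ → ℝ} (hΦ : Admissible Φ) {m : ℝ} {f : E3 → ℝ} (hf : InClass Φ m f) :
    infEnergy Φ m ≤ redEnergy Φ f :=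
  csInf_le (bddBelow_redEnergy hΦ m) ⟨f, hf, rfl⟩

/-! ### Scaling -/

lemma coulomb_comp_smul {f : E3 → ℝ} {b : ℝ} (hb : 0 < b) :
    coulomb (fun x => f (b • x)) (fun x => f (b • x)) = (b ^ 5)⁻¹ * coulomb f f := by
  have e : coulombIntegrand (fun x => f (b • x)) (fun x => f (b • x)) =
      fun p => b * coulombIntegrand f f (b • p) := by
    ext p
    simp only [coulombIntegrand, Prod.smul_fst, Prod.smul_snd, ← smul_sub, norm_smul,
      Real.norm_of_nonneg hb.le]
    field_simp
  have hfin : Module.finrank ℝ (E3 × E3) = 6 := by simp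
  rw [coulomb, e, integral_const_mul, Measure.integral_comp_smul, hfin,
    abs_of_nonneg (by positivity), coulomb, smul_eq_mul]
  field_simp

lemma InClass.comp_smul {Φ : ℝ → ℝ} {m : ℝ} {f : E3 → ℝ} (hf : InClass Φ m f) {b : ℝ}
    (hb : 0 < b) : InClass Φ ((b ^ 3)⁻¹ * m) (fun x => f (b • x)) ∧
      phiInt Φ (fun x => f (b • x)) = (b ^ 3)⁻¹ * phiInt Φ f := by
  have hi : ∀ g : E3 → ℝ, ∫ x, g (b • x) = (b ^ 3)⁻¹ * ∫ x, g x := fun g => by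
    rw [Measure.integral_comp_smul, finrank_E3, abs_of_nonneg (by positivity), smul_eq_mul]
  refine ⟨⟨hf.integrable.comp_smul hb.ne', ?_, hf.integrable_comp.comp_smul hb.ne', ?_⟩, ?_⟩
  · exact (Measure.quasiMeasurePreserving_smul volume hb.ne').ae hf.nonneg
  · rw [hi, hf.integral_eq]
  · exact hi fun x => Φ (f x)

end EulerPoisson

/-! ### Splitting and concentration of minimizing densities -/

namespace EulerPoisson

variable {Φ : ℝ → ℝ} {M : ℝ}

/-- The dilation x ↦ bx with b³ = t turns mass tM into mass M, multiplying ∫Φ by b⁻³ and J by b⁻⁵.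
As b ≤ 1, this gives the lower bound t^(5/3) inf H_r. Replacing t^(2/3) by its tangent (1+2t)/3 at t
= 1 leaves a polynomial whose strict subadditivity is explicit. Mass zero admits no such dilation
and is treated apart. -/
lemma redEnergy_ge_of_mass (hΦ : Admissible Φ) (hM : 0 < M) (hneg : infEnergy Φ M ≤ 0)
    {t : ℝ} (ht0 : 0 ≤ t) (ht1 : t ≤ 1) {f : E3 → ℝ} (hf : InClass Φ (t * M) f) :
    t * (1 + 2 * t) / 3 * infEnergy Φ M ≤ redEnergy Φ f := by
  rcases ht0.eq_or_lt with rfl | ht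
  · have hz : f =ᵐ[volume] 0 := by
      rw [← integral_eq_zero_iff_of_nonneg_ae hf.nonneg hf.integrable, hf.integral_eq, zero_mul]
    have h1 : phiInt Φ f = 0 := by
      rw [phiInt]
      refine integral_eq_zero_of_ae ?_
      filter_upwards [hz] with x hx
      simp [hx, hΦ.map_zero]
    have h2 : coulomb f f = 0 := by
      rw [coulomb_congr hz hz]
      simp [coulomb, coulombIntegrand]
    simp [redEnergy, h1, h2]
  · obtain ⟨b, hb0, hb⟩ : ∃ b : ℝ, 0 < b ∧ b ^ 3 = t := by
      refine ⟨t ^ (1 / 3 : ℝ), by positivity, ?_⟩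
      rw [← Real.rpow_natCast, ← Real.rpow_mul ht.le]; norm_num
    have hb1 : b ≤ 1 := by
      by_contra! h
      have : 1 < b ^ 3 := one_lt_pow₀ h (by norm_num)
      linarith
    obtain ⟨hF, hp⟩ := hf.comp_smul hb0
    have hmass : (b ^ 3)⁻¹ * (t * M) = M := by rw [hb]; field_simp
    rw [hmass] at hF
    have h1 := infEnergy_le hΦ hF
    rw [redEnergy, hp, coulomb_comp_smul hb0] at h1
    have h2 : b ^ 5 * infEnergy Φ M ≤ b ^ 2 * phiInt Φ f - 1 / 2 * coulomb f f := by
      calc b ^ 5 * infEnergy Φ M ≤ b ^ 5 * ((b ^ 3)⁻¹ * phiInt Φ f -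
            1 / 2 * ((b ^ 5)⁻¹ * coulomb f f)) := by gcongr
        _ = _ := by field_simp
    have h3 : b ^ 2 * phiInt Φ f ≤ phiInt Φ f :=
      mul_le_of_le_one_left (hf.phiInt_nonneg hΦ) (pow_le_one₀ hb0.le hb1)
    -- Equivalent to (1-b)²(1+2b) ≥ 0.
    have h4 : b ^ 2 ≤ (1 + 2 * t) / 3 := by
      rw [← hb]
      nlinarith [mul_nonneg (mul_self_nonneg (1 - b)) (by linarith : 0 ≤ 1 + 2 * b)]
    have h5 : t * (1 + 2 * t) / 3 * infEnergy Φ M ≤ b ^ 5 * infEnergy Φ M := by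
      refine mul_le_mul_of_nonpos_right ?_ hneg
      calc b ^ 5 = t * b ^ 2 := by rw [← hb]; ring
        _ ≤ t * ((1 + 2 * t) / 3) := by gcongr
        _ = _ := by ring
    rw [redEnergy]
    linarith

lemma InClass.indicator (hΦ : Admissible Φ) {m : ℝ} {f : E3 → ℝ} (hf : InClass Φ m f)
    {S : Set E3} (hS : MeasurableSet S) : InClass Φ (∫ x in S, f x) (S.indicator f) ∧
      phiInt Φ (S.indicator f) = ∫ x in S, Φ (f x) := by
  have e : (fun x => Φ (S.indicator f x)) = S.indicator (fun x => Φ (f x)) := by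
    ext x
    by_cases h : x ∈ S <;> simp [h, hΦ.map_zero]
  refine ⟨⟨hf.integrable.indicator hS, ?_, ?_, integral_indicator hS⟩, ?_⟩
  · filter_upwards [hf.nonneg] with x hx
    by_cases h : x ∈ S <;> simp [h]
    exact hx
  · rw [e]; exact hf.integrable_comp.indicator hS
  · rw [phiInt, e, integral_indicator hS]

/-- Radius s² and weight s make both terms of order s: short-range interaction is small uniformly on
sets with bounded ∫|f|^(4/3). -/
lemma nearCoulomb_sq_le {f g : E3 → ℝ} (hf : IsDensity f) (hg : IsDensity g) {s K : ℝ}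
    (hs : 0 < s) (hfK : powMass f ≤ K) (hgK : powMass g ≤ K) :
    nearCoulomb (s ^ 2) f g ≤ s * (K ^ 2 / 2 + 2 * Real.pi * K) := by
  have h := nearCoulomb_le hf hg (sq_nonneg s) hs
  have h1 := powMass_nonneg f
  have h2 := powMass_nonneg g
  calc nearCoulomb (s ^ 2) f g ≤ _ := h
    _ ≤ s / 2 * (K * K) + Real.pi * s ^ 2 / s * (K + K) := by
      have : 0 ≤ K := h1.trans hfK
      gcongr
    _ = _ := by field_simp; ring

/-- Splitting a density into an inner and an outer part. -/
lemma splitting_estimate (hΦ : Admissible Φ) (hM : 0 < M) (hneg : infEnergy Φ M ≤ 0)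
    {f : E3 → ℝ} (hf : InClass Φ M f) {K s R R' t : ℝ} (hK : powMass f ≤ K) (hs : 0 < s)
    (hR : R < R') (ht : ∫ x in Metric.ball 0 R, f x = t * M) :
    4 / 3 * (t * (1 - t)) * -infEnergy Φ M ≤ redEnergy Φ f - infEnergy Φ M +
      (s * (K ^ 2 / 2 + 2 * Real.pi * K) +
        M * (∫ x in Metric.ball 0 R' \ Metric.ball 0 R, f x) / s ^ 2 + M ^ 2 / (R' - R)) := by
  have mB : MeasurableSet (Metric.ball (0 : E3) R) := measurableSet_ball
  have mB' : MeasurableSet (Metric.ball (0 : E3) R') := measurableSet_ball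
  set B := Metric.ball (0 : E3) R with hBdef
  set B' := Metric.ball (0 : E3) R' with hB'def
  have hsub : B ⊆ B' := Metric.ball_subset_ball hR.le
  have hfd := hf.isDensity hΦ
  obtain ⟨h1, p1⟩ := hf.indicator hΦ mB
  obtain ⟨h2, p2⟩ := hf.indicator hΦ mB.compl
  obtain ⟨h3, -⟩ := hf.indicator hΦ (mB'.diff mB)
  obtain ⟨h4, -⟩ := hf.indicator hΦ mB'.compl
  have d1 := h1.isDensity hΦ
  have d2 := h2.isDensity hΦ
  have d3 := h3.isDensity hΦ
  have d4 := h4.isDensity hΦ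
  have hsum : (∫ x in B, f x) + ∫ x in Bᶜ, f x = M := by
    rw [integral_add_compl mB hf.integrable, hf.integral_eq]
  have hm1 := h1.mass_nonneg
  have hm2 := h2.mass_nonneg
  have hm3 := h3.mass_nonneg
  have hm4 := h4.mass_nonneg
  have hm2' : ∫ x in Bᶜ, f x = (1 - t) * M := by linarith
  rw [ht] at h1 hm1
  rw [hm2'] at h2 hm2
  have ht0 : 0 ≤ t := nonneg_of_mul_nonneg_left hm1 hM
  have ht1 : 0 ≤ 1 - t := nonneg_of_mul_nonneg_left hm2 hM
  have e12 : f = B.indicator f + Bᶜ.indicator f := (indicator_self_add_compl B f).symm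
  have e34 : Bᶜ.indicator f = (B' \ B).indicator f + B'ᶜ.indicator f := by
    ext x
    by_cases hx : x ∈ B
    · have := hsub hx
      simp [hx, this]
    · by_cases hx' : x ∈ B' <;> simp [hx, hx']
  have hE1 := redEnergy_ge_of_mass hΦ hM hneg ht0 (by linarith) h1
  have hE2 := redEnergy_ge_of_mass hΦ hM hneg ht1 (by linarith) h2
  have hph : phiInt Φ f = phiInt Φ (B.indicator f) + phiInt Φ (Bᶜ.indicator f) := by
    rw [p1, p2, phiInt, integral_add_compl mB hf.integrable_comp]
  have hco := coulomb_add_self d1 d2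
  rw [← e12] at hco
  -- The outer part is cut again at R'. The annulus interacts weakly because it carries little mass
  -- (apart from the short-range part), the remainder because it is at distance at least R' - R from
  -- the inner ball.
  have hci : coulomb (B.indicator f) (Bᶜ.indicator f) =
      coulomb (B.indicator f) ((B' \ B).indicator f) + coulomb (B.indicator f) (B'ᶜ.indicator f) := by
    rw [e34, coulomb_add_right (hasCoulomb d1 d3) (hasCoulomb d1 d4)]
  have hc3 := abs_coulomb_le d1 d3 (r := s ^ 2) (by positivity)
  have hn3 := nearCoulomb_sq_le d1 d3 hs ((powMass_indicator_le hfd mB).trans hK)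
    ((powMass_indicator_le hfd (mB'.diff mB)).trans hK)
  have hc4 := abs_coulomb_le_of_separated d1 d4 hR (fun x hx => by simp [B, hx])
    (fun x hx => by simp [B', hx])
  rw [h1.absMass_eq, h3.absMass_eq] at hc3
  rw [h1.absMass_eq, h4.absMass_eq] at hc4
  have hm4' : ∫ x in B'ᶜ, f x ≤ M := by
    rw [← hf.integral_eq]
    exact setIntegral_le_integral hf.integrable hf.nonneg
  have hbd3 : t * M * (∫ x in B' \ B, f x) * (s ^ 2)⁻¹ ≤ M * (∫ x in B' \ B, f x) / s ^ 2 := by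
    rw [← div_eq_mul_inv]
    gcongr
    nlinarith
  have hbd4 : t * M * (∫ x in B'ᶜ, f x) * (R' - R)⁻¹ ≤ M ^ 2 / (R' - R) := by
    have : 0 < R' - R := by linarith
    rw [← div_eq_mul_inv]
    gcongr
    calc t * M * (∫ x in B'ᶜ, f x) ≤ 1 * M * M := by gcongr; linarith
      _ = M ^ 2 := by ring
  have l3 := (le_abs_self _).trans hc3
  have l4 := (le_abs_self _).trans hc4
  have hE : redEnergy Φ f = redEnergy Φ (B.indicator f) + redEnergy Φ (Bᶜ.indicator f) -
      coulomb (B.indicator f) (Bᶜ.indicator f) := by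
    simp only [redEnergy]
    rw [hph, hco]; ring
  -- The two scaling bounds together exceed the infimum by exactly the gap 4/3 t(1-t)(-inf).
  have hid : t * (1 + 2 * t) / 3 * infEnergy Φ M + (1 - t) * (1 + 2 * (1 - t)) / 3 * infEnergy Φ M
      = infEnergy Φ M + 4 / 3 * (t * (1 - t)) * -infEnergy Φ M := by ring
  linarith

/-- A density of negative energy cannot be spread out uniformly. -/
lemma exists_concentration (hΦ : Admissible Φ) (hM : 0 < M) (hneg : infEnergy Φ M < 0) {K : ℝ}
    (hK0 : 0 ≤ K) :
    ∃ R δ : ℝ, 0 < R ∧ 0 < δ ∧ ∀ f, InClass Φ M f → powMass f ≤ K →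
      redEnergy Φ f ≤ infEnergy Φ M / 2 → ∃ a : E3, δ ≤ ∫ x in Metric.ball a R, f x := by
  set h := -infEnergy Φ M with hdef
  have hh : 0 < h := by linarith
  set D := K ^ 2 / 2 + 2 * Real.pi * K + 1 with hD
  have hD0 : 0 < D := by positivity
  -- The constants make the short, middle and long range parts of J(f,f) at most h/4, h/8 and h/4.
  -- Their sum is below h, while energy at most -h/2 forces J(f,f) ≥ h since ∫Φ(f) ≥ 0.
  set s := h / (4 * D) with hs
  have hs0 : 0 < s := by positivity
  refine ⟨4 * M ^ 2 / h, h * s ^ 2 / (8 * M), by positivity, by positivity, fun f hf hK hE => ?_⟩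
  set R := 4 * M ^ 2 / h with hR
  set δ := h * s ^ 2 / (8 * M) with hδ
  have hR0 : 0 < R := by positivity
  by_contra! hcon
  have hfd := hf.isDensity hΦ
  have hi := integrable_nearIntegrand hfd hfd (sq_nonneg s)
  have hfar := far_aux hfd hfd R
  have hmid : Integrable (fun p : E3 × E3 => |f p.1| * |f p.2| *
      (Metric.ball (0 : E3) R).indicator (fun _ => (1 : ℝ)) (p.2 - p.1))
      ((volume : Measure E3).prod volume) := by
    refine (far_aux hfd hfd 1).mono' ?_ (ae_of_all _ fun p => ?_)
    · refine (hfd.integrable.abs.1.comp_fst.mul hfd.integrable.abs.1.comp_snd).mul ?_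
      exact ((measurable_const.indicator measurableSet_ball).comp
        (measurable_snd.sub measurable_fst)).aestronglyMeasurable
    · by_cases hp : p.2 - p.1 ∈ Metric.ball (0 : E3) R
      · simp [indicator_of_mem hp]
      · simp only [indicator_of_notMem hp]
        simp; positivity
  have hmidle : ∫ p : E3 × E3, |f p.1| * |f p.2| *
      (Metric.ball (0 : E3) R).indicator (fun _ => (1 : ℝ)) (p.2 - p.1)
      ∂((volume : Measure E3).prod volume) ≤ M * δ := by
    rw [integral_prod _ hmid, ← hf.absMass_eq, absMass, ← integral_mul_const]
    refine integral_mono hmid.integral_prod_left (hfd.integrable.abs.mul_const δ) fun x => ?_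
    simp only [mul_assoc]
    rw [integral_const_mul]
    refine mul_le_mul_of_nonneg_left ?_ (abs_nonneg _)
    have : ∫ y, |f y| * (Metric.ball (0 : E3) R).indicator (fun _ => (1 : ℝ)) (y - x) =
        ∫ y in Metric.ball x R, f y := by
      rw [← integral_indicator measurableSet_ball]
      refine integral_congr_ae ?_
      filter_upwards [hf.abs_ae_eq] with y hy
      by_cases hyx : dist y x < R
      · have : ‖y - x‖ < R := by rwa [← dist_eq_norm]
        simp [indicator, hyx, this, hy]
      · have : ¬ ‖y - x‖ < R := by rwa [← dist_eq_norm]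
        simp [indicator, hyx, this]
    rw [this]
    exact (hcon x).le
  have hs2 : 0 < s ^ 2 := by positivity
  -- For |x-y| between s² and R the kernel is at most s⁻², and the mass within R of each x is below
  -- δ by the contrary assumption; beyond R the kernel is at most 1/R.
  have key : coulomb f f ≤ nearCoulomb (s ^ 2) f f + M * δ / s ^ 2 + M ^ 2 / R := by
    have hle : ∀ p : E3 × E3, ‖coulombIntegrand f f p‖ ≤ nearIntegrand (s ^ 2) f f p +
        (|f p.1| * |f p.2| * (Metric.ball (0 : E3) R).indicator (fun _ => (1 : ℝ)) (p.2 - p.1)) *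
          (s ^ 2)⁻¹ + |f p.1| * |f p.2| * R⁻¹ := by
      intro p
      by_cases hp : ‖p.1 - p.2‖ < R
      · have hp' : p.2 - p.1 ∈ Metric.ball (0 : E3) R := by simpa [norm_sub_rev p.2] using hp
        have := norm_coulombIntegrand_le (f := f) (g := f) hs2 p
        rw [indicator_of_mem hp', mul_one]
        have : 0 ≤ |f p.1| * |f p.2| * R⁻¹ := by positivity
        linarith
      · have hp' : p.2 - p.1 ∉ Metric.ball (0 : E3) R := by simpa [norm_sub_rev p.2] using hp
        have hn := nearIntegrand_nonneg (s ^ 2) f f p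
        rw [indicator_of_notMem hp', mul_zero, zero_mul, add_zero]
        have : ‖coulombIntegrand f f p‖ ≤ |f p.1| * |f p.2| * R⁻¹ := by
          rw [coulombIntegrand, norm_mul, norm_mul, norm_inv, norm_norm, Real.norm_eq_abs,
            Real.norm_eq_abs]
          gcongr
          exact not_lt.1 hp
        linarith
    have hint := (hi.add (hmid.mul_const (s ^ 2)⁻¹)).add hfar
    have h1 := norm_integral_le_of_norm_le hint (ae_of_all _ hle)
    refine ((le_abs_self _).trans h1).trans ?_
    rw [integral_add' (hi.add (hmid.mul_const (s ^ 2)⁻¹)) hfar,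
      integral_add' hi (hmid.mul_const (s ^ 2)⁻¹), integral_mul_const, integral_mul_const,
      integral_prod_mul (fun x : E3 => |f x|) (fun x : E3 => |f x|)]
    have e1 : ∫ x, |f x| = M := hf.absMass_eq
    rw [e1, ← div_eq_mul_inv, ← div_eq_mul_inv, ← sq]
    gcongr
    rfl
  have hn := nearCoulomb_sq_le hfd hfd hs0 hK hK
  have n1 : s * (K ^ 2 / 2 + 2 * Real.pi * K) ≤ h / 4 := by
    calc s * (K ^ 2 / 2 + 2 * Real.pi * K) ≤ s * D := by gcongr; linarith
      _ = h / 4 := by rw [hs]; field_simp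
  have n2 : M * δ / s ^ 2 = h / 8 := by rw [hδ]; field_simp
  have n3 : M ^ 2 / R = h / 4 := by rw [hR]; field_simp
  have hp := hf.phiInt_nonneg hΦ
  rw [redEnergy] at hE
  linarith

end EulerPoisson

/-! ### Negativity of the infimum and translations -/

namespace EulerPoisson

variable {Φ : ℝ → ℝ} {M : ℝ}

lemma volume_real_ball {R : ℝ} (hR : 0 ≤ R) :
    volume.real (Metric.ball (0 : E3) R) = 4 * Real.pi / 3 * R ^ 3 := by
  rw [measureReal_def, EuclideanSpace.volume_ball_fin_three, ENNReal.toReal_mul,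
    ENNReal.toReal_pow, ENNReal.toReal_ofReal hR, ENNReal.toReal_ofReal (by positivity)]
  ring

lemma integral_ball_indicator_const {R c : ℝ} (hR : 0 ≤ R) :
    ∫ x, (Metric.ball (0 : E3) R).indicator (fun _ => c) x = 4 * Real.pi / 3 * R ^ 3 * c := by
  rw [integral_indicator measurableSet_ball, setIntegral_const, volume_real_ball hR, smul_eq_mul]

/-- Uniform densities on balls. -/
lemma uniform_ball (hΦ : Admissible Φ) {R c : ℝ} (hR : 0 < R) (hc : 0 ≤ c)
    (hcM : 4 * Real.pi / 3 * R ^ 3 * c = M) :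
    InClass Φ M ((Metric.ball (0 : E3) R).indicator fun _ => c) ∧
    redEnergy Φ ((Metric.ball (0 : E3) R).indicator fun _ => c) ≤
      4 * Real.pi / 3 * R ^ 3 * Φ c - M ^ 2 / (4 * R) := by
  set B := Metric.ball (0 : E3) R with hB
  have mB : MeasurableSet B := measurableSet_ball
  have hfin : volume B ≠ ⊤ := measure_ball_lt_top.ne
  have eΦ : (fun x => Φ (B.indicator (fun _ => c) x)) = B.indicator (fun _ => Φ c) := by
    ext x
    by_cases h : x ∈ B <;> simp [h, hΦ.map_zero]
  have hcl : InClass Φ M (B.indicator fun _ => c) := by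
    refine ⟨(integrable_indicator_iff mB).2 (integrableOn_const hfin), ?_, ?_, ?_⟩
    · exact ae_of_all _ fun x => indicator_nonneg (fun _ _ => hc) x
    · rw [eΦ]; exact (integrable_indicator_iff mB).2 (integrableOn_const hfin)
    · rw [integral_ball_indicator_const hR.le, hcM]
  refine ⟨hcl, ?_⟩
  have hd := hcl.isDensity hΦ
  have h1 : phiInt Φ (B.indicator fun _ => c) = 4 * Real.pi / 3 * R ^ 3 * Φ c := by
    rw [phiInt, eΦ, integral_ball_indicator_const hR.le]
  have h2 : M ^ 2 / (2 * R) ≤ coulomb (B.indicator fun _ => c) (B.indicator fun _ => c) := by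
    have hlow : ∫ p : E3 × E3, B.indicator (fun _ => c) p.1 * B.indicator (fun _ => c) p.2 *
        (2 * R)⁻¹ ∂((volume : Measure E3).prod volume) = M ^ 2 / (2 * R) := by
      rw [integral_mul_const, integral_prod_mul (fun x : E3 => B.indicator (fun _ => c) x)
        (fun x : E3 => B.indicator (fun _ => c) x), integral_ball_indicator_const hR.le, hcM,
        div_eq_mul_inv, sq]
    rw [← hlow]
    refine integral_mono_ae ((hcl.integrable.mul_prod hcl.integrable).mul_const _)
      (hasCoulomb hd hd) ?_
    filter_upwards [ae_prod_ne] with p hp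
    rw [coulombIntegrand]
    by_cases h1 : p.1 ∈ B
    · by_cases h2 : p.2 ∈ B
      · have hlt : ‖p.1 - p.2‖ ≤ 2 * R := by
          have a1 : ‖p.1‖ < R := by simpa [B] using h1
          have a2 : ‖p.2‖ < R := by simpa [B] using h2
          have := norm_sub_le p.1 p.2
          linarith
        have hpos : 0 < ‖p.1 - p.2‖ := by rw [norm_sub_rev]; exact norm_pos_iff.2 hp
        simp only [h1, h2, indicator_of_mem]
        gcongr
      · simp [h2]
    · simp [h1]
  rw [redEnergy, h1]
  have : M ^ 2 / (4 * R) = 1 / 2 * (M ^ 2 / (2 * R)) := by field_simp; norm_num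
  linarith

/-- On a ball of large radius R, a uniform density of mass M has gravitational energy at most
-M²/(4R). Its height is of order R⁻³, so its internal energy is at most of order R^(-3/n) with n <
3, which decays faster than 1/R. -/
lemma infEnergy_neg (hΦ : Admissible Φ) (hM : 0 < M) : infEnergy Φ M < 0 := by
  obtain ⟨n, C, R₀, hn, hn3, hC, hR₀, hsmall⟩ := hΦ.growth_small
  set v := 4 * Real.pi / 3 with hv
  have hv0 : 0 < v := by positivity
  have hexp : 0 < 3 / n - 1 := by
    have : 1 < 3 / n := by rw [lt_div_iff₀ hn]; linarith
    linarith
  have t1 : Tendsto (fun R : ℝ => M / v * R ^ (-(3 : ℝ))) atTop (𝓝 0) := by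
    simpa using (tendsto_rpow_neg_atTop (by norm_num : (0 : ℝ) < 3)).const_mul (M / v)
  have t2 : Tendsto (fun R : ℝ => C * M * (M / v) ^ (1 / n) * R ^ (-(3 / n - 1))) atTop (𝓝 0) := by
    simpa using (tendsto_rpow_neg_atTop hexp).const_mul (C * M * (M / v) ^ (1 / n))
  obtain ⟨R, hR0, hR1, hR2⟩ := ((eventually_gt_atTop 0).and ((t1.eventually_le_const hR₀).and
    (t2.eventually_lt_const (u := M ^ 2 / 4) (by positivity)))).exists
  set c := M / v * R ^ (-(3 : ℝ)) with hc
  have hc0 : 0 ≤ c := by positivity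
  have hR3 : R ^ (-(3 : ℝ)) = (R ^ 3)⁻¹ := by
    rw [Real.rpow_neg hR0.le]; norm_cast
  have hcM : v * R ^ 3 * c = M := by rw [hc, hR3]; field_simp
  obtain ⟨hcl, hE⟩ := uniform_ball hΦ hR0 hc0 hcM
  have hcpos : 0 < c := by positivity
  have hΦc : v * R ^ 3 * Φ c ≤ C * M * c ^ (1 / n) := by
    calc v * R ^ 3 * Φ c ≤ v * R ^ 3 * (C * c ^ (1 + 1 / n)) := by
          gcongr; exact hsmall c hc0 hR1
      _ = C * (v * R ^ 3 * c) * c ^ (1 / n) := by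
          rw [Real.rpow_add hcpos, Real.rpow_one]; ring
      _ = _ := by rw [hcM]
  have hcn : R * (C * M * c ^ (1 / n)) < M ^ 2 / 4 := by
    refine lt_of_eq_of_lt ?_ hR2
    have : c ^ (1 / n) = (M / v) ^ (1 / n) * R ^ (-(3 / n)) := by
      rw [hc, Real.mul_rpow (by positivity) (by positivity), ← Real.rpow_mul hR0.le]
      congr 2; ring
    have h2 : R ^ (-(3 / n - 1)) = R * R ^ (-(3 / n)) := by
      nth_rw 2 [← Real.rpow_one R]
      rw [← Real.rpow_add hR0]; congr 1; ring
    rw [this, h2]; ring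
  have : C * M * c ^ (1 / n) < M ^ 2 / (4 * R) := by
    rw [lt_div_iff₀ (by positivity)]; linarith
  have h3 := infEnergy_le hΦ hcl
  rw [← hv] at hE
  linarith

/-! ### Shifts -/

lemma InClass.shift {m : ℝ} {f : E3 → ℝ} (hf : InClass Φ m f) (a : E3) :
    InClass Φ m (EulerPoisson.shift a f) := by
  refine ⟨hf.integrable.comp_add_right a,
    (measurePreserving_add_right volume a).quasiMeasurePreserving.ae hf.nonneg,
    hf.integrable_comp.comp_add_right a, ?_⟩
  simp only [EulerPoisson.shift]
  rw [integral_add_right_eq_self f a, hf.integral_eq]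

lemma phiInt_shift (f : E3 → ℝ) (a : E3) : phiInt Φ (shift a f) = phiInt Φ f :=
  integral_add_right_eq_self (fun x => Φ (f x)) a

lemma coulomb_shift (f g : E3 → ℝ) (a : E3) : coulomb (shift a f) (shift a g) = coulomb f g := by
  rw [coulomb, coulomb, ← integral_add_right_eq_self (coulombIntegrand f g) (a, a)]
  congr 1; ext p
  simp [coulombIntegrand, shift]

lemma redEnergy_shift (f : E3 → ℝ) (a : E3) : redEnergy Φ (shift a f) = redEnergy Φ f := by
  rw [redEnergy, redEnergy, phiInt_shift, coulomb_shift]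

lemma powMass_shift (f : E3 → ℝ) (a : E3) : powMass (shift a f) = powMass f :=
  integral_add_right_eq_self (fun x => |f x| ^ (4 / 3 : ℝ)) a

lemma shift_sub (f g : E3 → ℝ) (a : E3) : shift a (f - g) = shift a f - shift a g := rfl

lemma shift_neg_shift (f : E3 → ℝ) (a : E3) : shift a (shift (-a) f) = f := by
  ext x; simp [shift]

lemma setIntegral_ball_shift (f : E3 → ℝ) (a : E3) (R : ℝ) :
    ∫ x in Metric.ball 0 R, shift a f x = ∫ x in Metric.ball a R, f x := by
  rw [← integral_indicator measurableSet_ball, ← integral_indicator measurableSet_ball,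
    ← integral_add_right_eq_self ((Metric.ball a R).indicator f) a]
  congr 1; ext x
  simp [indicator, shift, dist_eq_norm]

end EulerPoisson

/-! ### Weak limits of densities -/

namespace EulerPoisson

/-- The threshold is |a| = s⁻³: above it |a|^(-1/3) ≤ s, and hence |a| ≤ s|a|^(4/3). -/
lemma le_inv_pow_add_rpow {s : ℝ} (hs : 0 < s) (a : ℝ) :
    a ≤ (s ^ 3)⁻¹ + s * |a| ^ (4 / 3 : ℝ) := by
  refine (le_abs_self a).trans ?_
  obtain ⟨p, hp0, hp1, hp2⟩ : ∃ p : ℝ, 0 ≤ p ∧ |a| = p ^ 3 ∧ |a| ^ (4 / 3 : ℝ) = p ^ 4 := by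
    refine ⟨|a| ^ (1 / 3 : ℝ), by positivity, ?_, ?_⟩ <;>
      rw [← Real.rpow_natCast, ← Real.rpow_mul (abs_nonneg a)]
    · norm_num
    · norm_num
  rw [hp2, hp1]
  by_cases h : s * p ≤ 1
  · have h1 : (s * p) ^ 3 ≤ 1 := pow_le_one₀ (by positivity) h
    have : p ^ 3 ≤ (s ^ 3)⁻¹ := by
      rw [← one_div, le_div_iff₀ (by positivity)]
      linarith [mul_pow s p 3]
    have : 0 ≤ s * p ^ 4 := by positivity
    linarith
  · have : p ^ 3 * 1 ≤ p ^ 3 * (s * p) := by gcongr; exact (not_le.1 h).le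
    have h2 : 0 ≤ (s ^ 3)⁻¹ := by positivity
    nlinarith

/-- Uniform integrability of densities in terms of `powMass`. -/
lemma setIntegral_le_volume {f : E3 → ℝ} (hf : IsDensity f) {S : Set E3} (hS : volume S ≠ ⊤)
    {s : ℝ} (hs : 0 < s) : ∫ x in S, f x ≤ (s ^ 3)⁻¹ * volume.real S + s * powMass f := by
  have hi : IntegrableOn (fun _ : E3 => (s ^ 3)⁻¹) S := integrableOn_const hS
  have hp := hf.integrable_rpow
  calc ∫ x in S, f x ≤ ∫ x in S, ((s ^ 3)⁻¹ + s * |f x| ^ (4 / 3 : ℝ)) :=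
        integral_mono hf.integrable.integrableOn (hi.add (hp.const_mul s).integrableOn)
          fun x => le_inv_pow_add_rpow hs _
    _ = (s ^ 3)⁻¹ * volume.real S + s * ∫ x in S, |f x| ^ (4 / 3 : ℝ) := by
        rw [integral_add hi (hp.const_mul s).integrableOn, setIntegral_const, integral_const_mul,
          smul_eq_mul, mul_comm]
    _ ≤ _ := by
        gcongr
        exact setIntegral_le_integral hp (ae_of_all _ fun x => by positivity)

variable {ι : Type*}

/-- Weak compactness of tight families of densities, along an ultrafilter. -/
lemma exists_weak_limit (U : Ultrafilter ι) {f : ι → E3 → ℝ} {M K : ℝ}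
    (hf : ∀ i, IsDensity (f i)) (h0 : ∀ i, 0 ≤ᵐ[volume] f i) (hM : ∀ i, ∫ x, f i x = M)
    (hK : ∀ i, powMass (f i) ≤ K)
    (tight : ∀ ε : ℝ, 0 < ε → ∃ R : ℝ, ∀ᶠ i in (U : Filter ι), ∫ x in (Metric.ball 0 R)ᶜ, f i x ≤ ε) :
    ∃ g : E3 → ℝ, Measurable g ∧ (∀ x, 0 ≤ g x) ∧ Integrable g ∧
      ∀ S, MeasurableSet S → Tendsto (fun i => ∫ x in S, f i x) U (𝓝 (∫ x in S, g x)) := by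
  have hint := fun i => (hf i).integrable
  have hnn : ∀ i (S : Set E3), 0 ≤ ∫ x in S, f i x := fun i S =>
    integral_nonneg_of_ae (ae_restrict_of_ae (h0 i))
  have hle : ∀ i (S : Set E3), ∫ x in S, f i x ≤ M := fun i S => by
    rw [← hM i]; exact setIntegral_le_integral (hint i) (h0 i)
  -- Along an ultrafilter every bounded real family converges, so the limiting mass exists for all
  -- sets simultaneously, without diagonal subsequences.
  have hex : ∀ S : Set E3, ∃ l : ℝ, Tendsto (fun i => ∫ x in S, f i x) U (𝓝 l) := by
    intro S
    obtain ⟨l, -, hl⟩ := (isCompact_Icc (a := (0 : ℝ)) (b := M)).ultrafilter_le_nhds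
      (U.map fun i => ∫ x in S, f i x)
      (by
        rw [le_principal_iff]
        exact Ultrafilter.mem_map.2 (Eventually.of_forall fun i => ⟨hnn i S, hle i S⟩))
    exact ⟨l, hl⟩
  choose l hl using hex
  have l_nonneg : ∀ S, 0 ≤ l S := fun S =>
    ge_of_tendsto (hl S) (Eventually.of_forall fun i => hnn i S)
  have l_le : ∀ S, l S ≤ M := fun S => le_of_tendsto (hl S) (Eventually.of_forall fun i => hle i S)
  have l_empty : l ∅ = 0 := tendsto_nhds_unique (hl ∅) (by simp)
  have l_null : ∀ S, volume S = 0 → l S = 0 := fun S hS =>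
    tendsto_nhds_unique (hl S) (by simp [setIntegral_measure_zero _ hS])
  have l_union : ∀ S T, Disjoint S T → MeasurableSet T → l (S ∪ T) = l S + l T := by
    intro S T hd hT
    refine tendsto_nhds_unique (hl (S ∪ T)) (((hl S).add (hl T)).congr fun i => ?_)
    rw [setIntegral_union hd hT (hint i).integrableOn (hint i).integrableOn]
  have hK1 : 0 < |K| + 1 := by positivity
  -- Continuity at the empty set, which upgrades finite additivity of the limit to countable
  -- additivity. Tightness controls the part outside a large ball, the uniform bound on ∫|f|^(4/3)
  -- the part inside.
  have l_small : ∀ T : ℕ → Set E3, (∀ n, MeasurableSet (T n)) → Antitone T → ⋂ n, T n = ∅ →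
      Tendsto (fun n => l (T n)) atTop (𝓝 0) := by
    intro T mT aT hT
    rw [Metric.tendsto_atTop]
    intro ε hε
    obtain ⟨R, hR⟩ := tight (ε / 4) (by positivity)
    set s := ε / (4 * (|K| + 1)) with hs
    have hs0 : 0 < s := by positivity
    have hball : ∀ n, volume (T n ∩ Metric.ball 0 R) ≠ ⊤ := fun n =>
      ((measure_mono inter_subset_right).trans_lt measure_ball_lt_top).ne
    have hv : Tendsto (fun n => volume (T n ∩ Metric.ball 0 R)) atTop (𝓝 0) := by
      have := tendsto_measure_iInter_atTop (μ := volume) (s := fun n => T n ∩ Metric.ball 0 R)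
        (fun n => ((mT n).inter measurableSet_ball).nullMeasurableSet)
        (fun a b hab => inter_subset_inter_left _ (aT hab)) ⟨0, hball 0⟩
      rwa [← iInter_inter, hT, empty_inter, measure_empty] at this
    have hv' : Tendsto (fun n => (s ^ 3)⁻¹ * volume.real (T n ∩ Metric.ball 0 R)) atTop (𝓝 0) := by
      simpa [measureReal_def] using ((ENNReal.tendsto_toReal ENNReal.zero_ne_top).comp hv).const_mul (s ^ 3)⁻¹
    obtain ⟨N, hN⟩ := (hv'.eventually_lt_const (u := ε / 4) (by positivity)).exists_forall_of_atTop
    refine ⟨N, fun n hn => ?_⟩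
    rw [Real.dist_eq, sub_zero, abs_of_nonneg (l_nonneg _)]
    refine lt_of_le_of_lt (le_of_tendsto (hl (T n)) (b := 3 * ε / 4) ?_) (by linarith)
    filter_upwards [hR] with i hi
    have h1 : ∫ x in T n, f i x = (∫ x in T n ∩ Metric.ball 0 R, f i x) +
        ∫ x in T n \ Metric.ball 0 R, f i x :=
      (integral_inter_add_sdiff measurableSet_ball (hint i).integrableOn).symm
    have h2 : ∫ x in T n \ Metric.ball 0 R, f i x ≤ ∫ x in (Metric.ball 0 R)ᶜ, f i x :=
      setIntegral_mono_set (hint i).integrableOn (ae_restrict_of_ae (h0 i))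
        (LE.le.eventuallyLE (fun x hx => hx.2))
    have h3 := setIntegral_le_volume (hf i) (hball n) hs0
    have h4 : s * powMass (f i) ≤ ε / 4 := by
      calc s * powMass (f i) ≤ s * (|K| + 1) := by
            gcongr; linarith [hK i, le_abs_self K]
        _ = ε / 4 := by rw [hs]; field_simp
    have := hN n hn
    linarith
  have l_sum : ∀ ⦃S : ℕ → Set E3⦄, (∀ n, MeasurableSet (S n)) →
      Pairwise (Function.onFun Disjoint S) → HasSum (fun n => l (S n)) (l (⋃ n, S n)) := by
    intro S mS dS
    rw [hasSum_iff_tendsto_nat_of_nonneg fun n => l_nonneg _]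
    have mP : ∀ n : ℕ, MeasurableSet (⋃ j ∈ Finset.range n, S j) := fun n =>
      Finset.measurableSet_biUnion _ fun j _ => mS j
    have hP : ∀ n : ℕ, l (⋃ j ∈ Finset.range n, S j) = ∑ j ∈ Finset.range n, l (S j) := by
      intro n
      induction n with
      | zero => simp [l_empty]
      | succ n ih =>
        rw [Finset.sum_range_succ, ← ih, ← l_union _ _ _ (mS n)]
        · congr 1
          ext x
          simp only [Finset.mem_range, mem_iUnion, mem_union, exists_prop]
          constructor
          · rintro ⟨j, hj, hx⟩
            rcases Nat.lt_succ_iff_lt_or_eq.1 hj with h | rfl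
            · exact Or.inl ⟨j, h, hx⟩
            · exact Or.inr hx
          · rintro (⟨j, hj, hx⟩ | hx)
            · exact ⟨j, by omega, hx⟩
            · exact ⟨n, by omega, hx⟩
        · simp only [Finset.mem_range, disjoint_iUnion_left]
          exact fun j hj => dS hj.ne
    have hT := l_small (fun n => (⋃ j, S j) \ ⋃ j ∈ Finset.range n, S j)
      (fun n => (MeasurableSet.iUnion mS).diff (mP n))
      (fun a b hab => sdiff_subset_sdiff_right
        (biUnion_subset_biUnion_left fun j hj => by simp at hj ⊢; omega))
      (by
        ext x
        simp only [mem_iInter, Set.mem_sdiff, mem_iUnion, Finset.mem_range, mem_empty_iff_false,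
          iff_false, not_forall]
        by_cases hx : ∃ j, x ∈ S j
        · obtain ⟨j, hj⟩ := hx
          exact ⟨j + 1, fun h => h.2 ⟨j, by simp, hj⟩⟩
        · exact ⟨0, fun h => hx h.1⟩)
    have hsplit : ∀ n : ℕ, l (⋃ j, S j) - l ((⋃ j, S j) \ ⋃ j ∈ Finset.range n, S j) =
        ∑ j ∈ Finset.range n, l (S j) := by
      intro n
      rw [← hP, sub_eq_iff_eq_add, ← l_union _ _ disjoint_sdiff_self_right
        ((MeasurableSet.iUnion mS).diff (mP n)), union_sdiff_cancel]
      exact iUnion₂_subset fun j _ => subset_iUnion S j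
    simpa only [hsplit, sub_zero] using hT.const_sub (l (⋃ j, S j))
  -- The limiting masses form a finite measure absolutely continuous with respect to Lebesgue
  -- measure; the weak limit is its Radon–Nikodym density.
  let μ : Measure E3 := Measure.ofMeasurable (fun S _ => ENNReal.ofReal (l S))
    (by simp [l_empty]) (by
      intro S mS dS
      have h := l_sum mS dS
      rw [← h.tsum_eq, ENNReal.ofReal_tsum_of_nonneg (fun n => l_nonneg _) h.summable])
  have hμ : ∀ S, MeasurableSet S → μ S = ENNReal.ofReal (l S) := fun S mS =>
    Measure.ofMeasurable_apply S mS
  have hfin : IsFiniteMeasure μ := ⟨by rw [hμ _ MeasurableSet.univ]; exact ENNReal.ofReal_lt_top⟩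
  have hac : μ ≪ volume := Measure.AbsolutelyContinuous.mk fun S mS hS => by
    rw [hμ S mS, l_null S hS, ENNReal.ofReal_zero]
  refine ⟨fun x => (μ.rnDeriv volume x).toReal, (Measure.measurable_rnDeriv μ volume).ennreal_toReal,
    fun x => ENNReal.toReal_nonneg, Measure.integrable_toReal_rnDeriv, fun S mS => ?_⟩
  rw [Measure.setIntegral_toReal_rnDeriv hac, measureReal_def, hμ S mS,
    ENNReal.toReal_ofReal (l_nonneg S)]
  exact hl S

/-- Convergence on measurable sets implies convergence against bounded functions. -/
lemma tendsto_integral_bounded_mul {l : Filter ι} {f : ι → E3 → ℝ} {g : E3 → ℝ} {M : ℝ}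
    (hf : ∀ i, Integrable (f i)) (h0 : ∀ i, 0 ≤ᵐ[volume] f i) (hM : ∀ i, ∫ x, f i x = M)
    (hg : Integrable g) (hg0 : 0 ≤ᵐ[volume] g) (hgM : ∫ x, g x = M)
    (hlim : ∀ S, MeasurableSet S → Tendsto (fun i => ∫ x in S, f i x) l (𝓝 (∫ x in S, g x)))
    {φ : E3 → ℝ} (hφ : Measurable φ) {C : ℝ} (hC : ∀ x, |φ x| ≤ C) :
    Tendsto (fun i => ∫ x, φ x * f i x) l (𝓝 (∫ x, φ x * g x)) := by
  rw [Metric.tendsto_nhds]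
  intro ε hε
  have hM0 : 0 ≤ M := by rw [← hgM]; exact integral_nonneg_of_ae hg0
  set e := ε / (4 * (M + 1)) with he
  have he0 : 0 < e := by positivity
  -- The function e·q takes finitely many values and lies within e of φ. Replacing φ by it costs at
  -- most eM ≤ ε/4, uniformly over the family, because all masses equal M.
  set q : E3 → ℤ := fun x => ⌊φ x / e⌋ with hq
  have hqm : Measurable q := (hφ.div_const e).floor
  obtain ⟨N, hN⟩ := exists_nat_gt (C / e + 1)
  have hqN : ∀ x, q x ∈ Finset.Icc (-(N : ℤ)) N := by
    intro x
    have h1 : |φ x / e| ≤ C / e := by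
      rw [abs_div, abs_of_pos he0]; gcongr; exact hC x
    have h2 := abs_le.1 h1
    have h3 := Int.floor_le (φ x / e)
    have h4 := Int.lt_floor_add_one (φ x / e)
    rw [Finset.mem_Icc]
    constructor
    · have : (-(N : ℤ) : ℝ) ≤ q x := by simp only [hq]; push_cast; linarith
      exact_mod_cast this
    · have : (q x : ℝ) ≤ (N : ℤ) := by simp only [hq]; push_cast; linarith
      exact_mod_cast this
  have mS : ∀ j : ℤ, MeasurableSet (q ⁻¹' {j}) := fun j => hqm (measurableSet_singleton j)
  have hstep : ∀ F : E3 → ℝ, Integrable F → ∫ x, (e * q x) * F x =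
      ∑ j ∈ Finset.Icc (-(N : ℤ)) N, (e * j) * ∫ x in q ⁻¹' {j}, F x := by
    intro F hF
    have : ∀ x, (e * q x) * F x =
        ∑ j ∈ Finset.Icc (-(N : ℤ)) N, (e * j) * (q ⁻¹' {j}).indicator F x := by
      intro x
      rw [Finset.sum_eq_single_of_mem (q x) (hqN x)]
      · simp [indicator]
      · intro j _ hj
        have : x ∉ q ⁻¹' {j} := fun h => hj h.symm
        simp [indicator_of_notMem this]
    simp only [this]
    rw [integral_finsetSum]
    · refine Finset.sum_congr rfl fun j _ => ?_
      rw [integral_const_mul, integral_indicator (mS j)]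
    · exact fun j _ => (hF.indicator (mS j)).const_mul _
  have herr : ∀ F : E3 → ℝ, Integrable F → 0 ≤ᵐ[volume] F → ∫ x, F x = M →
      |(∫ x, φ x * F x) - ∫ x, (e * q x) * F x| ≤ ε / 4 := by
    intro F hF hF0 hFM
    have i1 : Integrable (fun x => φ x * F x) :=
      hF.bdd_mul hφ.aestronglyMeasurable (ae_of_all _ hC)
    have i2 : Integrable (fun x => (e * q x) * F x) := by
      refine hF.bdd_mul (c := e * N) (Measurable.aestronglyMeasurable
        ((measurable_from_top.comp hqm).const_mul e)) (ae_of_all _ fun x => ?_)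
      have := Finset.mem_Icc.1 (hqN x)
      rw [norm_mul, Real.norm_of_nonneg he0.le, Real.norm_eq_abs]
      have h2 : |q x| ≤ (N : ℤ) := abs_le.2 this
      have h3 : |(q x : ℝ)| ≤ N := by exact_mod_cast h2
      gcongr
    rw [← integral_sub i1 i2, ← Real.norm_eq_abs]
    refine (norm_integral_le_of_norm_le (hF.const_mul e) ?_).trans ?_
    · filter_upwards [hF0] with x hx
      simp only [Pi.zero_apply] at hx
      rw [← sub_mul, norm_mul, Real.norm_of_nonneg hx]
      gcongr
      have h3 := Int.floor_le (φ x / e)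
      have h4 := Int.lt_floor_add_one (φ x / e)
      rw [le_div_iff₀ he0] at h3
      rw [div_lt_iff₀ he0] at h4
      rw [Real.norm_eq_abs, abs_le]
      constructor <;> simp only [hq] <;> linarith
    · rw [integral_const_mul, hFM, he, div_mul_eq_mul_div, div_le_iff₀ (by positivity)]
      linarith
  have hsum : Tendsto (fun i => ∫ x, (e * q x) * f i x) l (𝓝 (∫ x, (e * q x) * g x)) := by
    simp only [hstep _ hg, hstep _ (hf _)]
    exact tendsto_finsetSum _ fun j _ => (hlim _ (mS j)).const_mul _
  filter_upwards [Metric.tendsto_nhds.1 hsum (ε / 4) (by positivity)] with i hi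
  rw [Real.dist_eq] at hi ⊢
  have h1 := abs_le.1 (herr _ (hf i) (h0 i) (hM i))
  have h2 := abs_le.1 (herr _ hg hg0 hgM)
  have h3 := abs_lt.1 hi
  rw [abs_lt]
  constructor <;> linarith

end EulerPoisson

/-! ### Compactness of the Coulomb form along weak limits -/

namespace EulerPoisson

variable {ι : Type*} {Φ : ℝ → ℝ} {M : ℝ}

/-- Lower semicontinuity of the internal energy. -/
lemma phiInt_le_of_weak_limit (hΦ : Admissible Φ) {l : Filter ι} [l.NeBot] {f : ι → E3 → ℝ}
    {g : E3 → ℝ} {P : ℝ} (hf : ∀ i, InClass Φ M (f i)) (hgm : Measurable g) (hg0 : ∀ x, 0 ≤ g x)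
    (hg : Integrable g) (hgM : ∫ x, g x = M)
    (hlim : ∀ S, MeasurableSet S → Tendsto (fun i => ∫ x in S, f i x) l (𝓝 (∫ x in S, g x)))
    (hP : ∀ᶠ i in l, phiInt Φ (f i) ≤ P) :
    Integrable (fun x => Φ (g x)) ∧ phiInt Φ g ≤ P := by
  -- Truncation to where g is bounded makes Φ'(g) a bounded function, hence admissible as a test
  -- function for the weak convergence.
  set S : ℕ → Set E3 := fun n => Metric.ball 0 n ∩ {x | g x ≤ n} with hS
  have mS : ∀ n, MeasurableSet (S n) := fun n =>
    measurableSet_ball.inter (measurableSet_le hgm measurable_const)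
  have vS : ∀ n, volume (S n) ≠ ⊤ := fun n =>
    ((measure_mono inter_subset_left).trans_lt measure_ball_lt_top).ne
  have cover : AECover volume atTop S := by
    refine ⟨ae_of_all _ fun x => ?_, mS⟩
    obtain ⟨N, hN⟩ := exists_nat_gt (max ‖x‖ (g x))
    filter_upwards [eventually_ge_atTop N] with n hn
    have hn' : (N : ℝ) ≤ n := by exact_mod_cast hn
    refine ⟨?_, ?_⟩
    · simpa using (le_max_left _ _).trans_lt (hN.trans_le hn')
    · exact ((le_max_right ‖x‖ _).trans_lt (hN.trans_le hn')).le
  have hmax : ∀ x, max (g x) 0 = g x := fun x => max_eq_left (hg0 x)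
  have hΦg : Measurable (fun x => Φ (g x)) := by
    simpa [Function.comp_def, hmax] using hΦ.continuous_max.measurable.comp hgm
  have hDg : Measurable (fun x => derivWithin Φ (Ici 0) (g x)) := by
    simpa [Function.comp_def, hmax] using hΦ.continuous_deriv_max.measurable.comp hgm
  have bound : ∀ (h : ℝ → ℝ), ContinuousOn h (Ici 0) → ∀ n : ℕ, ∃ C, 0 ≤ C ∧ ∀ x ∈ S n, |h (g x)| ≤ C := by
    intro h hh n
    obtain ⟨C, hC⟩ := (isCompact_Icc (a := (0 : ℝ)) (b := n)).exists_bound_of_continuousOn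
      (hh.mono Icc_subset_Ici_self)
    exact ⟨|C|, abs_nonneg C, fun x hx => (hC _ ⟨hg0 x, hx.2⟩).trans (le_abs_self C)⟩
  have iΦ : ∀ n, IntegrableOn (fun x => Φ (g x)) (S n) := by
    intro n
    obtain ⟨C, -, hC⟩ := bound Φ hΦ.continuousOn n
    refine Measure.integrableOn_of_bounded (M := C) (vS n) hΦg.aestronglyMeasurable ?_
    filter_upwards [ae_restrict_mem (mS n)] with x hx
    exact hC x hx
  have key : ∀ n, ∫ x in S n, Φ (g x) ≤ P := by
    intro n
    obtain ⟨C, hC0, hC⟩ := bound _ hΦ.continuousOn_deriv n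
    set φ : E3 → ℝ := (S n).indicator fun x => derivWithin Φ (Ici 0) (g x) with hφ
    have mφ : Measurable φ := hDg.indicator (mS n)
    have hφC : ∀ x, |φ x| ≤ C := by
      intro x
      by_cases hx : x ∈ S n
      · simp only [hφ, indicator_of_mem hx]; exact hC x hx
      · simp only [hφ, indicator_of_notMem hx, abs_zero]; exact hC0
    have t := tendsto_integral_bounded_mul (fun i => (hf i).integrable) (fun i => (hf i).nonneg)
      (fun i => (hf i).integral_eq) hg (ae_of_all _ hg0) hgM hlim mφ hφC
    have iφ : ∀ {F : E3 → ℝ}, Integrable F → Integrable (fun x => φ x * F x) := fun hF =>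
      hF.bdd_mul mφ.aestronglyMeasurable (ae_of_all _ hφC)
    have t' : Tendsto (fun i => P - ((∫ x, φ x * f i x) - ∫ x, φ x * g x)) l (𝓝 P) := by
      simpa using (t.sub_const (∫ x, φ x * g x)).const_sub P
    refine ge_of_tendsto t' ?_
    filter_upwards [hP] with i hi
    -- On S n the graph of Φ lies above its tangent at g; elsewhere Φ ≥ 0 is enough.
    have h1 : (∫ x in S n, Φ (g x)) + ((∫ x, φ x * f i x) - ∫ x, φ x * g x) ≤ phiInt Φ (f i) := by
      have i1 : Integrable ((S n).indicator fun x => Φ (g x)) :=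
        (integrable_indicator_iff (mS n)).2 (iΦ n)
      have i2 : Integrable (fun x => φ x * f i x - φ x * g x) :=
        (iφ (hf i).integrable).sub (iφ hg)
      rw [← integral_indicator (mS n), ← integral_sub (iφ (hf i).integrable) (iφ hg),
        ← integral_add i1 i2]
      refine integral_mono_ae (i1.add i2) (hf i).integrable_comp ?_
      filter_upwards [(hf i).nonneg] with x hx
      by_cases hxS : x ∈ S n
      · simp only [hφ, indicator_of_mem hxS]
        have := hΦ.tangent_le (hg0 x) hx
        linarith
      · simp only [hφ, indicator_of_notMem hxS]
        have := hΦ.nonneg hx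
        simpa using this
    linarith
  have hint : Integrable (fun x => Φ (g x)) :=
    cover.integrable_of_integral_bounded_of_nonneg_ae P iΦ
      (ae_of_all _ fun x => hΦ.nonneg (hg0 x)) (Eventually.of_forall key)
  exact ⟨hint, le_of_tendsto (cover.integral_tendsto_of_countably_generated hint)
    (Eventually.of_forall key)⟩

/-- The kernel `1 / max |z| r`. -/
def truncKernel (r : ℝ) (z : E3) : ℝ := (max ‖z‖ r)⁻¹

lemma continuous_truncKernel {r : ℝ} (hr : 0 < r) : Continuous (truncKernel r) :=
  (continuous_norm.max continuous_const).inv₀ fun _ => (lt_max_of_lt_right hr).ne'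

lemma truncKernel_nonneg {r : ℝ} (hr : 0 < r) (z : E3) : 0 ≤ truncKernel r z :=
  inv_nonneg.2 (lt_max_of_lt_right hr).le

lemma abs_truncKernel_le {r : ℝ} (hr : 0 < r) (z : E3) : |truncKernel r z| ≤ r⁻¹ := by
  rw [abs_of_nonneg (truncKernel_nonneg hr z)]
  exact inv_anti₀ hr (le_max_right _ _)

lemma abs_truncKernel_sub_le {r : ℝ} (hr : 0 < r) (z w : E3) :
    |truncKernel r z - truncKernel r w| ≤ ‖z - w‖ / r ^ 2 := by
  have h1 : 0 < max ‖z‖ r := lt_max_of_lt_right hr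
  have h2 : 0 < max ‖w‖ r := lt_max_of_lt_right hr
  rw [truncKernel, truncKernel, inv_sub_inv h1.ne' h2.ne', abs_div, abs_of_pos (mul_pos h1 h2)]
  gcongr
  · have h3 := abs_max_sub_max_le_abs ‖w‖ ‖z‖ r
    have h4 := abs_norm_sub_norm_le w z
    rw [norm_sub_rev]
    exact h3.trans h4
  · rw [sq]
    exact mul_le_mul (le_max_right _ _) (le_max_right _ _) hr.le h1.le

/-- The kernel 1/max(|z|,r) is bounded and continuous, so weak convergence applies to it. It differs
from 1/|z| only for |z| < r, and there the near part absorbs the difference. -/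
lemma coulomb_self_le_trunc {u : E3 → ℝ} (hu : IsDensity u) {r : ℝ} (hr : 0 < r) :
    Integrable (fun x => u x * ∫ y, truncKernel r (x - y) * u y) ∧
    coulomb u u ≤ nearCoulomb r u u + ∫ x, u x * ∫ y, truncKernel r (x - y) * u y := by
  have mk : Measurable (truncKernel r) := (continuous_truncKernel hr).measurable
  have i1 : Integrable (fun p : E3 × E3 => u p.1 * (truncKernel r (p.1 - p.2) * u p.2))
      ((volume : Measure E3).prod volume) := by
    refine (far_aux hu hu r).mono' ?_ (ae_of_all _ fun p => ?_)
    · exact hu.integrable.1.comp_fst.mul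
        ((mk.comp (measurable_fst.sub measurable_snd)).aestronglyMeasurable.mul
          hu.integrable.1.comp_snd)
    · rw [norm_mul, norm_mul, Real.norm_eq_abs, Real.norm_eq_abs, Real.norm_eq_abs, mul_comm |truncKernel r _|, ← mul_assoc]
      gcongr
      exact abs_truncKernel_le hr _
  have i2 := integrable_nearIntegrand hu hu hr.le
  have i1' := i1.integral_prod_left
  have e : ∫ x, u x * ∫ y, truncKernel r (x - y) * u y = ∫ p : E3 × E3, u p.1 *
      (truncKernel r (p.1 - p.2) * u p.2) ∂((volume : Measure E3).prod volume) := by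
    rw [integral_prod _ i1]
    simp only [integral_const_mul]
  refine ⟨?_, ?_⟩
  · simpa only [integral_const_mul] using i1'
  · rw [e, nearCoulomb, ← integral_add i2 i1, coulomb]
    refine integral_mono_ae (hasCoulomb hu hu) (i2.add i1) ?_
    filter_upwards [ae_prod_ne] with p hp
    have hp' : ‖p.1 - p.2‖ ≠ 0 := by rw [norm_sub_rev]; exact norm_ne_zero_iff.2 hp
    have hpos : 0 < ‖p.1 - p.2‖ := lt_of_le_of_ne (norm_nonneg _) (Ne.symm hp')
    rw [coulombIntegrand, nearIntegrand]
    by_cases h : ‖p.1 - p.2‖ < r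
    · have e1 : nearInv r (p.1 - p.2) = ‖p.1 - p.2‖⁻¹ := by simp [nearInv, h]
      have e2 : truncKernel r (p.1 - p.2) = r⁻¹ := by simp [truncKernel, h.le]
      rw [e1, e2]
      have h1 : r⁻¹ ≤ ‖p.1 - p.2‖⁻¹ := by gcongr
      have h2 : u p.1 * u p.2 ≤ |u p.1| * |u p.2| := by rw [← abs_mul]; exact le_abs_self _
      have h3 : 0 < r⁻¹ := inv_pos.2 hr
      have h4 := mul_le_mul_of_nonneg_right h2 (sub_nonneg.2 h1)
      have h5 : 0 ≤ |u p.1| * |u p.2| * r⁻¹ := by positivity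
      linarith
    · have e2 : truncKernel r (p.1 - p.2) = ‖p.1 - p.2‖⁻¹ := by simp [truncKernel, not_lt.1 h]
      rw [e2]
      have := nearInv_nonneg r (p.1 - p.2)
      have h5 : 0 ≤ |u p.1| * |u p.2| * nearInv r (p.1 - p.2) := by positivity
      linarith

/-- Convergence of the Coulomb energy along weakly convergent, tight families. -/
lemma coulomb_sub_self_small {l : Filter ι} {f : ι → E3 → ℝ} {g : E3 → ℝ} {K : ℝ}
    (hf : ∀ i, IsDensity (f i)) (h0 : ∀ i, 0 ≤ᵐ[volume] f i) (hM : ∀ i, ∫ x, f i x = M)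
    (hK : ∀ i, powMass (f i) ≤ K) (hg : IsDensity g) (hg0 : 0 ≤ᵐ[volume] g) (hgM : ∫ x, g x = M)
    (hlim : ∀ S, MeasurableSet S → Tendsto (fun i => ∫ x in S, f i x) l (𝓝 (∫ x in S, g x)))
    (tight : ∀ ε : ℝ, 0 < ε → ∃ R : ℝ, ∫ x in (Metric.ball 0 R)ᶜ, g x ≤ ε ∧
      ∀ᶠ i in l, ∫ x in (Metric.ball 0 R)ᶜ, f i x ≤ ε) {ε : ℝ} (hε : 0 < ε) :
    ∀ᶠ i in l, coulomb (f i - g) (f i - g) ≤ ε := by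
  have hM0 : 0 ≤ M := by rw [← hgM]; exact integral_nonneg_of_ae hg0
  have massAbs : ∀ {F : E3 → ℝ}, 0 ≤ᵐ[volume] F → ∫ x, F x = M → absMass F = M := by
    intro F h1 h2
    rw [absMass, ← h2]
    refine integral_congr_ae ?_
    filter_upwards [h1] with x hx
    exact abs_of_nonneg hx
  set K' := 4 * (|K| + powMass g) with hK'
  have hK'0 : 0 ≤ K' := by have := powMass_nonneg g; positivity
  set D := K' ^ 2 / 2 + 2 * Real.pi * K' + 1 with hD
  have hD0 : 0 < D := by positivity
  set s := ε / (4 * D) with hs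
  have hs0 : 0 < s := by positivity
  set r := s ^ 2 with hr
  have hr0 : 0 < r := by positivity
  set η := ε * r / (16 * (M + 1)) with hη
  have hη0 : 0 < η := by positivity
  obtain ⟨R, hgR, hfR⟩ := tight η hη0
  set e := ε / (8 * (M + 1)) with he
  have he0 : 0 < e := by positivity
  set d := e * r ^ 2 / (4 * (M + 1)) with hd
  have hd0 : 0 < d := by positivity
  -- Weak convergence controls the convolution with the truncated kernel only pointwise. The kernel
  -- is Lipschitz with constant 1/r² and the mass of |f i - g| is at most 2M, so a finite net of
  -- mesh d gives uniformity on the ball.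
  obtain ⟨t, -, htf, htc⟩ := (isCompact_closedBall (0 : E3) R).finite_cover_balls hd0
  have hpt : ∀ z : E3, ∀ᶠ i in l, |∫ y, truncKernel r (z - y) * (f i - g) y| ≤ e / 2 := by
    intro z
    have mk : Measurable (fun y => truncKernel r (z - y)) :=
      ((continuous_truncKernel hr0).comp (by fun_prop)).measurable
    have hb : ∀ y, |truncKernel r (z - y)| ≤ r⁻¹ := fun y => abs_truncKernel_le hr0 _
    have := tendsto_integral_bounded_mul (fun i => (hf i).integrable) h0 hM hg.integrable hg0 hgM
      hlim mk hb
    filter_upwards [Metric.tendsto_nhds.1 this (e / 2) (by positivity)] with i hi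
    rw [Real.dist_eq, ← integral_sub] at hi
    · simpa only [Pi.sub_apply, mul_sub] using hi.le
    · exact (hf i).integrable.bdd_mul mk.aestronglyMeasurable (ae_of_all _ hb)
    · exact hg.integrable.bdd_mul mk.aestronglyMeasurable (ae_of_all _ hb)
  have hall : ∀ᶠ i in l, ∀ z ∈ t, |∫ y, truncKernel r (z - y) * (f i - g) y| ≤ e / 2 :=
    (eventually_all_finite htf).2 fun z _ => hpt z
  filter_upwards [hall, hfR] with i hi hfRi
  set u := f i - g with hu
  have hud : IsDensity u := (hf i).sub hg
  have huM : absMass u ≤ 2 * M := by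
    have := absMass_sub_le (hf i) hg
    rw [massAbs (h0 i) (hM i), massAbs hg0 hgM] at this
    linarith
  have huK : powMass u ≤ K' := by
    have := powMass_sub_le (hf i) hg
    have := hK i
    have := le_abs_self K
    rw [hK']; linarith
  have hTi : ∀ x, Integrable (fun y => truncKernel r (x - y) * u y) := fun x =>
    hud.integrable.bdd_mul ((continuous_truncKernel hr0).comp
      (continuous_const.sub continuous_id)).aestronglyMeasurable
      (ae_of_all _ fun y => abs_truncKernel_le hr0 _)
  have hTb : ∀ x, |∫ y, truncKernel r (x - y) * u y| ≤ 2 * M * r⁻¹ := by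
    intro x
    rw [← Real.norm_eq_abs]
    refine (norm_integral_le_of_norm_le (hud.integrable.abs.const_mul r⁻¹)
      (ae_of_all _ fun y => ?_)).trans ?_
    · rw [norm_mul]
      exact mul_le_mul_of_nonneg_right (abs_truncKernel_le hr0 _) (norm_nonneg _)
    · rw [integral_const_mul, mul_comm]
      exact mul_le_mul_of_nonneg_right huM (by positivity)
  have hTs : ∀ x ∈ Metric.closedBall (0 : E3) R, |∫ y, truncKernel r (x - y) * u y| ≤ e := by
    intro x hx
    obtain ⟨z, hz, hxz⟩ := mem_iUnion₂.1 (htc hx)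
    have h1 := hi z hz
    have h2 : |(∫ y, truncKernel r (x - y) * u y) - ∫ y, truncKernel r (z - y) * u y| ≤ e / 2 := by
      rw [← integral_sub (hTi x) (hTi z), ← Real.norm_eq_abs]
      refine (norm_integral_le_of_norm_le (hud.integrable.abs.const_mul (d / r ^ 2))
        (ae_of_all _ fun y => ?_)).trans ?_
      · rw [← sub_mul, norm_mul]
        refine mul_le_mul_of_nonneg_right ((abs_truncKernel_sub_le hr0 _ _).trans ?_) (norm_nonneg _)
        rw [sub_sub_sub_cancel_right]
        gcongr
        rw [← dist_eq_norm]
        exact (Metric.mem_ball.1 hxz).le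
      · rw [integral_const_mul]
        calc d / r ^ 2 * ∫ y, |u y| ≤ d / r ^ 2 * (2 * (M + 1)) := by
              refine mul_le_mul_of_nonneg_left ?_ (by positivity)
              exact huM.trans (by linarith)
          _ = e / 2 := by rw [hd]; field_simp; norm_num
    have h3 := abs_sub_abs_le_abs_sub (∫ y, truncKernel r (x - y) * u y)
      (∫ y, truncKernel r (z - y) * u y)
    linarith
  obtain ⟨hint, hle⟩ := coulomb_self_le_trunc hud hr0
  have hnear : nearCoulomb r u u ≤ ε / 4 := by
    refine (nearCoulomb_sq_le hud hud hs0 huK huK).trans ?_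
    calc s * (K' ^ 2 / 2 + 2 * Real.pi * K') ≤ s * D := by gcongr; linarith
      _ = ε / 4 := by rw [hs]; field_simp
  have hout : ∫ x in (Metric.ball (0 : E3) R)ᶜ, |u x| ≤ 2 * η := by
    have hadd : ∫ x in (Metric.ball (0 : E3) R)ᶜ, (f i x + g x) ≤ 2 * η := by
      rw [integral_add (hf i).integrable.integrableOn hg.integrable.integrableOn]
      linarith
    refine le_trans (integral_mono_ae hud.integrable.abs.integrableOn
      ((hf i).integrable.add hg.integrable).integrableOn (ae_restrict_of_ae ?_)) hadd
    filter_upwards [h0 i, hg0] with x h1 h2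
    have := abs_sub (f i x) (g x)
    rwa [abs_of_nonneg h1, abs_of_nonneg h2] at this
  -- Inside the ball the convolution is at most e; outside it is only bounded by 2M/r, but there |u|
  -- has mass at most 2η.
  have hmain : ∫ x, u x * ∫ y, truncKernel r (x - y) * u y ≤
      e * (2 * M) + 2 * M * r⁻¹ * (2 * η) := by
    have i2 : Integrable (fun x => e * |u x| + 2 * M * r⁻¹ *
        (Metric.ball (0 : E3) R)ᶜ.indicator (fun x => |u x|) x) :=
      (hud.integrable.abs.const_mul e).add
        ((hud.integrable.abs.indicator measurableSet_ball.compl).const_mul _)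
    refine (integral_mono hint i2 fun x => ?_).trans ?_
    · refine (le_abs_self _).trans ?_
      rw [abs_mul]
      by_cases hx : x ∈ Metric.ball (0 : E3) R
      · have h1 := hTs x (Metric.ball_subset_closedBall hx)
        simp only [indicator_of_notMem (show x ∉ (Metric.ball (0 : E3) R)ᶜ from fun h => h hx),
          mul_zero, add_zero]
        rw [mul_comm e]
        exact mul_le_mul_of_nonneg_left h1 (abs_nonneg _)
      · have h1 := hTb x
        simp only [indicator_of_mem (show x ∈ (Metric.ball (0 : E3) R)ᶜ from hx)]
        have h2 := mul_le_mul_of_nonneg_left h1 (abs_nonneg (u x))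
        have h3 : 0 ≤ e * |u x| := by positivity
        linarith
    · rw [integral_add (hud.integrable.abs.const_mul e)
        ((hud.integrable.abs.indicator measurableSet_ball.compl).const_mul _), integral_const_mul,
        integral_const_mul, integral_indicator measurableSet_ball.compl]
      have : (0 : ℝ) ≤ 2 * M * r⁻¹ := by positivity
      exact add_le_add (mul_le_mul_of_nonneg_left huM he0.le) (mul_le_mul_of_nonneg_left hout this)
  have b1 : e * (2 * M) ≤ ε / 4 := by
    calc e * (2 * M) ≤ e * (2 * (M + 1)) := by gcongr; linarith
      _ = ε / 4 := by rw [he]; field_simp; norm_num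
  have b2 : 2 * M * r⁻¹ * (2 * η) ≤ ε / 4 := by
    calc 2 * M * r⁻¹ * (2 * η) ≤ 2 * (M + 1) * r⁻¹ * (2 * η) := by gcongr; linarith
      _ = ε / 4 := by rw [hη]; field_simp; norm_num
  linarith

end EulerPoisson

/-! ### Near-minimal densities are close to minimizers -/

namespace EulerPoisson

variable {ι : Type*} {Φ : ℝ → ℝ} {M : ℝ}

lemma coulomb_smul_left (c : ℝ) (f g : E3 → ℝ) : coulomb (c • f) g = c * coulomb f g := by
  rw [coulomb, coulomb, ← integral_const_mul]
  congr 1; ext p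
  simp [coulombIntegrand]; ring

lemma coulomb_smul_right (c : ℝ) (f g : E3 → ℝ) : coulomb f (c • g) = c * coulomb f g := by
  rw [coulomb_comm, coulomb_smul_left, coulomb_comm]

lemma IsDensity.smul {f : E3 → ℝ} (hf : IsDensity f) {c : ℝ} (hc : |c| ≤ 1) :
    IsDensity (c • f) :=
  hf.of_le (hf.integrable.1.const_smul c) fun x => by
    simp only [Pi.smul_apply, smul_eq_mul, abs_mul]
    exact mul_le_of_le_one_left (abs_nonneg _) hc

/-- Positivity of J(tg - u, tg - u), divided by t. -/
lemma two_mul_coulomb_le {g u : E3 → ℝ} (hg : IsDensity g) (hu : IsDensity u) {t : ℝ}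
    (ht : 0 < t) (ht1 : t ≤ 1) : 2 * coulomb g u ≤ t * coulomb g g + coulomb u u / t := by
  have d1 : IsDensity (t • g) := hg.smul (by rw [abs_of_pos ht]; exact ht1)
  have d2 : IsDensity ((-1 : ℝ) • u) := hu.smul (by simp)
  have h := coulomb_self_nonneg (d1.add d2).integrable (hasCoulomb (d1.add d2) (d1.add d2))
  rw [coulomb_add_self d1 d2] at h
  simp only [coulomb_smul_left, coulomb_smul_right] at h
  have : t * (2 * coulomb g u) ≤ t * (t * coulomb g g + coulomb u u / t) := by
    rw [mul_add, mul_div_cancel₀ _ ht.ne']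
    linarith
  exact le_of_mul_le_mul_left this ht

lemma coulomb_add_self_le {g u : E3 → ℝ} (hg : IsDensity g) (hu : IsDensity u) {t : ℝ}
    (ht : 0 < t) (ht1 : t ≤ 1) :
    coulomb (g + u) (g + u) ≤ (1 + t) * coulomb g g + (1 + 1 / t) * coulomb u u := by
  rw [coulomb_add_self hg hu]
  have := two_mul_coulomb_le hg hu ht ht1
  have e : coulomb u u / t = 1 / t * coulomb u u := by ring
  linarith

/-- Energy-minimizing families which do not vanish at the origin are tight. -/
lemma tight_of_minimizing (hΦ : Admissible Φ) (hM : 0 < M) {U : Ultrafilter ι} {f : ι → E3 → ℝ}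
    (hf : ∀ i, InClass Φ M (f i)) {K : ℝ} (hK : ∀ i, powMass (f i) ≤ K)
    (hE : Tendsto (fun i => redEnergy Φ (f i)) U (𝓝 (infEnergy Φ M))) {R₀ δ : ℝ}
    (hδ : 0 < δ) (hconc : ∀ᶠ i in (U : Filter ι), δ ≤ ∫ x in Metric.ball 0 R₀, f i x)
    {ε : ℝ} (hε : 0 < ε) :
    ∃ R : ℝ, ∀ᶠ i in (U : Filter ι), ∫ x in (Metric.ball 0 R)ᶜ, f i x ≤ ε := by
  have hneg := infEnergy_neg hΦ hM
  set h := infEnergy Φ M with hh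
  have hnn : ∀ i (S : Set E3), 0 ≤ ∫ x in S, f i x := fun i S =>
    integral_nonneg_of_ae (ae_restrict_of_ae (hf i).nonneg)
  have hle : ∀ i (S : Set E3), ∫ x in S, f i x ≤ M := fun i S => by
    rw [← (hf i).integral_eq]; exact setIntegral_le_integral (hf i).integrable (hf i).nonneg
  have hex : ∀ R : ℝ, ∃ m ∈ Icc 0 M, Tendsto (fun i => ∫ x in Metric.ball 0 R, f i x) U (𝓝 m) := by
    intro R
    obtain ⟨m, hm, hl⟩ := (isCompact_Icc (a := (0 : ℝ)) (b := M)).ultrafilter_le_nhds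
      (U.map fun i => ∫ x in Metric.ball 0 R, f i x)
      (by
        rw [le_principal_iff]
        exact Ultrafilter.mem_map.2 (Eventually.of_forall fun i => ⟨hnn i _, hle i _⟩))
    exact ⟨m, hm, hl⟩
  choose m hmI hm using hex
  have m_mono : Monotone m := fun R R' hRR' =>
    le_of_tendsto_of_tendsto (hm R) (hm R') (Eventually.of_forall fun i =>
      setIntegral_mono_set (hf i).integrable.integrableOn (ae_restrict_of_ae (hf i).nonneg)
        (LE.le.eventuallyLE (Metric.ball_subset_ball hRR')))
  have hbdd : BddAbove (range m) := ⟨M, by rintro _ ⟨R, rfl⟩; exact (hmI R).2⟩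
  set mi := ⨆ R, m R with hmi
  have hmiM : mi ≤ M := ciSup_le fun R => (hmI R).2
  have hm0 : δ ≤ m R₀ := ge_of_tendsto (hm R₀) hconc
  -- Here mi is the mass that remains at finite distance in the limit. If it were less than M, the
  -- family would split into two separated pieces, which the strict subadditivity forbids.
  have hsup : M ≤ mi := by
    by_contra! hlt
    have hK0 : 0 ≤ K := by
      obtain ⟨i, -⟩ := hconc.exists
      exact (powMass_nonneg _).trans (hK i)
    -- A lower bound for the cost of splitting: the inner mass fraction is at least δ/M and the
    -- outer one at least 1 - mi/M.
    set c := 4 / 3 * (δ / M * (1 - mi / M)) * -h with hc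
    have hc0 : 0 < c := by
      have h1 : 0 < 1 - mi / M := by rw [sub_pos, div_lt_one hM]; exact hlt
      have : 0 < -h := by linarith
      positivity
    set D := K ^ 2 / 2 + 2 * Real.pi * K + 1 with hD
    have hD0 : 0 < D := by positivity
    set s := c / (4 * D) with hs
    have hs0 : 0 < s := by positivity
    -- With R' - R = 1/η and limiting annulus mass at most η, the two remaining errors add up to at
    -- most c/4; with the short-range error c/4 the total stays below c.
    set η := c / (4 * (M / s ^ 2 + M ^ 2)) with hη
    have hη0 : 0 < η := by positivity
    obtain ⟨R₁, hR₁⟩ := exists_lt_of_lt_ciSup (show mi - η < mi by linarith)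
    set R := max R₀ R₁ with hR
    have hmR : mi - η < m R := hR₁.trans_le (m_mono (le_max_right _ _))
    have hmR0 : δ ≤ m R := hm0.trans (m_mono (le_max_left _ _))
    have hmR1 : m R ≤ mi := le_ciSup hbdd R
    set R' := R + 1 / η with hR'
    have hRR' : R < R' := by have : 0 < 1 / η := by positivity
                             linarith
    have hann : Tendsto (fun i => ∫ x in Metric.ball 0 R' \ Metric.ball 0 R, f i x) U
        (𝓝 (m R' - m R)) := by
      refine ((hm R').sub (hm R)).congr fun i => ?_
      rw [setIntegral_sdiff measurableSet_ball (hf i).integrable.integrableOn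
        (Metric.ball_subset_ball hRR'.le)]
    have hsplit : ∀ i, 4 / 3 * ((∫ x in Metric.ball 0 R, f i x) / M *
        (1 - (∫ x in Metric.ball 0 R, f i x) / M)) * -h ≤ redEnergy Φ (f i) - h +
        (s * (K ^ 2 / 2 + 2 * Real.pi * K) +
        M * (∫ x in Metric.ball 0 R' \ Metric.ball 0 R, f i x) / s ^ 2 + M ^ 2 / (R' - R)) := by
      intro i
      exact splitting_estimate hΦ hM hneg.le (hf i) (hK i) hs0 hRR' (by field_simp)
    have hlim := le_of_tendsto_of_tendsto
      (((((hm R).div_const M).mul (((hm R).div_const M).const_sub 1)).const_mul (4 / 3)).mul_const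
        (-h)) (((hE.sub_const h).add ((((hann.const_mul M).div_const (s ^ 2)).const_add
          (s * (K ^ 2 / 2 + 2 * Real.pi * K))).add_const (M ^ 2 / (R' - R)))))
      (Eventually.of_forall hsplit)
    rw [sub_self, zero_add] at hlim
    have b0 : c ≤ 4 / 3 * (m R / M * (1 - m R / M)) * -h := by
      have h1 : 0 ≤ 1 - mi / M := by rw [sub_nonneg, div_le_one hM]; exact hmiM
      have h2 : 0 ≤ m R / M := div_nonneg (hmI R).1 hM.le
      have : 0 ≤ -h := by linarith
      rw [hc]
      gcongr
    have b1 : s * (K ^ 2 / 2 + 2 * Real.pi * K) ≤ c / 4 := by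
      calc s * (K ^ 2 / 2 + 2 * Real.pi * K) ≤ s * D := by gcongr; linarith
        _ = c / 4 := by rw [hs]; field_simp
    have b2 : M * (m R' - m R) / s ^ 2 + M ^ 2 / (R' - R) ≤ c / 4 := by
      have h1 : m R' - m R ≤ η := by have := le_ciSup hbdd R'; linarith
      have h2 : R' - R = 1 / η := by rw [hR']; ring
      rw [h2]
      calc M * (m R' - m R) / s ^ 2 + M ^ 2 / (1 / η) ≤ M * η / s ^ 2 + M ^ 2 / (1 / η) := by gcongr
        _ = η * (M / s ^ 2 + M ^ 2) := by field_simp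
        _ = c / 4 := by rw [hη]; field_simp
    linarith
  obtain ⟨R, hR⟩ := exists_lt_of_lt_ciSup (show mi - ε < mi by linarith)
  refine ⟨R, ?_⟩
  filter_upwards [(hm R).eventually_const_lt hR] with i hi
  have := integral_add_compl (measurableSet_ball (x := (0 : E3)) (ε := R)) (hf i).integrable
  rw [(hf i).integral_eq] at this
  linarith

/-- Compactness of minimizing sequences: densities of almost minimal energy are close, in the
Coulomb norm, to minimizers. -/
theorem exists_near_minimizer (hΦ : Admissible Φ) (hM : 0 < M) {ε : ℝ} (hε : 0 < ε) :
    ∃ δ : ℝ, 0 < δ ∧ ∀ f, InClass Φ M f → redEnergy Φ f < infEnergy Φ M + δ →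
      ∃ g, InClass Φ M g ∧ redEnergy Φ g = infEnergy Φ M ∧ coulomb (f - g) (f - g) < ε := by
  by_contra! hcon
  have hneg := infEnergy_neg hΦ hM
  set h := infEnergy Φ M with hh
  choose f hf hfE hfar using fun n : ℕ => hcon (1 / ((n : ℝ) + 1)) (by positivity)
  have hE : Tendsto (fun n => redEnergy Φ (f n)) atTop (𝓝 h) := by
    refine tendsto_of_tendsto_of_tendsto_of_le_of_le tendsto_const_nhds
      (by simpa using (tendsto_one_div_add_atTop_nhds_zero_nat (𝕜 := ℝ)).const_add h)
      (fun n => infEnergy_le hΦ (hf n)) (fun n => (hfE n).le)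
  obtain ⟨C, hC0, hC⟩ := exists_coercive hΦ M
  have hE1 : ∀ n, redEnergy Φ (f n) ≤ h + 1 := by
    intro n
    have : 1 / ((n : ℝ) + 1) ≤ 1 := by
      rw [div_le_one (by positivity)]
      have : (0 : ℝ) ≤ n := by positivity
      linarith
    linarith [hfE n]
  set P := 2 * (h + 1 + C) with hP
  have hphi : ∀ n, phiInt Φ (f n) ≤ P := fun n => by
    have := (hC M (f n) le_rfl (hf n)).1
    have := hE1 n
    linarith
  set K := P + C with hK
  have hpow : ∀ n, powMass (f n) ≤ K := fun n => by
    have := (hC M (f n) le_rfl (hf n)).2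
    have := hphi n
    linarith
  have hK0 : 0 ≤ K := (powMass_nonneg _).trans (hpow 0)
  obtain ⟨R₀, δ, hR₀, hδ, hconc⟩ := exists_concentration hΦ hM hneg hK0
  -- Concentration needs energy at most h/2, which holds for all large n; the shift 0 for the other
  -- indices is a harmless default.
  have hshift : ∀ n, ∃ a : E3, redEnergy Φ (f n) ≤ h / 2 → δ ≤ ∫ x in Metric.ball a R₀, f n x := by
    intro n
    by_cases hn : redEnergy Φ (f n) ≤ h / 2
    · obtain ⟨a, ha⟩ := hconc (f n) (hf n) (hpow n) hn
      exact ⟨a, fun _ => ha⟩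
    · exact ⟨0, fun h' => absurd h' hn⟩
  choose a ha using hshift
  set F : ℕ → E3 → ℝ := fun n => shift (a n) (f n) with hF
  have hFc : ∀ n, InClass Φ M (F n) := fun n => (hf n).shift (a n)
  have hFd : ∀ n, IsDensity (F n) := fun n => (hFc n).isDensity hΦ
  have hFp : ∀ n, powMass (F n) ≤ K := fun n => by rw [hF, powMass_shift]; exact hpow n
  set U : Ultrafilter ℕ := hyperfilter ℕ with hU
  have hUle : (U : Filter ℕ) ≤ atTop := Nat.hyperfilter_le_atTop
  have hFE : Tendsto (fun n => redEnergy Φ (F n)) U (𝓝 h) := by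
    simp only [hF, redEnergy_shift]
    exact hE.mono_left hUle
  have hFconc : ∀ᶠ n in (U : Filter ℕ), δ ≤ ∫ x in Metric.ball 0 R₀, F n x := by
    filter_upwards [(hE.mono_left hUle).eventually_le_const (show h < h / 2 by linarith)] with n hn
    rw [hF, setIntegral_ball_shift]
    exact ha n hn
  have htight := fun (e : ℝ) (he : 0 < e) => tight_of_minimizing hΦ hM hFc hFp hFE hδ hFconc he
  obtain ⟨g, hgm, hg0, hgi, hlim⟩ := exists_weak_limit U hFd (fun n => (hFc n).nonneg)
    (fun n => (hFc n).integral_eq) hFp htight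
  have hgM : ∫ x, g x = M := by
    have := hlim univ MeasurableSet.univ
    simp only [setIntegral_univ, (hFc _).integral_eq] at this
    exact tendsto_nhds_unique this tendsto_const_nhds
  have hlsc := fun {P : ℝ} (hP : ∀ᶠ n in (U : Filter ℕ), phiInt Φ (F n) ≤ P) =>
    phiInt_le_of_weak_limit hΦ hFc hgm hg0 hgi hgM hlim hP
  have hgc : InClass Φ M g := ⟨hgi, ae_of_all _ hg0,
    (hlsc (P := P) (Eventually.of_forall fun n => by rw [hF, phiInt_shift]; exact hphi n)).1, hgM⟩
  have hgd := hgc.isDensity hΦ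
  have hsmall := fun {e : ℝ} (he : 0 < e) => coulomb_sub_self_small hFd (fun n => (hFc n).nonneg)
    (fun n => (hFc n).integral_eq) hFp hgd (ae_of_all _ hg0) hgM hlim (fun e he => by
      obtain ⟨R, hR⟩ := htight e he
      exact ⟨R, le_of_tendsto (hlim _ measurableSet_ball.compl) hR, hR⟩) he
  -- The bound on ∫Φ(F n) supplied to lower semicontinuity must already contain the limiting Coulomb
  -- energy of g. Only J(F n - g, F n - g) is known to be small, so J(F n, F n) is compared with
  -- J(g,g) at the price of a factor 1 + t.
  have hgE : redEnergy Φ g = h := by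
    refine le_antisymm (le_of_forall_pos_le_add fun e he => ?_) (infEnergy_le hΦ hgc)
    have hgg := coulomb_self_nonneg hgd.integrable (hasCoulomb hgd hgd)
    set t := min 1 (e / (2 * (coulomb g g + 1))) with ht
    have ht0 : 0 < t := lt_min one_pos (by positivity)
    have ht1 : t ≤ 1 := min_le_left _ _
    have htg : t * coulomb g g ≤ e / 2 := by
      calc t * coulomb g g ≤ e / (2 * (coulomb g g + 1)) * (coulomb g g + 1) := by
            gcongr
            · exact min_le_right _ _
            · linarith
        _ = e / 2 := by field_simp
    have hev : ∀ᶠ n in (U : Filter ℕ), phiInt Φ (F n) ≤ h + e + 1 / 2 * coulomb g g := by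
      filter_upwards [hsmall (e := e / (2 * (1 + 1 / t))) (by positivity),
        hFE.eventually_le_const (show h < h + e / 2 by linarith)] with n h1 h2
      have h3 := coulomb_add_self_le hgd ((hFd n).sub hgd) ht0 ht1
      rw [add_sub_cancel] at h3
      have h4 : (1 + 1 / t) * coulomb (F n - g) (F n - g) ≤ e / 2 := by
        calc (1 + 1 / t) * coulomb (F n - g) (F n - g) ≤ (1 + 1 / t) * (e / (2 * (1 + 1 / t))) := by
              gcongr
          _ = e / 2 := by field_simp
      rw [redEnergy] at h2
      linarith
    have := (hlsc hev).2
    rw [redEnergy]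
    linarith
  obtain ⟨n, hn⟩ := (hsmall (e := ε / 2) (by positivity)).exists
  -- The limit is moved back to the original position of f n; it remains a minimizer, since the
  -- energy is translation invariant.
  have hcontra := hfar n (shift (-a n) g) (hgc.shift _) (by rw [redEnergy_shift, hgE])
  rw [← coulomb_shift _ _ (a n), shift_sub, shift_neg_shift] at hcontra
  linarith

end EulerPoisson

/-! ### Translation to the extended-valued functionals -/

namespace EulerPoisson

variable {Φ : ℝ → ℝ} {M : ℝ}

lemma mem_constraintSet_iff (hΦ : Admissible Φ) {f : E3 → ℝ} :
    f ∈ constraintSet Φ M ↔ InClass Φ M f := by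
  constructor
  · rintro ⟨h1, h2, h3, h4⟩
    refine ⟨h1, h2, ⟨hΦ.aestronglyMeasurable_comp h1.1 h2, ?_⟩, h4⟩
    rwa [hasFiniteIntegral_iff_ofReal (h2.mono fun x hx => hΦ.nonneg hx)]
  · rintro ⟨h1, h2, h3, h4⟩
    refine ⟨h1, h2, ?_, h4⟩
    have := h3.2
    rwa [hasFiniteIntegral_iff_ofReal (h2.mono fun x hx => hΦ.nonneg hx)] at this

lemma internalEnergy_eq (hΦ : Admissible Φ) {f : E3 → ℝ} (hf : InClass Φ M f) :
    internalEnergy Φ f = ENNReal.ofReal (phiInt Φ f) :=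
  (ofReal_integral_eq_lintegral_ofReal hf.integrable_comp
    (hf.nonneg.mono fun _ hx => hΦ.nonneg hx)).symm

lemma selfEnergy_eq (hΦ : Admissible Φ) {f : E3 → ℝ} (hf : InClass Φ M f) :
    selfEnergy f = ENNReal.ofReal (1 / 2 * coulomb f f) := by
  have hd := hf.isDensity hΦ
  have hJ := hasCoulomb hd hd
  have hnn : 0 ≤ᵐ[(volume : Measure E3).prod volume] coulombIntegrand f f := by
    filter_upwards [Measure.quasiMeasurePreserving_fst.ae hf.nonneg,
      Measure.quasiMeasurePreserving_snd.ae hf.nonneg] with p h1 h2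
    exact mul_nonneg (mul_nonneg h1 h2) (by positivity)
  rw [ENNReal.ofReal_mul (by norm_num), coulomb, ofReal_integral_eq_lintegral_ofReal hJ hnn,
    lintegral_prod _ hJ.1.aemeasurable.ennreal_ofReal, selfEnergy]
  congr 1
  rw [one_div, ENNReal.ofReal_inv_of_pos (by norm_num)]
  simp

lemma coulomb_self_nonneg_of_inClass {f : E3 → ℝ} (hf : InClass Φ M f) : 0 ≤ coulomb f f :=
  coulomb_nonneg hf.nonneg hf.nonneg

lemma reducedEnergy_eq (hΦ : Admissible Φ) {f : E3 → ℝ} (hf : InClass Φ M f) :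
    reducedEnergy Φ f = (redEnergy Φ f : EReal) := by
  have h1 := coulomb_self_nonneg_of_inClass hf
  rw [reducedEnergy, internalEnergy_eq hΦ hf, selfEnergy_eq hΦ hf,
    EReal.coe_ennreal_ofReal, EReal.coe_ennreal_ofReal, max_eq_left (hf.phiInt_nonneg hΦ),
    max_eq_left (by positivity), redEnergy, EReal.coe_sub]

lemma mem_minimizers_iff (hΦ : Admissible Φ) {f : E3 → ℝ} :
    f ∈ minimizers Φ M ↔ InClass Φ M f ∧ redEnergy Φ f = infEnergy Φ M := by
  constructor
  · rintro ⟨h1, h2⟩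
    have hf := (mem_constraintSet_iff hΦ).1 h1
    refine ⟨hf, le_antisymm (le_csInf ⟨_, f, hf, rfl⟩ ?_) (infEnergy_le hΦ hf)⟩
    rintro _ ⟨g, hg, rfl⟩
    have := h2 g ((mem_constraintSet_iff hΦ).2 hg)
    rw [reducedEnergy_eq hΦ hf, reducedEnergy_eq hΦ hg] at this
    exact_mod_cast this
  · rintro ⟨hf, h⟩
    refine ⟨(mem_constraintSet_iff hΦ).2 hf, fun g hg => ?_⟩
    have hg' := (mem_constraintSet_iff hΦ).1 hg
    rw [reducedEnergy_eq hΦ hf, reducedEnergy_eq hΦ hg', h]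
    exact_mod_cast infEnergy_le hΦ hg'

lemma integral_potential_mul {f g : E3 → ℝ} (hf : IsDensity f) (hg : IsDensity g) :
    Integrable (fun x => potential f x * g x) ∧ ∫ x, potential f x * g x = -coulomb f g := by
  have e : ∀ x, potential f x * g x = -∫ y, coulombIntegrand g f (x, y) := by
    intro x
    have : ∫ y, coulombIntegrand g f (x, y) = g x * ∫ y, f y / ‖x - y‖ := by
      rw [← integral_const_mul]
      congr 1; ext y; simp only [coulombIntegrand]; ring
    rw [this, potential]; ring
  have hJ := hasCoulomb hg hf
  constructor
  · simp only [e]; exact (Integrable.integral_prod_left hJ).neg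
  · simp only [e]
    rw [integral_neg, coulomb_comm, coulomb, integral_prod _ hJ]

/-- The multiplier is integrated against f - g, whose integral vanishes as the masses agree. Its
value is therefore immaterial. -/
lemma dFun_eq (hΦ : Admissible Φ) {f g : E3 → ℝ} (hf : InClass Φ M f) (hg : InClass Φ M g) :
    dFun Φ f g = phiInt Φ f - phiInt Φ g - coulomb g (f - g) := by
  have df := hf.isDensity hΦ
  have dg := hg.isDensity hΦ
  obtain ⟨i1, v1⟩ := integral_potential_mul dg (df.sub dg)
  have i2 : Integrable (fun x => multiplier Φ g * (f - g) x) :=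
    (df.sub dg).integrable.const_mul _
  have i3 : Integrable (fun x => Φ (f x) - Φ (g x)) := hf.integrable_comp.sub hg.integrable_comp
  have i4 : Integrable (fun x => potential g x * (f - g) x - multiplier Φ g * (f - g) x) :=
    i1.sub i2
  have e : ∀ x, Φ (f x) - Φ (g x) + (potential g x - multiplier Φ g) * (f x - g x) =
      (Φ (f x) - Φ (g x)) + (potential g x * (f - g) x - multiplier Φ g * (f - g) x) := by
    intro x; simp only [Pi.sub_apply]; ring
  have hz : ∫ x, (f - g) x = 0 := by
    rw [integral_sub' hf.integrable hg.integrable, hf.integral_eq, hg.integral_eq, sub_self]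
  rw [dFun]
  simp only [e]
  rw [integral_add i3 i4, integral_sub i1 i2, v1, integral_const_mul, hz,
    integral_sub hf.integrable_comp hg.integrable_comp, phiInt, phiInt]
  ring

lemma coulomb_sub_self_nonneg (hΦ : Admissible Φ) {f g : E3 → ℝ} (hf : InClass Φ M f)
    (hg : InClass Φ M g) : 0 ≤ coulomb (f - g) (f - g) := by
  have hd := (hf.isDensity hΦ).sub (hg.isDensity hΦ)
  exact coulomb_self_nonneg hd.integrable (hasCoulomb hd hd)

lemma fieldDist_sq_eq (hΦ : Admissible Φ) {f g : E3 → ℝ} (hf : InClass Φ M f)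
    (hg : InClass Φ M g) :
    fieldDist f g ^ 2 = ENNReal.ofReal (4 * Real.pi * coulomb (f - g) (f - g)) := by
  have hd := (hf.isDensity hΦ).sub (hg.isDensity hΦ)
  exact fieldDist_sq hf.integrable hg.integrable (hasCoulomb hd hd)

/-- Expanding J(f,f) around g shows that d(f,g) is the difference of the reduced energies plus
½J(f-g,f-g); the field term supplies the other half. Minimality of g plays no role. -/
lemma distTo_eq (hΦ : Admissible Φ) {f g : E3 → ℝ} (hf : InClass Φ M f) (hg : InClass Φ M g)
    (u : E3 → E3) : distTo Φ f u g =
      ((redEnergy Φ f - redEnergy Φ g + coulomb (f - g) (f - g) : ℝ) : EReal) +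
        (kineticEnergy f u : EReal) := by
  have h0 := coulomb_sub_self_nonneg hΦ hf hg
  have hpi := Real.pi_pos
  have e : ENNReal.ofReal (1 / (8 * Real.pi)) * fieldDist f g ^ 2 =
      ENNReal.ofReal (1 / 2 * coulomb (f - g) (f - g)) := by
    rw [fieldDist_sq_eq hΦ hf hg, ← ENNReal.ofReal_mul (by positivity)]
    congr 1; field_simp; ring
  rw [distTo, e, EReal.coe_ennreal_ofReal, max_eq_left (by positivity), ← EReal.coe_add,
    dFun_eq hΦ hf hg]
  congr 2
  have h := coulomb_add_self (hg.isDensity hΦ) ((hf.isDensity hΦ).sub (hg.isDensity hΦ))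
  rw [add_sub_cancel] at h
  rw [redEnergy, redEnergy, h]
  ring

lemma energy_eq (hΦ : Admissible Φ) {f : E3 → ℝ} (hf : InClass Φ M f) {u : E3 → E3}
    (hk : kineticEnergy f u ≠ ⊤) :
    energy Φ f u = ((redEnergy Φ f + (kineticEnergy f u).toReal : ℝ) : EReal) := by
  have h1 := coulomb_self_nonneg_of_inClass hf
  have h2 := hf.phiInt_nonneg hΦ
  rw [energy, EReal.coe_ennreal_add, internalEnergy_eq hΦ hf, selfEnergy_eq hΦ hf,
    EReal.coe_ennreal_ofReal, EReal.coe_ennreal_ofReal, max_eq_left h2,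
    max_eq_left (by positivity), ← EReal.coe_ennreal_toReal hk, ← EReal.coe_add, ← EReal.coe_sub,
    redEnergy]
  congr 1; ring

/-- This carries membership in the constraint class from time 0 to time t, the conserved energy
being finite at time 0. -/
lemma inClass_of_mass_energy (hΦ : Admissible Φ) (hM : 0 < M) {f : E3 → ℝ} {u : E3 → E3}
    (hm : AEStronglyMeasurable f volume) (h0 : 0 ≤ᵐ[volume] f) (hmass : mass f = ENNReal.ofReal M)
    {e : ℝ} (he : energy Φ f u = (e : EReal)) :
    InClass Φ M f ∧ kineticEnergy f u ≠ ⊤ := by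
  have hint : Integrable f := ⟨hm, by
    rw [hasFiniteIntegral_iff_ofReal h0]
    change mass f < ⊤
    rw [hmass]; exact ENNReal.ofReal_lt_top⟩
  have hM' : ∫ x, f x = M := by
    rw [integral_eq_lintegral_of_nonneg_ae h0 hm]
    change (mass f).toReal = M
    rw [hmass, ENNReal.toReal_ofReal hM.le]
  have hfin : kineticEnergy f u + internalEnergy Φ f ≠ ⊤ := by
    intro h
    rw [energy, h, EReal.coe_ennreal_top] at he
    -- In `EReal`, ⊤ - ⊤ = ⊥ and ⊤ minus a real is ⊤, so neither case can give the real value e.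
    by_cases hs : selfEnergy f = ⊤
    · rw [hs, EReal.coe_ennreal_top, EReal.sub_top] at he
      exact EReal.bot_ne_coe e he
    · rw [← EReal.coe_ennreal_toReal hs, EReal.top_sub_coe] at he
      exact EReal.top_ne_coe e he
  rw [ENNReal.add_ne_top] at hfin
  exact ⟨(mem_constraintSet_iff hΦ).1 ⟨hint, h0, hfin.2.lt_top, hM'⟩, hfin.1⟩

lemma mass_eq {f : E3 → ℝ} (hf : InClass Φ M f) : mass f = ENNReal.ofReal M := by
  rw [← hf.integral_eq, ofReal_integral_eq_lintegral_ofReal hf.integrable hf.nonneg, mass]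

/-- Along a solution preserving mass and energy, the distance to a minimizer is controlled by the
Coulomb norm of the difference, up to the conserved energy excess. -/
lemma exists_excess (hΦ : Admissible Φ) (hM : 0 < M) {P : ℝ → ℝ} {I : Set ℝ}
    {ρ : ℝ → E3 → ℝ} {u : ℝ → E3 → E3} (hsol : IsSolution P I ρ u)
    (h0 : ρ 0 ∈ constraintSet Φ M) (hpres : PreservesMassEnergy Φ I ρ u) {δ : ℝ} {σ : E3 → ℝ}
    (hσ : σ ∈ minimizers Φ M) (hlt : distTo Φ (ρ 0) (u 0) σ < (δ : EReal)) :
    ∃ e : ℝ, 0 ≤ e ∧ e < δ ∧ ∀ t ∈ I, InClass Φ M (ρ t) ∧ redEnergy Φ (ρ t) ≤ infEnergy Φ M + e ∧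
      ∀ τ ∈ minimizers Φ M, distTo Φ (ρ t) (u t) τ =
        ((e + coulomb (ρ t - τ) (ρ t - τ) : ℝ) : EReal) := by
  have hc0 := (mem_constraintSet_iff hΦ).1 h0
  obtain ⟨hσc, hσE⟩ := (mem_minimizers_iff hΦ).1 hσ
  have hk0 : kineticEnergy (ρ 0) (u 0) ≠ ⊤ := by
    intro h
    rw [distTo_eq hΦ hc0 hσc, h, EReal.coe_ennreal_top, EReal.coe_add_top] at hlt
    exact not_top_lt hlt
  have hE0 := energy_eq hΦ hc0 hk0
  -- The conserved excess of the total energy over the infimum of the reduced energy.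
  set e := redEnergy Φ (ρ 0) + (kineticEnergy (ρ 0) (u 0)).toReal - infEnergy Φ M with he
  have hkin : 0 ≤ (kineticEnergy (ρ 0) (u 0)).toReal := ENNReal.toReal_nonneg
  refine ⟨e, ?_, ?_, fun t ht => ?_⟩
  · have := infEnergy_le hΦ hc0
    linarith
  · have h1 := coulomb_sub_self_nonneg hΦ hc0 hσc
    rw [distTo_eq hΦ hc0 hσc, ← EReal.coe_ennreal_toReal hk0, ← EReal.coe_add,
      EReal.coe_lt_coe_iff] at hlt
    linarith
  · obtain ⟨G, hG⟩ := hsol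
    obtain ⟨hm, hen⟩ := hpres t ht
    obtain ⟨hct, hkt⟩ := inClass_of_mass_energy hΦ hM (hG.measurable_density t ht)
      (hG.density_nonneg t ht) (hm.trans (mass_eq hc0)) (hen.trans hE0)
    have hEt := energy_eq hΦ hct hkt
    rw [hen, hE0, EReal.coe_eq_coe_iff] at hEt
    have hkin' : 0 ≤ (kineticEnergy (ρ t) (u t)).toReal := ENNReal.toReal_nonneg
    refine ⟨hct, by linarith, fun τ hτ => ?_⟩
    obtain ⟨hτc, hτE⟩ := (mem_minimizers_iff hΦ).1 hτ
    rw [distTo_eq hΦ hct hτc, ← EReal.coe_ennreal_toReal hkt, ← EReal.coe_add, hτE]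
    congr 1; linarith

lemma shift_mem_minimizers (hΦ : Admissible Φ) {σ : E3 → ℝ} (hσ : σ ∈ minimizers Φ M) (a : E3) :
    shift a σ ∈ minimizers Φ M := by
  rw [mem_minimizers_iff hΦ] at hσ ⊢
  exact ⟨hσ.1.shift a, by rw [redEnergy_shift, hσ.2]⟩

lemma fieldDist_comm (f g : E3 → ℝ) : fieldDist f g = fieldDist g f := by
  rw [fieldDist, fieldDist, eLpNorm_sub_comm]

lemma fieldDist_shift (hΦ : Admissible Φ) {f g : E3 → ℝ} (hf : InClass Φ M f) (hg : InClass Φ M g)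
    (a : E3) : fieldDist (shift a f) (shift a g) = fieldDist f g := by
  have h1 := fieldDist_sq_eq hΦ hf hg
  have h2 := fieldDist_sq_eq hΦ (hf.shift a) (hg.shift a)
  rw [← shift_sub, coulomb_shift, ← h1] at h2
  exact (ENNReal.pow_right_strictMono two_ne_zero).injective h2

/-- A minimizer isolated up to shifts has a positive distance to densities close to other
minimizers. -/
lemma le_coulomb_of_isolated (hΦ : Admissible Φ) {ρ₀ σ f : E3 → ℝ} (hρ₀ : ρ₀ ∈ minimizers Φ M)
    {d : ℝ} (hd : 0 < d) (hiso : ENNReal.ofReal d ≤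
      ⨅ σ ∈ {σ ∈ minimizers Φ M | ¬ ∃ a : E3, σ =ᵐ[volume] shift a ρ₀}, fieldDist ρ₀ σ)
    (hσ : σ ∈ minimizers Φ M) (hns : ¬ ∃ a : E3, σ =ᵐ[volume] shift a ρ₀) (hf : InClass Φ M f)
    (hnear : coulomb (f - σ) (f - σ) ≤ d ^ 2 / (16 * Real.pi)) (a : E3) :
    d ^ 2 / (16 * Real.pi) ≤ coulomb (f - shift a ρ₀) (f - shift a ρ₀) := by
  have hpi := Real.pi_pos
  have hσc := ((mem_minimizers_iff hΦ).1 hσ).1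
  have hρc := ((mem_minimizers_iff hΦ).1 hρ₀).1
  -- Isolation is stated for ρ₀ itself, so the comparison with a shift of ρ₀ is made after moving σ
  -- back by the same vector.
  have hmem : shift (-a) σ ∈ {σ ∈ minimizers Φ M | ¬ ∃ a : E3, σ =ᵐ[volume] shift a ρ₀} := by
    refine ⟨shift_mem_minimizers hΦ hσ _, ?_⟩
    rintro ⟨b, hb⟩
    refine hns ⟨a + b, ?_⟩
    have := (measurePreserving_add_right volume a).quasiMeasurePreserving.ae hb
    filter_upwards [this] with x hx
    simpa [shift, add_assoc] using hx
  have h1 : ENNReal.ofReal d ≤ fieldDist (shift a ρ₀) σ := by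
    have := hiso.trans (iInf₂_le _ hmem)
    rwa [← fieldDist_shift hΦ hρc (hσc.shift (-a)) a, shift_neg_shift] at this
  -- In terms of the field distance, J ≤ d²/(16π) reads at most d/2. The triangle inequality then
  -- leaves at least d/2 between f and the shift of ρ₀.
  have h2 : fieldDist f σ ≤ ENNReal.ofReal (d / 2) := by
    rw [← (ENNReal.pow_right_strictMono two_ne_zero).le_iff_le, fieldDist_sq_eq hΦ hf hσc,
      ← ENNReal.ofReal_pow (by positivity)]
    refine ENNReal.ofReal_le_ofReal ?_
    calc 4 * Real.pi * coulomb (f - σ) (f - σ) ≤ 4 * Real.pi * (d ^ 2 / (16 * Real.pi)) := by gcongr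
      _ = (d / 2) ^ 2 := by field_simp; norm_num
  have h3 := fieldDist_triangle (hρc.shift a).integrable hf.integrable hσc.integrable
  have h4 : ENNReal.ofReal (d / 2) ≤ fieldDist f (shift a ρ₀) := by
    rw [fieldDist_comm]
    have h5 : ENNReal.ofReal (d / 2) + ENNReal.ofReal (d / 2) ≤
        fieldDist (shift a ρ₀) f + ENNReal.ofReal (d / 2) := by
      rw [← ENNReal.ofReal_add (by positivity) (by positivity), add_halves]
      exact (h1.trans h3).trans (by gcongr)
    exact (ENNReal.add_le_add_iff_right ENNReal.ofReal_ne_top).1 h5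
  rw [← (ENNReal.pow_right_strictMono two_ne_zero).le_iff_le, fieldDist_sq_eq hΦ hf (hρc.shift a),
    ← ENNReal.ofReal_pow (by positivity), ENNReal.ofReal_le_ofReal_iff
      (mul_nonneg (by positivity) (coulomb_sub_self_nonneg hΦ hf (hρc.shift a)))] at h4
  rw [div_le_iff₀ (by positivity)]
  linarith

end EulerPoisson

/-! ### The stability theorem. -/

theorem mainTheorem3 (Φ : ℝ → ℝ) (hΦ : EulerPoisson.Admissible Φ) (M : ℝ) (hM : 0 < M) :
    (∀ ε : ℝ, 0 < ε → ∃ δ : ℝ, 0 < δ ∧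
      ∀ (I : Set ℝ) (ρ : ℝ → EulerPoisson.E3 → ℝ) (u : ℝ → EulerPoisson.E3 → EulerPoisson.E3),
        EulerPoisson.IsSolution (EulerPoisson.pressure Φ) I ρ u →
        ρ 0 ∈ EulerPoisson.constraintSet Φ M →
        EulerPoisson.PreservesMassEnergy Φ I ρ u →
        (⨅ ρ₀ ∈ EulerPoisson.minimizers Φ M,
          EulerPoisson.distTo Φ (ρ 0) (u 0) ρ₀) < (δ : EReal) →
        ∀ t ∈ I, (⨅ ρ₀ ∈ EulerPoisson.minimizers Φ M,
          EulerPoisson.distTo Φ (ρ t) (u t) ρ₀) < (ε : EReal)) ∧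
    (∀ ρ₀ ∈ EulerPoisson.minimizers Φ M, EulerPoisson.IsolatedUpToShifts Φ M ρ₀ →
      ∀ ε : ℝ, 0 < ε → ∃ δ : ℝ, 0 < δ ∧
        ∀ (I : Set ℝ) (ρ : ℝ → EulerPoisson.E3 → ℝ) (u : ℝ → EulerPoisson.E3 → EulerPoisson.E3),
          EulerPoisson.IsSolution (EulerPoisson.pressure Φ) I ρ u →
          ρ 0 ∈ EulerPoisson.constraintSet Φ M →
          EulerPoisson.PreservesMassEnergy Φ I ρ u →
          ContinuousOn (fun t : ℝ => ⨅ a : EulerPoisson.E3,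
            EulerPoisson.distTo Φ (ρ t) (u t) (EulerPoisson.shift a ρ₀)) I →
          EulerPoisson.distTo Φ (ρ 0) (u 0) ρ₀ < (δ : EReal) →
          ∀ t ∈ I, ∃ a : EulerPoisson.E3,
            EulerPoisson.distTo Φ (ρ t) (u t) (EulerPoisson.shift a ρ₀) < (ε : EReal)) := by
  open EulerPoisson in
  constructor
  · intro ε hε
    obtain ⟨δ, hδ, hcomp⟩ := exists_near_minimizer hΦ hM (half_pos hε)
    -- The distance at time t is e + J: the excess e is below ε/2 by conservation and J by
    -- compactness, whose hypothesis is e < δ.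
    refine ⟨min δ (ε / 2), lt_min hδ (half_pos hε), fun I ρ u hsol h0 hpres hinit t ht => ?_⟩
    obtain ⟨σ, hσ⟩ := iInf_lt_iff.1 hinit
    obtain ⟨hσm, hσ⟩ := iInf_lt_iff.1 hσ
    obtain ⟨e, he0, he, hall⟩ := exists_excess hΦ hM hsol h0 hpres hσm hσ
    obtain ⟨hct, hEt, hdist⟩ := hall t ht
    obtain ⟨g, hg, hgE, hgd⟩ := hcomp (ρ t) hct (by
      have := he.trans_le (min_le_left _ _); linarith)
    have hgm : g ∈ minimizers Φ M := (mem_minimizers_iff hΦ).2 ⟨hg, hgE⟩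
    refine (iInf₂_le g hgm).trans_lt ?_
    rw [hdist g hgm, EReal.coe_lt_coe_iff]
    have := he.trans_le (min_le_right _ _)
    linarith
  · intro ρ₀ hρ₀ hiso ε hε
    obtain ⟨d, hd, hdiso⟩ : ∃ d : ℝ, 0 < d ∧ ENNReal.ofReal d ≤
        ⨅ σ ∈ {σ ∈ minimizers Φ M | ¬ ∃ a : E3, σ =ᵐ[volume] shift a ρ₀}, fieldDist ρ₀ σ := by
      obtain ⟨q, hq0, hq⟩ := ENNReal.lt_iff_exists_nnreal_btwn.1 hiso
      refine ⟨q, by exact_mod_cast hq0, ?_⟩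
      rw [ENNReal.ofReal_coe_nnreal]
      exact hq.le
    have hpi := Real.pi_pos
    set c := d ^ 2 / (16 * Real.pi) with hc
    have hc0 : 0 < c := by positivity
    -- Keeping η strictly below c leaves a nonempty range [η, c) of forbidden values for the
    -- distance to the orbit of ρ₀.
    set η := min ε (c / 2) with hη
    have hη0 : 0 < η := lt_min hε (by positivity)
    have hηc : η < c := (min_le_right _ _).trans_lt (by linarith)
    obtain ⟨δ, hδ, hcomp⟩ := exists_near_minimizer hΦ hM (half_pos hη0)
    refine ⟨min δ (η / 2), lt_min hδ (half_pos hη0), fun I ρ u hsol h0 hpres hcont hinit => ?_⟩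
    obtain ⟨e, he0, he, hall⟩ := exists_excess hΦ hM hsol h0 hpres hρ₀ hinit
    have he1 := he.trans_le (min_le_left _ _)
    have he2 := he.trans_le (min_le_right _ _)
    -- At each time there is a minimizer within η/2 in J. If it is a shift of ρ₀, adding e < η/2
    -- stays below η; otherwise isolation keeps every shift of ρ₀ at distance at least c.
    have hgap : ∀ t ∈ I, (⨅ a : E3, distTo Φ (ρ t) (u t) (shift a ρ₀)) < (η : EReal) ∨
        (c : EReal) ≤ ⨅ a : E3, distTo Φ (ρ t) (u t) (shift a ρ₀) := by
      intro t ht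
      obtain ⟨hct, hEt, hdist⟩ := hall t ht
      obtain ⟨g, hg, hgE, hgd⟩ := hcomp (ρ t) hct (by linarith)
      have hgm : g ∈ minimizers Φ M := (mem_minimizers_iff hΦ).2 ⟨hg, hgE⟩
      by_cases hs : ∃ a : E3, g =ᵐ[volume] shift a ρ₀
      · obtain ⟨a, ha⟩ := hs
        left
        refine (iInf_le _ a).trans_lt ?_
        have hcg : ρ t - g =ᵐ[volume] ρ t - shift a ρ₀ := (Filter.EventuallyEq.refl _ _).sub ha
        rw [hdist _ (shift_mem_minimizers hΦ hρ₀ a), ← coulomb_congr hcg hcg,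
          EReal.coe_lt_coe_iff]
        linarith
      · right
        refine le_iInf fun a => ?_
        rw [hdist _ (shift_mem_minimizers hΦ hρ₀ a), EReal.coe_le_coe_iff]
        have := le_coulomb_of_isolated hΦ hρ₀ hd hdiso hgm hs hct (by linarith) a
        linarith
    have hzero : (0 : ℝ) ∈ I := hsol.choose_spec.zero_mem
    have hpre : IsPreconnected I := hsol.choose_spec.ordConnected.isPreconnected
    intro t ht
    have hsmall : (⨅ a : E3, distTo Φ (ρ t) (u t) (shift a ρ₀)) < (η : EReal) := by
      refine (hgap t ht).resolve_right fun hbig => ?_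
      have hstart : (⨅ a : E3, distTo Φ (ρ 0) (u 0) (shift a ρ₀)) ≤ (η : EReal) := by
        refine (iInf_le _ 0).trans ?_
        have hs0 : shift 0 ρ₀ = ρ₀ := by ext x; simp [shift]
        rw [hs0]
        refine hinit.le.trans (EReal.coe_le_coe_iff.2 ?_)
        exact (min_le_right _ _).trans (by linarith)
      -- Passing from below the gap to above it, the continuous distance would have to take the
      -- forbidden value η.
      obtain ⟨s, hs, hseq⟩ := hpre.intermediate_value hzero ht hcont
        ⟨hstart, (EReal.coe_le_coe_iff.2 hηc.le).trans hbig⟩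
      simp only at hseq
      rcases hgap s hs with h | h
      · exact absurd hseq h.ne
      · rw [hseq, EReal.coe_le_coe_iff] at h
        linarith
    obtain ⟨a, ha⟩ := iInf_lt_iff.1 hsmall
    exact ⟨a, ha.trans_le (EReal.coe_le_coe_iff.2 (min_le_left _ _))⟩

end
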